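/- Let $m,n\ge 1$, $N=mn$, and consider $\min_{x\in\mathbb R^d}P(x):=\frac1N\sum_{\tau=1}^n\sum_{i=1}^m\phi_{i\tau}(A_{i\tau}^\top x)+g(x)$, where $A_{i\tau}\in\mathbb R^{d\times t}$, each $\phi_{i\tau}:\mathbb R^t\to\mathbb R$ is convex, $1/\gamma$-smooth and bounded below ($\gamma>0$), and $g:\mathbb R^d\to\mathbb R$ is $\lambda$-strongly convex ($\lambda>0$). Put $R_m=\max_{i,\tau}\|A_{i\tau}\|$, $\bar R^2=\max_\tau\frac1m\lambda_{\max}(\sum_iA_{i\tau}A_{i\tau}^\top)$, $R^2=\frac1N\lambda_{\max}(\sum_{\tau,i}A_{i\tau}A_{i\tau}^\top)$. Let $Q$ be a randomized map on $\mathbb R^d$ with $\mathbb E\|x-Q(x)\|^2\le(1-\delta)\|x\|^2$ and $\mathbb E[Q(x)]=\delta x$ for all $x$, where $0<\delta<1$. **Outer loop (Catalyst).** Let $\kappa\ge0$, $\tilde\lambda=\lambda+\kappa$, $q=\lambda/\tilde\lambda$, $0\le\rho_0<\sqrt q$, $P^*=\min P$, $x^0=y^0$ with $P(x^0)>P^*$,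 $\varepsilon_k=\frac29(P(x^0)-P^*)(1-\rho_0)^k$, $c_0=\sqrt q$, $c_k>0$ the solution of $c_k^2=(1-c_k)c_{k-1}^2+qc_k$, $\beta_k=\frac{c_{k-1}(1-c_{k-1})}{c_{k-1}^2+c_k}$. For $k\ge1$ let $G_k(x)=P(x)+\frac\kappa2\|x-y^{k-1}\|^2$, $G_k^*=\min G_k$, $\xi_k(x)=\tilde\lambda^{-1}\big(g(x)+\frac\kappa2\|x-y^{k-1}\|^2\big)$, $v(\alpha)=\frac1{\tilde\lambda N}\sum_{\tau,i}A_{i\tau}\alpha_{i\tau}$, and $D_k(\alpha)=-\frac1N\sum_{\tau,i}\phi_{i\tau}^*(-\alpha_{i\tau})-\tilde\lambda\,\xi_k^*(v(\alpha))$. From $x^k$ (obtained below), $y^k=x^k+\beta_k(x^k-x^{k-1})$. **Inner loop (EC-SDCA on $G_k$).** Start from $\alpha^0_{(k)}=\alpha^{k-1}$ (with $\alpha^0=0$), $u^0_{(k)}=v(\alpha^0_{(k)})$, $e^0_{\tau,(k)}=0$. For $K=0,1,\dots$ let $x^{K+1}_{(k)}=\nabla\xi_k^*(u^K_{(k)})$;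 each node $\tau$ samples $i=i_K^\tau$ uniformly from $[m]$, sets $\Delta_\tau=-\theta m\big(\alpha_{i\tau}^K+\nabla\phi_{i\tau}(A_{i\tau}^\top x^{K+1})\big)$, adds $\Delta_\tau$ to $\alpha_{i\tau}$ (other coordinates unchanged), and with $w_\tau=\frac1{\tilde\lambda m}A_{i\tau}\Delta_\tau+e^K_\tau$ sets $e^{K+1}_\tau=w_\tau-Q(w_\tau)$; then $u^{K+1}=u^K+\frac1n\sum_\tau Q(w_\tau)$. All samples and all applications of $Q$ (over outer iterations, inner iterations and nodes) are independent. With $M=\sqrt{2R^2+(16\bar R^2+9\delta R_m^2)/n}$ the stepsize is given by $$\frac1\theta=m+\frac{R^2+R_m^2/n}{\gamma\tilde\lambda}+\frac{4\sqrt{1-\delta}\,RM}{\delta\gamma\tilde\lambda}+\frac{2\sqrt{1-\delta}\,M}{\delta\sqrt{\gamma\tilde\lambda}}.$$ Let $\rho=\frac{\delta\tilde\lambda R}{2\sqrt{1-\delta}\,M}$ ($\rho=0$ if $R=0$), $e^K=\frac1n\sum_\tau e^K_\tau$, and $$\Psi^K_{4,(k)}=G_k^*-D_k(\alpha^K_{(k)})+\frac{2(\rho+\theta\tilde\lambda)}{\delta}\|e^K_{(k)}\|^2+\frac{16(1-\delta)(\rho+\theta\tilde\lambda)}{\delta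 n^2}\sum_{\tau=1}^n\|e^K_{\tau,(k)}\|^2 .$$ The inner loop stops at $T_k=\inf\{K\ge1:\ 3\sqrt{2+\delta m}\,\Psi^K_{4,(k)}+2(G_k(x^{K+1}_{(k)})-G_k^*)\le\varepsilon_k\}$ and outputs $(x^k,\alpha^k)=(x^{T_k+1}_{(k)},\alpha^{T_k}_{(k)})$. **Claim.** $\mathbb E[T_k]\le\tilde{\mathcal O}\big(\frac1\delta+m+\frac{a_4}{\lambda+\kappa}\big)$ with $a_4=\frac{R_m^2}{n\gamma}+\frac{R^2}{\gamma}+\frac{\sqrt{1-\delta}R^2}{\delta\gamma}$. Precisely, let $$\Lambda=1+\log\Big(\frac N\delta\cdot\Big(1+\frac{R^2}{\gamma(\lambda+\kappa)}\Big)\cdot\frac{\lambda+\kappa}{\lambda}\cdot\frac1{\sqrt q-\rho_0}\Big).$$ There is a universal constant $C>0$ such that, in every such situation, $$\mathbb E[T_k]\le C\Big(\frac1\delta+m+\frac{a_4}{\lambda+\kappa}\Big)\Lambda\quad(k\ge2),\qquad \mathbb E[T_1]\le C\Big(\frac1\delta+m+\frac{a_4}{\lambda+\kappa}\Big)\Big(\Lambda+\log\Big(1+\frac{G_1^*-D_1(0)}{P(x^0)-P^*}\Big)\Big).$$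 -/

import Mathlib

open MeasureTheory ProbabilityTheory
open scoped ENNReal

namespace ECSDCA

noncomputable section

/-- The Euclidean space `ℝ^d`. -/
abbrev Vec (d : ℕ) := EuclideanSpace ℝ (Fin d)

/-- The Fenchel conjugate `f^*(y) = sup_x (⟪x, y⟫ - f x)`, with values in `[-∞, +∞]`. -/
def conj {d : ℕ} (f : Vec d → ℝ) (y : Vec d) : EReal :=
  ⨆ x : Vec d, ((inner ℝ x y - f x : ℝ) : EReal)

/-- The gradient of the Fenchel conjugate. (It is used only for strongly convex `f : ℝ^d → ℝ`,
whose conjugate is finite and differentiable everywhere.) -/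
def gradConj {d : ℕ} (f : Vec d → ℝ) (u : Vec d) : Vec d :=
  gradient (fun v => (conj f v).toReal) u

/-- The largest eigenvalue of a linear operator on `ℝ^d`. -/
def lambdaMax {d : ℕ} (B : Vec d →L[ℝ] Vec d) : ℝ :=
  sSup {μ : ℝ | Module.End.HasEigenvalue (B : Vec d →ₗ[ℝ] Vec d) μ}

/-- `f` is convex and `L`-smooth: convex, differentiable, with `L`-Lipschitz gradient. -/
structure ConvexSmooth {t : ℕ} (f : Vec t → ℝ) (L : ℝ) : Prop where
  convex : ConvexOn ℝ Set.univ f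
  differentiable : Differentiable ℝ f
  lipschitz : ∀ x y, ‖gradient f x - gradient f y‖ ≤ L * ‖x - y‖

/-- A randomized map `Q`, whose internal randomness has law `ν`, is a contraction compressor with
parameter `δ`: `E‖x - Q(x)‖² ≤ (1 - δ)‖x‖²` for all `x`. -/
structure IsContractionCompressor {d : ℕ} {Ξ : Type*} [MeasurableSpace Ξ] (ν : Measure Ξ)
    (Q : Ξ → Vec d → Vec d) (δ : ℝ) : Prop where
  measurable : Measurable (fun p : Ξ × Vec d => Q p.1 p.2)
  pos : 0 < δ
  le_one : δ ≤ 1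
  integrable : ∀ x, Integrable (fun ξ => ‖x - Q ξ x‖ ^ 2) ν
  contraction : ∀ x, ∫ ξ, ‖x - Q ξ x‖ ^ 2 ∂ν ≤ (1 - δ) * ‖x‖ ^ 2

/-- The data of the problem `min_x P(x) = (1/N) ∑_{τ,i} φ_{iτ}(A_{iτ}ᵀ x) + g(x)`, `N = m n`, and of
the method. The matrices `A_{iτ} ∈ ℝ^{d × t}` are written as linear maps `ℝ^t → ℝ^d` and both `A`
and `φ` take the node `τ` first. `lam` is the strong convexity parameter of `g`, `1/γ` the
smoothness parameter of the `φ_{iτ}`, `κ` and `ρ₀` the parameters of Catalyst, `x₀` its starting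
point, and `Q` the compressor with parameter `δ`. -/
structure Setup (d t m n : ℕ) (Ξ : Type*) where
  A : Fin n → Fin m → (Vec t →L[ℝ] Vec d)
  φ : Fin n → Fin m → Vec t → ℝ
  g : Vec d → ℝ
  lam : ℝ
  γ : ℝ
  κ : ℝ
  ρ₀ : ℝ
  x₀ : Vec d
  δ : ℝ
  Q : Ξ → Vec d → Vec d

/-- The variables of EC-SDCA: dual variables `α_{iτ}`, the vector `u`, the errors `e_τ`. -/
structure InnerState (d t m n : ℕ) where
  α : Fin n → Fin m → Vec t
  u : Vec d
  e : Fin n → Vec d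

/-- The variables `(x^k, y^k, α^k)` of the outer loop. -/
structure OuterState (d t m n : ℕ) where
  x : Vec d
  y : Vec d
  α : Fin n → Fin m → Vec t

/-- The random draws of one outer iteration: for the inner step `K` and the node `τ`, the sampled
index `i_K^τ ∈ [m]` and the randomness of the compressor. -/
abbrev InnerDraws (m n : ℕ) (Ξ : Type*) := ℕ → Fin n → Fin m × Ξ

namespace Setup

variable {d t m n : ℕ} {Ξ : Type*} (S : Setup d t m n Ξ)

/-- `N = m n`. -/
def N (_S : Setup d t m n Ξ) : ℝ := (m : ℝ) * n

/-! ### Constants -/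

/-- `R_m = max_{i,τ} ‖A_{iτ}‖`. -/
def Rm : ℝ := ⨆ p : Fin n × Fin m, ‖S.A p.1 p.2‖

/-- `Rbar² = max_τ (1/m) λ_max(∑_i A_{iτ} A_{iτ}ᵀ)`. -/
def RbarSq : ℝ :=
  ⨆ τ : Fin n, (1 / (m : ℝ)) * lambdaMax (∑ i, (S.A τ i).comp (S.A τ i).adjoint)

/-- `R² = (1/N) λ_max(∑_{τ,i} A_{iτ} A_{iτ}ᵀ)`. -/
def RSq : ℝ := (1 / S.N) * lambdaMax (∑ τ, ∑ i, (S.A τ i).comp (S.A τ i).adjoint)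

/-- `λ + κ`, the strong convexity parameter of the subproblems. -/
def mu : ℝ := S.lam + S.κ

/-- `q = λ / (λ + κ)`. -/
def q : ℝ := S.lam / (S.lam + S.κ)

/-- `M² = 2R² + (16 Rbar² + 9 δ R_m²)/n`. -/
def MSq : ℝ := 2 * S.RSq + (16 * S.RbarSq + 9 * S.δ * S.Rm ^ 2) / n

/-- The weight `ρ = δ(λ+κ)R / (2 √(1-δ) M)` of the Lyapunov function. -/
def rho : ℝ := S.δ * S.mu * √S.RSq / (2 * √(1 - S.δ) * √S.MSq)

/-- The stepsize `θ` of EC-SDCA. -/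
def theta : ℝ :=
  (m + (S.RSq + S.Rm ^ 2 / n) / (S.γ * S.mu)
    + 4 * √(1 - S.δ) * √S.RSq * √S.MSq / (S.δ * S.γ * S.mu)
    + 2 * √(1 - S.δ) * √S.MSq / (S.δ * √(S.γ * S.mu)))⁻¹

/-- `a₄ = R_m²/(nγ) + R²/γ + √(1-δ) R²/(δγ)`. -/
def a₄ : ℝ :=
  S.Rm ^ 2 / (n * S.γ) + S.RSq / S.γ + √(1 - S.δ) * S.RSq / (S.δ * S.γ)

/-! ### Primal and dual functions -/

/-- `P(x) = (1/N) ∑ φ_{iτ}(A_{iτ}ᵀ x) + g(x)`. -/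
def P (x : Vec d) : ℝ :=
  (1 / S.N) * ∑ τ, ∑ i, S.φ τ i ((S.A τ i).adjoint x) + S.g x

/-- `P^* = min P`. -/
def Pmin : ℝ := ⨅ x, S.P x

/-- The objective `G(x) = P(x) + (κ/2)‖x - y‖²` of the subproblem with prox-center `y`. -/
def G (y x : Vec d) : ℝ := S.P x + S.κ / 2 * ‖x - y‖ ^ 2

/-- `G^* = min G`. -/
def Gmin (y : Vec d) : ℝ := ⨅ x, S.G y x

/-- The 1-strongly convex regularizer of the subproblem,
`ξ(x) = (g(x) + (κ/2)‖x - y‖²)/(λ+κ)`, so that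
`G(x) = (1/N) ∑ φ_{iτ}(A_{iτ}ᵀ x) + (λ+κ) ξ(x)`. -/
def xi (y x : Vec d) : ℝ := (S.g x + S.κ / 2 * ‖x - y‖ ^ 2) / S.mu

/-- `v(α) = (1/((λ+κ)N)) ∑ A_{iτ} α_{iτ}`. -/
def v (α : Fin n → Fin m → Vec t) : Vec d :=
  (1 / (S.mu * S.N)) • ∑ τ, ∑ i, S.A τ i (α τ i)

/-- The dual objective of the subproblem,
`D(α) = -(1/N) ∑ φ_{iτ}^*(-α_{iτ}) - (λ+κ) ξ^*(v(α))`. -/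
def D (y : Vec d) (α : Fin n → Fin m → Vec t) : EReal :=
  -(((1 / S.N : ℝ) : EReal) * ∑ τ, ∑ i, conj (S.φ τ i) (-(α τ i)))
    - (S.mu : EReal) * conj (S.xi y) (S.v α)

/-! ### EC-SDCA applied to the subproblem with prox-center `y` -/

/-- The primal iterate `x^{K+1} = ∇ξ^*(u^K)` computed from the state at step `K`. -/
def primal (y : Vec d) (s : InnerState d t m n) : Vec d := gradConj (S.xi y) s.u

/-- Start: `α^0` given, `u^0 = v(α^0)`, `e_τ^0 = 0`. -/
def innerInit (α : Fin n → Fin m → Vec t) : InnerState d t m n where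
  α := α
  u := S.v α
  e := 0

/-- The increment `Δα_{iτ} = -θ m (α_{iτ} + ∇φ_{iτ}(A_{iτ}ᵀ x^{K+1}))` of a sampled coordinate. -/
def dualStep (y : Vec d) (s : InnerState d t m n) (τ : Fin n) (i : Fin m) : Vec t :=
  -(S.theta * m) • s.α τ i
    - (S.theta * m) • gradient (S.φ τ i) ((S.A τ i).adjoint (S.primal y s))

/-- The vector `(1/((λ+κ)m)) A_{iτ} Δα_{iτ} + e_τ` that node `τ` compresses. -/
def message (y : Vec d) (s : InnerState d t m n) (τ : Fin n) (i : Fin m) : Vec d :=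
  (1 / (S.mu * m)) • S.A τ i (S.dualStep y s τ i) + s.e τ

/-- One iteration of EC-SDCA with the draws `w τ = (i^τ, randomness of Q at node τ)`. -/
def innerStep (y : Vec d) (w : Fin n → Fin m × Ξ) (s : InnerState d t m n) :
    InnerState d t m n where
  α τ := Function.update (s.α τ) (w τ).1 (s.α τ (w τ).1 + S.dualStep y s τ (w τ).1)
  u := s.u + (1 / (n : ℝ)) • ∑ τ, S.Q (w τ).2 (S.message y s τ (w τ).1)
  e τ := S.message y s τ (w τ).1 - S.Q (w τ).2 (S.message y s τ (w τ).1)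

/-- The state of EC-SDCA after `K` iterations. -/
def iter (y : Vec d) (α : Fin n → Fin m → Vec t) (w : InnerDraws m n Ξ) :
    ℕ → InnerState d t m n
  | 0 => S.innerInit α
  | K + 1 => S.innerStep y (w K) (iter y α w K)

/-- The Lyapunov function
`Ψ₄ = (G^* - D(α)) + (2(ρ+θ(λ+κ))/δ)‖e‖² + (16(1-δ)(ρ+θ(λ+κ))/(δn²)) ∑_τ ‖e_τ‖²`,
where `e = (1/n) ∑_τ e_τ`. -/
def Psi₄ (y : Vec d) (s : InnerState d t m n) : EReal :=
  ((S.Gmin y : EReal) - S.D y s.α)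
    + ((2 * (S.rho + S.theta * S.mu) / S.δ * ‖(1 / (n : ℝ)) • ∑ τ, s.e τ‖ ^ 2
        + 16 * (1 - S.δ) * (S.rho + S.theta * S.mu) / (S.δ * n ^ 2) * ∑ τ, ‖s.e τ‖ ^ 2 : ℝ) :
      EReal)

/-- The stopping criterion at tolerance `ε`:
`3 √(2+δm) Ψ₄^K + 2 (G(x^{K+1}) - G^*) ≤ ε`. -/
def Stop (y : Vec d) (ε : ℝ) (s : InnerState d t m n) : Prop :=
  ((3 * √(2 + S.δ * m) : ℝ) : EReal) * S.Psi₄ y s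
    + ((2 * (S.G y (S.primal y s) - S.Gmin y) : ℝ) : EReal) ≤ (ε : EReal)

/-- `inf {K ≥ 1 | the stopping criterion holds at step K}`, infinite if there is no such `K`. -/
def stopTime (y : Vec d) (α : Fin n → Fin m → Vec t) (ε : ℝ) (w : InnerDraws m n Ξ) : ℕ∞ :=
  ⨅ K ∈ {K : ℕ | 1 ≤ K ∧ S.Stop y ε (S.iter y α w K)}, (K : ℕ∞)

/-! ### Catalyst -/

/-- `ε_k = (2/9)(P(x^0) - P^*)(1 - ρ₀)^k`. -/
def eps (k : ℕ) : ℝ := 2 / 9 * (S.P S.x₀ - S.Pmin) * (1 - S.ρ₀) ^ k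

/-- The extrapolation sequence of Catalyst: `a_0 = √q`, and `a_{k+1}` is the positive root of
`a² = (1 - a) a_k² + q a`. -/
def catA : ℕ → ℝ
  | 0 => √S.q
  | k + 1 => (S.q - catA k ^ 2 + √((S.q - catA k ^ 2) ^ 2 + 4 * catA k ^ 2)) / 2

/-- `catB k = β_{k+1} = a_k (1 - a_k) / (a_k² + a_{k+1})`. -/
def catB (k : ℕ) : ℝ := S.catA k * (1 - S.catA k) / (S.catA k ^ 2 + S.catA (k + 1))

/-- The inner iteration count of outer iteration `k`, run from the outer state `o` that
iteration `k - 1` has produced. -/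
def count (k : ℕ) (o : OuterState d t m n) (w : InnerDraws m n Ξ) : ℕ∞ :=
  S.stopTime o.y o.α (S.eps k) w

/-- The outer iterates `(x^k, y^k, α^k)`; `w k` holds the draws of outer iteration `k ≥ 1`.
Iteration `k + 1` runs EC-SDCA on the subproblem with prox-center `y^k` from the dual point `α^k`
and outputs `x^{k+1} = x_{(k+1)}^{T+1}`, `α^{k+1} = α_{(k+1)}^T`. -/
def outer (w : ℕ → InnerDraws m n Ξ) : ℕ → OuterState d t m n
  | 0 => { x := S.x₀, y := S.x₀, α := 0 }
  | k + 1 =>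
    let o := outer w k
    let s := S.iter o.y o.α (w (k + 1)) (S.count (k + 1) o (w (k + 1))).toNat
    let x := S.primal o.y s
    { x := x, y := x + S.catB k • (x - o.x), α := s.α }

/-- `T_k`, the number of inner iterations in outer iteration `k ≥ 1`. -/
def T (w : ℕ → InnerDraws m n Ξ) : ℕ → ℕ∞
  | 0 => 0
  | k + 1 => S.count (k + 1) (S.outer w k) (w (k + 1))

/-! ### The bound -/

/-- `1/δ + m + a₄/(λ+κ)`. -/
def rate : ℝ := 1 / S.δ + m + S.a₄ / S.mu

/-- The logarithmic factor: `1` plus the logarithm of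
`(N/δ) (1 + R²/(γ(λ+κ))) ((λ+κ)/λ) / (√q - ρ₀)`. -/
def logFactor : ℝ :=
  1 + Real.log (S.N / S.δ * (1 + S.RSq / (S.γ * S.mu)) * (S.mu / S.lam) / (√S.q - S.ρ₀))

/-- The initial dual gap `G_1^* - D_1(0)` relative to `P(x^0) - P^*`. -/
def initGap : ℝ :=
  ((S.Gmin S.x₀ : EReal) - S.D S.x₀ 0).toReal / (S.P S.x₀ - S.Pmin)

end Setup

/-- The draws `U k K τ = (index, randomness of the compressor)` are independent over the outer
iterations `k`, inner iterations `K` and nodes `τ`, and each consists of a uniform index in `[m]`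
and an independent variable of law `ν`. -/
structure IsSampling {m n : ℕ} {Ξ Ω : Type*} [MeasurableSpace Ξ] [MeasurableSpace Ω]
    (prob : Measure Ω) (ν : Measure Ξ) (U : ℕ → ℕ → Fin n → Ω → Fin m × Ξ) : Prop where
  measurable : ∀ k K τ, Measurable (U k K τ)
  law : ∀ k K τ, Measure.map (U k K τ) prob = (uniformOn (Set.univ : Set (Fin m))).prod ν
  indep : iIndepFun (fun (j : ℕ × ℕ × Fin n) ω => U j.1 j.2.1 j.2.2 ω) prob

end

end ECSDCA

namespace ECSDCA

noncomputable section

/-! ### Strongly convex functions -/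

section StrongConvex

variable {d : ℕ} {f : Vec d → ℝ} {c : ℝ}

/-! Within one outer iteration the Lyapunov function Ψ contracts in conditional expectation by the
factor 1 - r, r = min θ (δ/4) (`one_step`). By error feedback the point v(α) = u + ē moves as if
nothing were compressed. A step is therefore a randomized dual ascent step whose primal point
∇ξ^*(u) is off by at most ‖ē‖. Moving a sampled coordinate towards -∇φ gains, by strong convexity of
φ^*, a multiple of the squared dual residual. This gain pays for the smoothness term of ξ^*, for the
coupling of ē with the expected direction, and for the new compression error. Because E Q(x) = δx,
the errors of different nodes are independent with known means, so only their averaged mean and a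
variance with factor 1/n² enter. The stepsize and ρ make the total coefficient of the residual
nonpositive (`stepsize_bound`, `lyapunov_arith`).

Since Ψ is nonnegative, the same inequality gives θ(G(x) - G^*) ≤ Ψ at the current state, without
expectation (`primal_gap_le`). Hence the loop stops as soon as `stopFactor` times Ψ is at most ε_k.
Markov's inequality bounds P(T > K), K ≥ 1, by min(1, (1 - r)^K Y), where Y is `stopFactor` times
the initial gap over ε_k. Summation gives E T ≤ (3 + log Y)/r (`lintegral_T_le`), and 1/r is at most
60 times the claimed rate (`one_div_contr_le`).

It remains to bound Y polynomially in the argument of the logarithm Λ. For k = 1 the initial gap is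
G_1^* - D_1(0). For k ≥ 2, changing the prox-center at most doubles the dual gap and adds a multiple
of the squared displacement of the center (`warm_start`). The old gap is at most ε_{k-1} because the
previous loop stopped. The displacement is controlled by the linear convergence of inexact
accelerated proximal point steps (`catalyst_bound`, `prox_center_bound`). Both bounds hold on every
path on which the earlier loops terminated, and almost sure termination follows by induction on k
(`ae_T_ne_top`). -/

lemma StrongConvexOn.apply_combo (hf : StrongConvexOn Set.univ c f) (x y : Vec d) {s : ℝ}
    (hs₀ : 0 ≤ s) (hs₁ : s ≤ 1) :
    f ((1 - s) • x + s • y) ≤ (1 - s) * f x + s * f y - (1 - s) * s * (c / 2 * ‖x - y‖ ^ 2) := by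
  have h := hf.2 (Set.mem_univ x) (Set.mem_univ y) (sub_nonneg.2 hs₁) hs₀ (by ring)
  simpa using h

lemma StrongConvexOn.continuous' (hc : 0 ≤ c) (hf : StrongConvexOn Set.univ c f) :
    Continuous f := by
  have h : ConvexOn ℝ Set.univ f := strongConvexOn_zero.1 (hf.mono hc)
  exact h.locallyLipschitz.continuous

lemma StrongConvexOn.exists_forall_le (hc : 0 < c) (hf : StrongConvexOn Set.univ c f) :
    ∃ x₀, ∀ x, f x₀ ≤ f x := by
  have hcont : Continuous f := StrongConvexOn.continuous' hc.le hf
  obtain ⟨b, hb⟩ := (isCompact_closedBall (0 : Vec d) 1).bddBelow_image hcont.continuousOn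
  refine hcont.exists_forall_le_of_isBounded 0 ?_
  -- The sublevel set of f 0 is bounded: x / ‖x‖ lies on the segment [0, x] and in the unit ball,
  -- where f ≥ b, and strong convexity along the segment then bounds ‖x‖.
  refine (Metric.isBounded_closedBall (x := (0 : Vec d)) (r := 1 + 2 * |f 0 - b| / c)).subset ?_
  intro x hx
  rw [mem_closedBall_zero_iff]
  by_contra! hlt
  have hpos : 0 ≤ 2 * |f 0 - b| / c := by positivity
  have hx1 : 1 < ‖x‖ := by linarith
  have hx0 : 0 < ‖x‖ := by linarith
  have hbx : b ≤ f ((1 - ‖x‖⁻¹) • (0 : Vec d) + ‖x‖⁻¹ • x) := by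
    apply hb
    refine Set.mem_image_of_mem _ ?_
    rw [mem_closedBall_zero_iff, smul_zero, zero_add, norm_smul, norm_inv, norm_norm,
      inv_mul_cancel₀ hx0.ne']
  have h := StrongConvexOn.apply_combo hf 0 x (s := ‖x‖⁻¹) (by positivity)
    (inv_le_one_of_one_le₀ hx1.le)
  rw [zero_sub, norm_neg] at h
  have hxf : f x ≤ f 0 := hx
  have h1 : b ≤ f 0 - (1 - ‖x‖⁻¹) * ‖x‖⁻¹ * (c / 2 * ‖x‖ ^ 2) := by
    have : ‖x‖⁻¹ * f x ≤ ‖x‖⁻¹ * f 0 := by gcongr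
    linarith
  have h2 : (1 - ‖x‖⁻¹) * ‖x‖⁻¹ * (c / 2 * ‖x‖ ^ 2) = c / 2 * (‖x‖ - 1) := by
    field_simp
  have h3 : |f 0 - b| < c / 2 * (‖x‖ - 1) := by
    have : 2 * |f 0 - b| / c < ‖x‖ - 1 := by linarith
    rw [div_lt_iff₀ hc] at this
    linarith
  linarith [le_abs_self (f 0 - b)]

/-- Compare x₀ with the points of the segment towards x and let s → 0, which removes the factor 1 -
s. -/
lemma StrongConvexOn.add_sq_le (hf : StrongConvexOn Set.univ c f) {x₀ : Vec d}
    (h₀ : ∀ x, f x₀ ≤ f x) (x : Vec d) : f x₀ + c / 2 * ‖x - x₀‖ ^ 2 ≤ f x := by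
  have key : ∀ s ∈ Set.Ioo (0 : ℝ) 1, (1 - s) * (c / 2 * ‖x - x₀‖ ^ 2) ≤ f x - f x₀ := by
    intro s hs
    have h := (h₀ _).trans (StrongConvexOn.apply_combo hf x₀ x hs.1.le hs.2.le)
    rw [norm_sub_rev] at h
    have : 0 ≤ s * (f x - f x₀ - (1 - s) * (c / 2 * ‖x - x₀‖ ^ 2)) := by linarith
    linarith [nonneg_of_mul_nonneg_right this hs.1]
  have hlim : Filter.Tendsto (fun s : ℝ => (1 - s) * (c / 2 * ‖x - x₀‖ ^ 2))
      (nhdsWithin 0 (Set.Ioi 0)) (nhds ((1 - 0) * (c / 2 * ‖x - x₀‖ ^ 2))) :=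
    (Continuous.tendsto (by fun_prop) 0).mono_left nhdsWithin_le_nhds
  have := le_of_tendsto hlim (Filter.mem_of_superset (Ioo_mem_nhdsGT one_pos) key)
  linarith

lemma StrongConvexOn.sub_inner (hf : StrongConvexOn Set.univ c f) (u : Vec d) :
    StrongConvexOn Set.univ c (fun x => f x - inner ℝ x u) := by
  refine ⟨convex_univ, fun x _ y _ a b ha hb hab => ?_⟩
  have h := hf.2 (Set.mem_univ x) (Set.mem_univ y) ha hb hab
  simp only [smul_eq_mul, inner_add_left, real_inner_smul_left] at h ⊢
  linarith

/-- The formula for ‖· - y‖² along a segment is an identity, so the parameters add without a sign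
condition on k. -/
lemma StrongConvexOn.add_sq (hf : StrongConvexOn Set.univ c f) {k : ℝ} (y : Vec d) :
    StrongConvexOn Set.univ (c + k) (fun x => f x + k / 2 * ‖x - y‖ ^ 2) := by
  refine ⟨convex_univ, fun p _ r _ a b ha hb hab => ?_⟩
  have h := hf.2 (Set.mem_univ p) (Set.mem_univ r) ha hb hab
  simp only [smul_eq_mul] at h ⊢
  have e : ‖a • p + b • r - y‖ ^ 2 = a * ‖p - y‖ ^ 2 + b * ‖r - y‖ ^ 2 - a * b * ‖p - r‖ ^ 2 := by
    obtain rfl : b = 1 - a := by linarith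
    have e1 : a • p + (1 - a) • r - y = a • (p - y) + (1 - a) • (r - y) := by module
    have e2 : p - r = (p - y) - (r - y) := by abel
    rw [e1, e2, norm_add_sq_real, norm_sub_sq_real (p - y), norm_smul, norm_smul, real_inner_smul_left,
      real_inner_smul_right, mul_pow, mul_pow, Real.norm_eq_abs, Real.norm_eq_abs, sq_abs, sq_abs]
    ring
  rw [e]
  linarith

lemma StrongConvexOn.div_const (hf : StrongConvexOn Set.univ c f) {k : ℝ} (hk : 0 < k) :
    StrongConvexOn Set.univ (c / k) (fun x => f x / k) := by
  refine ⟨convex_univ, fun p _ r _ a b ha hb hab => ?_⟩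
  have h := hf.2 (Set.mem_univ p) (Set.mem_univ r) ha hb hab
  simp only [smul_eq_mul] at h ⊢
  rw [div_le_iff₀ hk]
  refine h.trans (le_of_eq ?_)
  field_simp

end StrongConvex

/-! ### Fenchel conjugates -/

section Conj

variable {d : ℕ}

/-- The real value of the Fenchel conjugate, meaningful where the conjugate is finite. -/
def conjR (f : Vec d → ℝ) (y : Vec d) : ℝ := (conj f y).toReal

lemma le_conj (f : Vec d → ℝ) (x y : Vec d) : ((inner ℝ x y - f x : ℝ) : EReal) ≤ conj f y :=
  le_iSup (fun x : Vec d => ((inner ℝ x y - f x : ℝ) : EReal)) x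

lemma conj_ne_bot (f : Vec d → ℝ) (y : Vec d) : conj f y ≠ ⊥ :=
  fun h => EReal.coe_ne_bot _ (le_bot_iff.1 (h ▸ le_conj f 0 y))

lemma coe_conjR {f : Vec d → ℝ} {y : Vec d} (h : conj f y ≠ ⊤) : (conjR f y : EReal) = conj f y :=
  EReal.coe_toReal h (conj_ne_bot f y)

lemma le_conjR {f : Vec d → ℝ} {y : Vec d} (h : conj f y ≠ ⊤) (x : Vec d) :
    inner ℝ x y - f x ≤ conjR f y := by
  have := le_conj f x y
  rw [← coe_conjR h] at this
  exact_mod_cast this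

lemma conj_ne_top_of_le {f : Vec d → ℝ} {y : Vec d} {b : ℝ} (h : ∀ x, inner ℝ x y - f x ≤ b) :
    conj f y ≠ ⊤ := by
  have : conj f y ≤ (b : EReal) := iSup_le fun x => by exact_mod_cast h x
  exact ne_top_of_le_ne_top (EReal.coe_ne_top b) this

lemma conjR_le {f : Vec d → ℝ} {y : Vec d} {b : ℝ} (h : ∀ x, inner ℝ x y - f x ≤ b) :
    conjR f y ≤ b := by
  have h1 : conj f y ≤ (b : EReal) := iSup_le fun x => by exact_mod_cast h x
  rw [← coe_conjR (conj_ne_top_of_le h)] at h1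
  exact_mod_cast h1

lemma conj_eq_of_forall_le {f : Vec d → ℝ} {x y : Vec d}
    (h : ∀ z, inner ℝ z y - f z ≤ inner ℝ x y - f x) :
    conj f y ≠ ⊤ ∧ conjR f y = inner ℝ x y - f x :=
  ⟨conj_ne_top_of_le h, le_antisymm (conjR_le h) (le_conjR (conj_ne_top_of_le h) x)⟩

lemma measurable_conj {f : Vec d → ℝ} : Measurable (conj f) := by
  refine LowerSemicontinuous.measurable (lowerSemicontinuous_iSup fun x => ?_)
  refine Continuous.lowerSemicontinuous ?_
  exact continuous_coe_real_ereal.comp (by fun_prop)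

lemma measurable_conjR {f : Vec d → ℝ} : Measurable (conjR f) :=
  measurable_ereal_toReal.comp measurable_conj

variable {f : Vec d → ℝ} {c : ℝ}

lemma exists_forall_inner_sub_le (hc : 0 < c) (hf : StrongConvexOn Set.univ c f) (u : Vec d) :
    ∃ x, ∀ z, inner ℝ z u - f z + c / 2 * ‖z - x‖ ^ 2 ≤ inner ℝ x u - f x := by
  have h := StrongConvexOn.sub_inner hf u
  obtain ⟨x, hx⟩ := StrongConvexOn.exists_forall_le hc h
  refine ⟨x, fun z => ?_⟩
  linarith [StrongConvexOn.add_sq_le h hx z]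

lemma conj_ne_top_of_strongConvexOn (hc : 0 < c) (hf : StrongConvexOn Set.univ c f) (u : Vec d) :
    conj f u ≠ ⊤ := by
  obtain ⟨x, hx⟩ := exists_forall_inner_sub_le hc hf u
  refine (conj_eq_of_forall_le (x := x) fun z => ?_).1
  have : 0 ≤ c / 2 * ‖z - x‖ ^ 2 := by positivity
  linarith [hx z]

lemma hasGradientAt_of_abs_sub_le {F : Vec d → ℝ} {u x : Vec d} {b : ℝ}
    (h : ∀ p, |F (u + p) - F u - inner ℝ x p| ≤ b * ‖p‖ ^ 2) : HasGradientAt F x u := by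
  rw [hasGradientAt_iff_isLittleO_nhds_zero]
  refine Asymptotics.IsBigO.trans_isLittleO (g := fun p : Vec d => ‖p‖ ^ 2) ?_ ?_
  · exact Asymptotics.IsBigO.of_bound b (Filter.Eventually.of_forall fun p => by
      simpa using h p)
  · exact Asymptotics.isLittleO_norm_pow_id one_lt_two

/-- Testing the conjugate at u + p with the maximizer x gives the lower bound; quadratic growth at x
and Young's inequality give the upper one. The squeezed remainder is at most ‖p‖²/(2c), which yields
differentiability. -/
lemma hasGradientAt_conjR (hc : 0 < c) (hf : StrongConvexOn Set.univ c f) {u x : Vec d}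
    (hx : ∀ z, inner ℝ z u - f z + c / 2 * ‖z - x‖ ^ 2 ≤ inner ℝ x u - f x) :
    conjR f u = inner ℝ x u - f x ∧
    (∀ p, conjR f u + inner ℝ x p ≤ conjR f (u + p)) ∧
    (∀ p, conjR f (u + p) ≤ conjR f u + inner ℝ x p + 1 / (2 * c) * ‖p‖ ^ 2) ∧
    HasGradientAt (conjR f) x u := by
  have hu : conjR f u = inner ℝ x u - f x := by
    refine (conj_eq_of_forall_le (x := x) fun z => ?_).2
    have : 0 ≤ c / 2 * ‖z - x‖ ^ 2 := by positivity
    linarith [hx z]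
  have h1 : ∀ p, conjR f u + inner ℝ x p ≤ conjR f (u + p) := fun p => by
    have := le_conjR (conj_ne_top_of_strongConvexOn hc hf (u + p)) x
    rw [inner_add_right] at this
    linarith
  have h2 : ∀ p, conjR f (u + p) ≤ conjR f u + inner ℝ x p + 1 / (2 * c) * ‖p‖ ^ 2 := fun p => by
    refine conjR_le fun z => ?_
    have e1 : inner ℝ (z - x) p ≤ c / 2 * ‖z - x‖ ^ 2 + 1 / (2 * c) * ‖p‖ ^ 2 := by
      have h3 := real_inner_le_norm (z - x) p
      have h4 : 0 ≤ 1 / (2 * c) * (c * ‖z - x‖ - ‖p‖) ^ 2 := by positivity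
      have h5 : 1 / (2 * c) * (c * ‖z - x‖ - ‖p‖) ^ 2
          = c / 2 * ‖z - x‖ ^ 2 - ‖z - x‖ * ‖p‖ + 1 / (2 * c) * ‖p‖ ^ 2 := by
        field_simp
        ring
      linarith
    rw [inner_sub_left] at e1
    rw [inner_add_right]
    linarith [hx z]
  refine ⟨hu, h1, h2, hasGradientAt_of_abs_sub_le (b := 1 / (2 * c)) fun p => ?_⟩
  rw [abs_le]
  have : 0 ≤ 1 / (2 * c) * ‖p‖ ^ 2 := by positivity
  constructor <;> linarith [h1 p, h2 p]

lemma inner_sub_add_sq_le (hc : 0 < c) (hf : StrongConvexOn Set.univ c f) (u z : Vec d) :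
    inner ℝ z u - f z + c / 2 * ‖z - gradConj f u‖ ^ 2
      ≤ inner ℝ (gradConj f u) u - f (gradConj f u) := by
  obtain ⟨x, hx⟩ := exists_forall_inner_sub_le hc hf u
  have : gradConj f u = x := (hasGradientAt_conjR hc hf hx).2.2.2.gradient
  rw [this]
  exact hx z

lemma conjR_eq (hc : 0 < c) (hf : StrongConvexOn Set.univ c f) (u : Vec d) :
    conjR f u = inner ℝ (gradConj f u) u - f (gradConj f u) :=
  (hasGradientAt_conjR hc hf (inner_sub_add_sq_le hc hf u)).1

lemma conjR_add_le (hc : 0 < c) (hf : StrongConvexOn Set.univ c f) (u p : Vec d) :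
    conjR f (u + p) ≤ conjR f u + inner ℝ (gradConj f u) p + 1 / (2 * c) * ‖p‖ ^ 2 :=
  (hasGradientAt_conjR hc hf (inner_sub_add_sq_le hc hf u)).2.2.1 p

/-- Adding the growth inequalities at the two maximizers gives c‖Δ‖² ≤ ⟨Δ, u - w⟩ for their
difference Δ; then Cauchy–Schwarz. -/
lemma norm_gradConj_sub_le (hc : 0 < c) (hf : StrongConvexOn Set.univ c f) (u w : Vec d) :
    c * ‖gradConj f u - gradConj f w‖ ≤ ‖u - w‖ := by
  have h1 := inner_sub_add_sq_le hc hf u (gradConj f w)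
  have h2 := inner_sub_add_sq_le hc hf w (gradConj f u)
  rw [norm_sub_rev] at h1
  have h3 := real_inner_le_norm (gradConj f u - gradConj f w) (u - w)
  rw [inner_sub_left, inner_sub_right, inner_sub_right] at h3
  rcases (norm_nonneg (gradConj f u - gradConj f w)).eq_or_lt with h0 | h0
  · rw [← h0, mul_zero]
    exact norm_nonneg _
  · refine le_of_mul_le_mul_left ?_ h0
    nlinarith

lemma continuous_gradConj (hc : 0 < c) (hf : StrongConvexOn Set.univ c f) :
    Continuous (gradConj f) := by
  refine (LipschitzWith.of_dist_le_mul (K := (1 / c).toNNReal) fun u w => ?_).continuous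
  rw [dist_eq_norm, dist_eq_norm, Real.coe_toNNReal _ (by positivity), one_div_mul_eq_div,
    le_div_iff₀ hc, mul_comm]
  exact norm_gradConj_sub_le hc hf u w

end Conj

/-! ### Convex smooth functions -/

section Smooth

variable {t : ℕ} {φ : Vec t → ℝ} {L γ : ℝ}

lemma ConvexSmooth.hasDerivAt (hφ : ConvexSmooth φ L) (z p : Vec t) (s : ℝ) :
    HasDerivAt (fun r : ℝ => φ (z + r • p)) (inner ℝ (gradient φ (z + s • p)) p) s := by
  have h1 : HasFDerivAt φ _ (z + s • p) :=
    ((hφ.differentiable (z + s • p)).hasGradientAt).hasFDerivAt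
  have h2 : HasDerivAt (fun r : ℝ => z + r • p) p s := by
    simpa using ((hasDerivAt_id s).smul_const p).const_add z
  have h3 := h1.comp_hasDerivAt s h2
  rw [InnerProductSpace.toDual_apply_apply] at h3
  exact h3

/-- On [0, 1] the function r ↦ φ(z + rp) minus its quadratic model has nonpositive derivative. -/
lemma ConvexSmooth.le_add_sq (hφ : ConvexSmooth φ L) (z p : Vec t) :
    φ (z + p) ≤ φ z + inner ℝ (gradient φ z) p + L / 2 * ‖p‖ ^ 2 := by
  have hd : ∀ s : ℝ, HasDerivAt
      (fun r : ℝ => φ (z + r • p) - r * inner ℝ (gradient φ z) p - L / 2 * ‖p‖ ^ 2 * r ^ 2)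
      (inner ℝ (gradient φ (z + s • p)) p - inner ℝ (gradient φ z) p
        - L / 2 * ‖p‖ ^ 2 * (2 * s)) s := fun s => by
    have h3 := ((hφ.hasDerivAt z p s).sub ((hasDerivAt_id s).mul_const
      (inner ℝ (gradient φ z) p))).sub ((hasDerivAt_pow 2 s).const_mul (L / 2 * ‖p‖ ^ 2))
    convert! h3 using 1
    norm_num
  have ha := antitoneOn_of_deriv_nonpos (convex_Icc (0 : ℝ) 1)
    (fun s _ => (hd s).continuousAt.continuousWithinAt)
    (fun s _ => (hd s).differentiableAt.differentiableWithinAt) (fun s hs => by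
      rw [interior_Icc] at hs
      rw [(hd s).deriv, ← inner_sub_left]
      have h1 := real_inner_le_norm (gradient φ (z + s • p) - gradient φ z) p
      have h2 := hφ.lipschitz (z + s • p) z
      rw [add_sub_cancel_left, norm_smul, Real.norm_of_nonneg hs.1.le] at h2
      have h3 := mul_le_mul_of_nonneg_right h2 (norm_nonneg p)
      nlinarith)
  have := ha (Set.left_mem_Icc.2 zero_le_one) (Set.right_mem_Icc.2 zero_le_one) zero_le_one
  simp only [one_smul, zero_smul, add_zero] at this
  linarith

lemma ConvexSmooth.add_inner_le (hφ : ConvexSmooth φ L) (z p : Vec t) :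
    φ z + inner ℝ (gradient φ z) p ≤ φ (z + p) := by
  have hc : ConvexOn ℝ Set.univ (fun r : ℝ => φ (z + r • p)) := by
    refine ⟨convex_univ, fun x _ y _ a b ha hb hab => ?_⟩
    have e : z + (a • x + b • y) • p = a • (z + x • p) + b • (z + y • p) := by
      obtain rfl : b = 1 - a := by linarith
      simp only [smul_eq_mul]
      module
    simp only [e]
    exact hφ.convex.2 (Set.mem_univ _) (Set.mem_univ _) ha hb hab
  have h := hc.le_slope_of_hasDerivAt (Set.mem_univ 0) (Set.mem_univ 1) zero_lt_one
    (hφ.hasDerivAt z p 0)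
  simp only [slope_def_field, one_smul, zero_smul, add_zero, sub_zero, div_one] at h
  linarith

lemma ConvexSmooth.continuous_gradient (hφ : ConvexSmooth φ L) (hL : 0 ≤ L) :
    Continuous (gradient φ) := by
  refine (LipschitzWith.of_dist_le_mul (K := L.toNNReal) fun u w => ?_).continuous
  rw [dist_eq_norm, dist_eq_norm, Real.coe_toNNReal _ hL]
  exact hφ.lipschitz u w

lemma ConvexSmooth.conj_gradient (hφ : ConvexSmooth φ L) (z : Vec t) :
    conj φ (gradient φ z) ≠ ⊤ ∧ conjR φ (gradient φ z) = inner ℝ z (gradient φ z) - φ z := by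
  refine conj_eq_of_forall_le fun w => ?_
  have h := hφ.add_inner_le z (w - z)
  rw [add_sub_cancel, inner_sub_right, real_inner_comm, real_inner_comm z] at h
  linarith

/-- The conjugate of a `1/γ`-smooth convex function is `γ`-strongly convex. -/
lemma ConvexSmooth.conjR_combo_le (hγ : 0 < γ) (hφ : ConvexSmooth φ (1 / γ)) {a b : Vec t}
    (ha : conj φ a ≠ ⊤) (hb : conj φ b ≠ ⊤) {s : ℝ} (hs₀ : 0 ≤ s) (hs₁ : s ≤ 1) :
    conj φ ((1 - s) • a + s • b) ≠ ⊤ ∧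
    conjR φ ((1 - s) • a + s • b)
      ≤ (1 - s) * conjR φ a + s * conjR φ b - γ / 2 * s * (1 - s) * ‖a - b‖ ^ 2 := by
  have key : ∀ z, inner ℝ z ((1 - s) • a + s • b) - φ z
      ≤ (1 - s) * conjR φ a + s * conjR φ b - γ / 2 * s * (1 - s) * ‖a - b‖ ^ 2 := fun z => by
    -- This k maximizes ⟨k, a - b⟩ - ‖k‖²/(2γ). Testing the conjugates at z + s k and z - (1 - s) k
    -- makes the gradient terms cancel in the convex combination and leaves s(1 - s) times that
    -- maximum.
    set k := γ • (a - b) with hk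
    have h1 := le_conjR ha (z + s • k)
    have h2 := le_conjR hb (z + (-(1 - s)) • k)
    have h3 := hφ.le_add_sq z (s • k)
    have h4 := hφ.le_add_sq z ((-(1 - s)) • k)
    have hkn : ‖k‖ ^ 2 = γ ^ 2 * ‖a - b‖ ^ 2 := by
      rw [hk, norm_smul, mul_pow, Real.norm_eq_abs, sq_abs]
    have hki : inner ℝ k a - inner ℝ k b = γ * ‖a - b‖ ^ 2 := by
      rw [← inner_sub_right, hk, real_inner_smul_left, real_inner_self_eq_norm_sq]
    rw [norm_smul, mul_pow, Real.norm_eq_abs, sq_abs, hkn] at h3 h4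
    simp only [inner_add_left, inner_add_right, real_inner_smul_left, real_inner_smul_right]
      at h1 h2 h3 h4 ⊢
    have h5 : (1 - s) * (inner ℝ z a + s * inner ℝ k a - (φ z + s * inner ℝ (gradient φ z) k
        + 1 / γ / 2 * (s ^ 2 * (γ ^ 2 * ‖a - b‖ ^ 2)))) ≤ (1 - s) * conjR φ a :=
      mul_le_mul_of_nonneg_left (by linarith) (by linarith)
    have h6 : s * (inner ℝ z b + -(1 - s) * inner ℝ k b -
        (φ z + -(1 - s) * inner ℝ (gradient φ z) k
        + 1 / γ / 2 * ((-(1 - s)) ^ 2 * (γ ^ 2 * ‖a - b‖ ^ 2)))) ≤ s * conjR φ b :=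
      mul_le_mul_of_nonneg_left (by linarith) hs₀
    have h7 : 1 / γ / 2 * (s ^ 2 * (γ ^ 2 * ‖a - b‖ ^ 2)) = γ / 2 * s ^ 2 * ‖a - b‖ ^ 2 := by
      field_simp
    have h8 : 1 / γ / 2 * ((-(1 - s)) ^ 2 * (γ ^ 2 * ‖a - b‖ ^ 2))
        = γ / 2 * (1 - s) ^ 2 * ‖a - b‖ ^ 2 := by
      field_simp
    rw [h7] at h5
    rw [h8] at h6
    have h9 : s * (1 - s) * (inner ℝ k a - inner ℝ k b) = s * (1 - s) * (γ * ‖a - b‖ ^ 2) := by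
      rw [hki]
    linarith
  exact ⟨conj_ne_top_of_le key, conjR_le key⟩

/-- Lower boundedness of φ is what makes the starting point α = 0 dual feasible. -/
lemma conj_zero_ne_top (hφ : BddBelow (Set.range φ)) : conj φ 0 ≠ ⊤ := by
  obtain ⟨b, hb⟩ := hφ
  refine conj_ne_top_of_le (b := -b) fun x => ?_
  have : b ≤ φ x := hb ⟨x, rfl⟩
  rw [inner_zero_right]
  linarith

end Smooth

/-! ### The largest eigenvalue -/

section LambdaMax

variable {d t : ℕ}

lemma bddAbove_eigenvalues (B : Vec d →L[ℝ] Vec d) :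
    BddAbove {ν : ℝ | Module.End.HasEigenvalue (B : Vec d →ₗ[ℝ] Vec d) ν} :=
  (Module.End.finite_hasEigenvalue (B : Vec d →ₗ[ℝ] Vec d)).bddAbove

/-- For a symmetric operator in finite dimension the supremum of the Rayleigh quotient is an
eigenvalue. -/
lemma inner_le_lambdaMax {B : Vec d →L[ℝ] Vec d} (hB : (B : Vec d →ₗ[ℝ] Vec d).IsSymmetric)
    (x : Vec d) : inner ℝ (B x) x ≤ lambdaMax B * ‖x‖ ^ 2 := by
  rcases eq_or_ne x 0 with rfl | hx
  · simp
  have : Nontrivial (Vec d) := ⟨x, 0, hx⟩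
  have h1 := le_csSup (bddAbove_eigenvalues B) hB.hasEigenvalue_iSup_of_finiteDimensional
  have hpos : 0 < ‖x‖ ^ 2 := by positivity
  rw [← div_le_iff₀ hpos]
  refine le_trans ?_ h1
  refine le_ciSup (f := fun x : { x : Vec d // x ≠ 0 } =>
    (RCLike.re (inner ℝ ((B : Vec d →ₗ[ℝ] Vec d) x) x) / ‖(x : Vec d)‖ ^ 2 : ℝ)) ?_ ⟨x, hx⟩
  refine ⟨‖B‖, ?_⟩
  rintro _ ⟨⟨z, hz⟩, rfl⟩
  have hz' : 0 < ‖z‖ ^ 2 := by positivity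
  simp only [ContinuousLinearMap.coe_coe, RCLike.re_to_real]
  rw [div_le_iff₀ hz']
  calc inner ℝ (B z) z ≤ ‖B z‖ * ‖z‖ := real_inner_le_norm _ _
    _ ≤ ‖B‖ * ‖z‖ * ‖z‖ := by gcongr; exact B.le_opNorm z
    _ = ‖B‖ * ‖z‖ ^ 2 := by ring

lemma lambdaMax_le {B : Vec d →L[ℝ] Vec d} {b : ℝ} (hb : 0 ≤ b)
    (h : ∀ x, inner ℝ (B x) x ≤ b * ‖x‖ ^ 2) : lambdaMax B ≤ b := by
  refine Real.sSup_le (fun ν hν => ?_) hb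
  obtain ⟨x, hx⟩ := hν.exists_hasEigenvector
  have h1 := h x
  have h2 : B x = ν • x := hx.apply_eq_smul
  rw [h2, real_inner_smul_left, real_inner_self_eq_norm_sq] at h1
  have : 0 < ‖x‖ ^ 2 := by have := hx.2; positivity
  exact le_of_mul_le_mul_right h1 this

variable {ι : Type*} [Fintype ι] (A : ι → Vec t →L[ℝ] Vec d)

lemma inner_sum_comp_adjoint (x y : Vec d) :
    inner ℝ ((∑ i, (A i).comp (A i).adjoint) x) y
      = ∑ i, inner ℝ ((A i).adjoint x) ((A i).adjoint y) := by
  rw [sum_apply, sum_inner]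
  refine Finset.sum_congr rfl fun i _ => ?_
  rw [ContinuousLinearMap.comp_apply, ContinuousLinearMap.adjoint_inner_right]

lemma sum_norm_adjoint_sq_le (x : Vec d) :
    ∑ i, ‖(A i).adjoint x‖ ^ 2
      ≤ lambdaMax (∑ i, (A i).comp (A i).adjoint) * ‖x‖ ^ 2 := by
  have hs : ((∑ i, (A i).comp (A i).adjoint : Vec d →L[ℝ] Vec d) : Vec d →ₗ[ℝ] Vec d).IsSymmetric := by
    intro x y
    have h1 := inner_sum_comp_adjoint A x y
    have h2 := inner_sum_comp_adjoint A y x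
    rw [ContinuousLinearMap.coe_coe, h1, real_inner_comm, h2]
    exact Finset.sum_congr rfl fun i _ => real_inner_comm _ _
  have h := inner_le_lambdaMax hs x
  rw [inner_sum_comp_adjoint] at h
  simpa using h

lemma lambdaMax_sum_nonneg : 0 ≤ lambdaMax (∑ i, (A i).comp (A i).adjoint) := by
  refine Real.sSup_nonneg fun ν hν => ?_
  obtain ⟨x, hx⟩ := hν.exists_hasEigenvector
  have h2 : (∑ i, (A i).comp (A i).adjoint) x = ν • x := hx.apply_eq_smul
  have h1 := inner_sum_comp_adjoint A x x
  rw [h2, real_inner_smul_left, real_inner_self_eq_norm_sq] at h1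
  have h3 : 0 < ‖x‖ ^ 2 := by have := hx.2; positivity
  have h4 : 0 ≤ ν * ‖x‖ ^ 2 := by
    rw [h1]
    exact Finset.sum_nonneg fun i _ => real_inner_self_nonneg
  exact nonneg_of_mul_nonneg_left h4 h3

/-- Expand ‖w‖² = ∑ ⟨A_iᵀ w, a_i⟩, apply Cauchy–Schwarz over i, bound ∑ ‖A_iᵀ w‖² by the eigenvalue,
and cancel one factor ‖w‖². -/
lemma norm_sum_apply_sq_le (a : ι → Vec t) :
    ‖∑ i, A i (a i)‖ ^ 2
      ≤ lambdaMax (∑ i, (A i).comp (A i).adjoint) * ∑ i, ‖a i‖ ^ 2 := by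
  set w := ∑ i, A i (a i) with hw
  set Λ := lambdaMax (∑ i, (A i).comp (A i).adjoint)
  rcases eq_or_ne w 0 with h0 | h0
  · rw [h0]
    have : 0 ≤ Λ := lambdaMax_sum_nonneg A
    simp only [norm_zero, ne_eq, OfNat.ofNat_ne_zero, not_false_eq_true, zero_pow]
    positivity
  have hpos : 0 < ‖w‖ ^ 2 := by positivity
  have h1 : ‖w‖ ^ 2 ≤ ∑ i, ‖(A i).adjoint w‖ * ‖a i‖ := by
    rw [← real_inner_self_eq_norm_sq]
    nth_rewrite 2 [hw]
    rw [inner_sum]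
    refine Finset.sum_le_sum fun i _ => ?_
    rw [← ContinuousLinearMap.adjoint_inner_left]
    exact real_inner_le_norm _ _
  have h2 := Finset.sum_mul_sq_le_sq_mul_sq Finset.univ (fun i => ‖(A i).adjoint w‖)
    (fun i => ‖a i‖)
  have h3 := sum_norm_adjoint_sq_le A w
  have h4 : (‖w‖ ^ 2) ^ 2 ≤ (Λ * ‖w‖ ^ 2) * ∑ i, ‖a i‖ ^ 2 := by
    calc (‖w‖ ^ 2) ^ 2 ≤ (∑ i, ‖(A i).adjoint w‖ * ‖a i‖) ^ 2 := by gcongr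
      _ ≤ _ := h2
      _ ≤ _ := mul_le_mul_of_nonneg_right h3 (Finset.sum_nonneg fun i _ => by positivity)
  refine le_of_mul_le_mul_right ?_ hpos
  calc ‖w‖ ^ 2 * ‖w‖ ^ 2 = (‖w‖ ^ 2) ^ 2 := by ring
    _ ≤ _ := h4
    _ = _ := by ring

end LambdaMax

/-! ### The standing assumptions and the constants -/

/-- The assumptions on the problem, the compressor and the parameters. -/
structure Setup.Valid {d t m n : ℕ} {Ξ : Type*} [MeasurableSpace Ξ] (S : Setup d t m n Ξ)
    (ν : Measure Ξ) : Prop where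
  one_le_m : 1 ≤ m
  one_le_n : 1 ≤ n
  lam_pos : 0 < S.lam
  γ_pos : 0 < S.γ
  smooth : ∀ τ i, ConvexSmooth (S.φ τ i) (1 / S.γ)
  bddBelow : ∀ τ i, BddBelow (Set.range (S.φ τ i))
  strong : StrongConvexOn Set.univ S.lam S.g
  compressor : IsContractionCompressor ν S.Q S.δ
  δ_lt_one : S.δ < 1
  mean : ∀ x, ∫ ξ, S.Q ξ x ∂ν = S.δ • x
  κ_nonneg : 0 ≤ S.κ
  ρ₀_nonneg : 0 ≤ S.ρ₀
  ρ₀_lt : S.ρ₀ < √S.q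
  gap_pos : S.Pmin < S.P S.x₀

namespace Setup

set_option linter.unusedSectionVars false

variable {d t m n : ℕ} {Ξ : Type*} [MeasurableSpace Ξ] {S : Setup d t m n Ξ} {ν : Measure Ξ}

namespace Valid

variable (h : S.Valid ν)
include h

lemma m_pos : (0 : ℝ) < m := by exact_mod_cast h.one_le_m
lemma n_pos : (0 : ℝ) < n := by exact_mod_cast h.one_le_n
lemma N_pos : 0 < S.N := mul_pos h.m_pos h.n_pos
lemma mu_pos : 0 < S.mu := add_pos_of_pos_of_nonneg h.lam_pos h.κ_nonneg
lemma δ_pos : 0 < S.δ := h.compressor.pos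
lemma γmu_pos : 0 < S.γ * S.mu := mul_pos h.γ_pos h.mu_pos

lemma N_RSq : S.N * S.RSq = lambdaMax (∑ p : Fin n × Fin m,
    (S.A p.1 p.2).comp (S.A p.1 p.2).adjoint) := by
  rw [RSq, ← mul_assoc, mul_one_div_cancel h.N_pos.ne', one_mul, Fintype.sum_prod_type]

lemma RSq_nonneg : 0 ≤ S.RSq := by
  have h1 := lambdaMax_sum_nonneg (fun p : Fin n × Fin m => S.A p.1 p.2)
  rw [← h.N_RSq] at h1
  exact nonneg_of_mul_nonneg_right h1 h.N_pos

omit h in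
lemma norm_A_le (τ : Fin n) (i : Fin m) : ‖S.A τ i‖ ≤ S.Rm :=
  le_ciSup (f := fun p : Fin n × Fin m => ‖S.A p.1 p.2‖) (Set.finite_range _).bddAbove (τ, i)

omit h in
lemma Rm_nonneg : 0 ≤ S.Rm := Real.iSup_nonneg fun _ => norm_nonneg _

lemma RbarSq_nonneg : 0 ≤ S.RbarSq :=
  Real.iSup_nonneg fun τ => mul_nonneg (by positivity) (lambdaMax_sum_nonneg (S.A τ))

lemma norm_A_apply_sq_le (τ : Fin n) (i : Fin m) (a : Vec t) :
    ‖S.A τ i a‖ ^ 2 ≤ S.Rm ^ 2 * ‖a‖ ^ 2 := by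
  rw [← mul_pow]
  gcongr
  exact (S.A τ i).le_of_opNorm_le (norm_A_le τ i) a

lemma norm_sum_sum_A_sq_le (a : Fin n → Fin m → Vec t) :
    ‖∑ τ, ∑ i, S.A τ i (a τ i)‖ ^ 2 ≤ S.N * S.RSq * ∑ τ, ∑ i, ‖a τ i‖ ^ 2 := by
  have h1 := norm_sum_apply_sq_le (fun p : Fin n × Fin m => S.A p.1 p.2) (fun p => a p.1 p.2)
  rw [← h.N_RSq] at h1
  simpa only [Fintype.sum_prod_type] using h1

lemma lambdaMax_node_le (τ : Fin n) :
    lambdaMax (∑ i, (S.A τ i).comp (S.A τ i).adjoint) ≤ m * S.RbarSq := by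
  have h1 : (1 / (m : ℝ)) * lambdaMax (∑ i, (S.A τ i).comp (S.A τ i).adjoint) ≤ S.RbarSq :=
    le_ciSup (f := fun τ : Fin n => (1 / (m : ℝ)) *
      lambdaMax (∑ i, (S.A τ i).comp (S.A τ i).adjoint)) (Set.finite_range _).bddAbove τ
  rwa [one_div_mul_eq_div, div_le_iff₀' h.m_pos] at h1

lemma norm_sum_A_sq_le (τ : Fin n) (a : Fin m → Vec t) :
    ‖∑ i, S.A τ i (a i)‖ ^ 2 ≤ m * S.RbarSq * ∑ i, ‖a i‖ ^ 2 :=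
  (norm_sum_apply_sq_le (S.A τ) a).trans (mul_le_mul_of_nonneg_right (h.lambdaMax_node_le τ)
    (Finset.sum_nonneg fun i _ => by positivity))

lemma RbarSq_le : S.RbarSq ≤ n * S.RSq := by
  have := h.RSq_nonneg
  have hN := h.N_pos
  refine Real.iSup_le (fun τ => ?_) (by positivity)
  rw [one_div_mul_eq_div, div_le_iff₀ h.m_pos]
  refine lambdaMax_le (by have := h.m_pos; positivity) fun x => ?_
  have h1 := sum_norm_adjoint_sq_le (fun p : Fin n × Fin m => S.A p.1 p.2) x
  rw [← h.N_RSq, Fintype.sum_prod_type] at h1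
  rw [inner_sum_comp_adjoint]
  simp only [real_inner_self_eq_norm_sq]
  have h2 := Finset.single_le_sum (f := fun τ => ∑ i, ‖(S.A τ i).adjoint x‖ ^ 2)
    (fun σ _ => Finset.sum_nonneg fun i _ => by positivity) (Finset.mem_univ τ)
  refine (h2.trans h1).trans (le_of_eq ?_)
  rw [N]
  ring

lemma Rm_sq_le : S.Rm ^ 2 ≤ m * n * S.RSq := by
  have hR := h.RSq_nonneg
  have hN := h.N_pos
  suffices S.Rm ≤ √(m * n * S.RSq) by
    calc S.Rm ^ 2 ≤ √(m * n * S.RSq) ^ 2 := by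
          have := Rm_nonneg (S := S)
          gcongr
      _ = _ := Real.sq_sqrt (by positivity)
  refine Real.iSup_le (fun p => ?_) (Real.sqrt_nonneg _)
  refine ContinuousLinearMap.opNorm_le_bound _ (Real.sqrt_nonneg _) fun a => ?_
  refine abs_le_of_sq_le_sq' ?_ (by positivity) |>.2
  rw [mul_pow, Real.sq_sqrt (by positivity)]
  -- A vector supported on the single block p isolates ‖A_p a‖.
  have h1 := norm_sum_apply_sq_le (fun p : Fin n × Fin m => S.A p.1 p.2) (Pi.single p a)
  rw [← h.N_RSq, Finset.sum_eq_single p, Finset.sum_eq_single p] at h1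
  · simpa [N] using h1
  · intro r _ hr
    simp [hr]
  · simp
  · intro r _ hr
    simp [hr]
  · simp

/-! ### The stepsize θ and the weight ρ -/

lemma MSq_nonneg : 0 ≤ S.MSq := by
  have h1 := h.RSq_nonneg
  have h2 := h.RbarSq_nonneg
  have h3 := h.δ_pos
  unfold MSq
  positivity

lemma theta_inv : S.theta⁻¹ = m + (S.RSq + S.Rm ^ 2 / n) / (S.γ * S.mu)
    + 4 * √(1 - S.δ) * √S.RSq * √S.MSq / (S.δ * S.γ * S.mu)
    + 2 * √(1 - S.δ) * √S.MSq / (S.δ * √(S.γ * S.mu)) := inv_inv _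

lemma m_le_theta_inv : (m : ℝ) ≤ S.theta⁻¹ := by
  rw [h.theta_inv]
  have h1 := h.RSq_nonneg
  have h2 := h.γ_pos
  have h3 := h.δ_pos
  have h4 := h.mu_pos
  have : 0 ≤ (S.RSq + S.Rm ^ 2 / n) / (S.γ * S.mu)
    + 4 * √(1 - S.δ) * √S.RSq * √S.MSq / (S.δ * S.γ * S.mu)
    + 2 * √(1 - S.δ) * √S.MSq / (S.δ * √(S.γ * S.mu)) := by positivity
  linarith

lemma theta_pos : 0 < S.theta := inv_pos.1 (h.m_pos.trans_le h.m_le_theta_inv)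

lemma theta_mul_m_le : S.theta * m ≤ 1 := by
  have := mul_le_mul_of_nonneg_left h.m_le_theta_inv h.theta_pos.le
  rwa [mul_inv_cancel₀ h.theta_pos.ne'] at this

lemma theta_le_one : S.theta ≤ 1 := by
  have h1 : (1 : ℝ) ≤ m := by exact_mod_cast h.one_le_m
  nlinarith [h.theta_mul_m_le, h.theta_pos]

lemma rho_nonneg : 0 ≤ S.rho := by
  have h3 := h.δ_pos
  have h4 := h.mu_pos
  unfold rho
  positivity

lemma sqrt_one_sub_δ_pos : 0 < √(1 - S.δ) := Real.sqrt_pos.2 (sub_pos.2 h.δ_lt_one)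

/-- If M = 0, the quotient defining ρ divides by 0 and takes the value 0; R = 0 makes this harmless.
-/
lemma RSq_eq_zero_of_MSq (h0 : S.MSq = 0) : S.RSq = 0 := by
  have h1 := h.RSq_nonneg
  have h2 := h.RbarSq_nonneg
  have h3 := h.δ_pos
  have h4 : 0 ≤ (16 * S.RbarSq + 9 * S.δ * S.Rm ^ 2) / n := by positivity
  unfold MSq at h0
  linarith

/-- The weight `ρ` balances the two occurrences of the coupling term. -/
lemma rho_balance :
    2 * S.rho * (1 - S.δ) * S.MSq / (S.mu ^ 2 * S.δ ^ 2)
      = √S.RSq * √(1 - S.δ) * √S.MSq / (S.δ * S.mu) := by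
  rcases h.MSq_nonneg.eq_or_lt with h0 | h0
  · simp [← h0]
  have h3 := h.δ_pos
  have h4 := h.mu_pos
  have h5 := h.sqrt_one_sub_δ_pos
  have h6 := Real.sqrt_pos.2 h0
  have e1 : S.MSq = √S.MSq ^ 2 := (Real.sq_sqrt h0.le).symm
  have e2 : 1 - S.δ = √(1 - S.δ) ^ 2 := (Real.sq_sqrt (sub_pos.2 h.δ_lt_one).le).symm
  unfold rho
  set a := √S.MSq
  set b := √(1 - S.δ)
  rw [e1, e2]
  field_simp

/-- Young's inequality for the coupling of the averaged error (x) with the root of the mean squared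
residual (z). By `rho_balance`, the weight ρ makes the z² term equal to the ρ-share of the
compression error. -/
lemma young_rho {x z : ℝ} :
    S.theta * √S.RSq * x * z ≤ S.rho / 2 * x ^ 2
      + S.theta ^ 2 * (√S.RSq * √(1 - S.δ) * √S.MSq / (S.δ * S.mu)) * z ^ 2 := by
  rcases h.MSq_nonneg.eq_or_lt with h0 | h0
  · have hr := h.RSq_eq_zero_of_MSq h0.symm
    have := h.rho_nonneg
    simp only [hr, Real.sqrt_zero, mul_zero, zero_mul, zero_div, add_zero]
    positivity
  have h3 := h.δ_pos
  have h4 := h.mu_pos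
  have h5 := h.sqrt_one_sub_δ_pos
  have h6 := Real.sqrt_pos.2 h0
  unfold rho
  set a := √S.MSq
  set b := √(1 - S.δ)
  set r := √S.RSq
  have hr : 0 ≤ r := Real.sqrt_nonneg _
  have : 0 ≤ r / (4 * S.δ * S.mu * a * b) * (S.δ * S.mu * x - 2 * S.theta * a * b * z) ^ 2 := by
    positivity
  have e : r / (4 * S.δ * S.mu * a * b) * (S.δ * S.mu * x - 2 * S.theta * a * b * z) ^ 2
      = S.δ * S.mu * r / (2 * b * a) / 2 * x ^ 2
      + S.theta ^ 2 * (r * b * a / (S.δ * S.mu)) * z ^ 2 - S.theta * r * x * z := by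
    field_simp
    ring
  linarith

/-- The choice of the stepsize makes the coefficient of the squared dual residual nonpositive. -/
lemma stepsize_bound :
    2 * (S.rho + S.theta * S.mu) * (1 - S.δ) * S.theta ^ 2 * S.MSq / (S.mu ^ 2 * S.δ ^ 2)
      + S.theta ^ 2 * (√S.RSq * √(1 - S.δ) * √S.MSq / (S.δ * S.mu))
      + S.theta ^ 2 * (S.RSq + S.Rm ^ 2 / n) / (2 * S.mu)
      ≤ S.theta * S.γ * (1 - S.theta * m) / 2 := by
  have h2 := h.γ_pos
  have h3 := h.δ_pos
  have h4 := h.mu_pos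
  have h5 := h.theta_pos
  have hb := h.rho_balance
  -- X, 4Y/γ and W are the last three summands of 1/θ, so 1 - θm = θ(X + 4Y/γ + W). X pays for the
  -- smoothness term, 4Y/γ for the two equal contributions θ²Y, and W for the W² term, because θW ≤
  -- 1.
  set X := (S.RSq + S.Rm ^ 2 / n) / (S.γ * S.mu) with hX
  set Y := √S.RSq * √(1 - S.δ) * √S.MSq / (S.δ * S.mu) with hY
  set W := 2 * √(1 - S.δ) * √S.MSq / (S.δ * √(S.γ * S.mu)) with hW
  have hW0 : 0 ≤ W := by positivity
  have hW2 : W ^ 2 = 4 * (1 - S.δ) * S.MSq / (S.δ ^ 2 * (S.γ * S.mu)) := by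
    rw [hW, div_pow, mul_pow, mul_pow, mul_pow, Real.sq_sqrt (sub_pos.2 h.δ_lt_one).le,
      Real.sq_sqrt h.MSq_nonneg, Real.sq_sqrt h.γmu_pos.le]
    norm_num
  have hinv : S.theta⁻¹ = m + X + 4 * Y / S.γ + W := by
    rw [h.theta_inv, hX, hY, hW]
    congr 2
    field_simp
  have hone : S.theta * (m + X + 4 * Y / S.γ + W) = 1 := by
    rw [← hinv, mul_inv_cancel₀ h5.ne']
  have hX0 : 0 ≤ X := by
    have := h.RSq_nonneg
    positivity
  have hY0 : 0 ≤ Y := by positivity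
  have hm := h.m_pos
  have hWle : S.theta * W ≤ 1 := by
    have : 0 ≤ S.theta * (m + X + 4 * Y / S.γ) := by positivity
    linarith
  have e1 : 2 * (S.rho + S.theta * S.mu) * (1 - S.δ) * S.theta ^ 2 * S.MSq / (S.mu ^ 2 * S.δ ^ 2)
      = S.theta ^ 2 * Y + S.γ * S.theta ^ 3 / 2 * W ^ 2 := by
    rw [hW2, ← hb]
    field_simp
    ring
  have e2 : S.theta ^ 2 * (S.RSq + S.Rm ^ 2 / n) / (2 * S.mu) = S.γ * S.theta ^ 2 / 2 * X := by
    rw [hX]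
    field_simp
  have e3 : 1 - S.theta * m = S.theta * (X + 4 * Y / S.γ + W) := by linarith
  have e4 : S.theta * S.γ * (S.theta * (X + 4 * Y / S.γ + W)) / 2
      = S.γ * S.theta ^ 2 / 2 * X + 2 * S.theta ^ 2 * Y + S.γ * S.theta ^ 2 / 2 * W := by
    field_simp
    ring
  rw [e1, e2, e3, e4]
  have : S.γ * S.theta ^ 2 / 2 * W * (S.theta * W) ≤ S.γ * S.theta ^ 2 / 2 * W * 1 := by
    gcongr
  linarith

lemma MSq_le : S.MSq ≤ 18 * S.RSq + 9 * S.δ * (S.Rm ^ 2 / n) := by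
  have h1 : S.RbarSq / n ≤ S.RSq := by
    rw [div_le_iff₀' h.n_pos]
    exact h.RbarSq_le
  have : S.MSq = 2 * S.RSq + 16 * (S.RbarSq / n) + 9 * S.δ * (S.Rm ^ 2 / n) := by
    unfold MSq
    ring
  linarith

lemma rate_eq : S.rate = 1 / S.δ + m + (S.Rm ^ 2 / n / (S.γ * S.mu) + S.RSq / (S.γ * S.mu)
    + √(1 - S.δ) / S.δ * (S.RSq / (S.γ * S.mu))) := by
  have h2 := h.γ_pos
  have h3 := h.δ_pos
  have h4 := h.mu_pos
  have hn := h.n_pos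
  unfold rate a₄
  field_simp

lemma rate_pos : 0 < S.rate := by
  have h2 := h.γmu_pos
  have h3 := h.δ_pos
  have hn := h.n_pos
  have := h.RSq_nonneg
  rw [h.rate_eq]
  positivity

lemma sqrt_one_sub_δ_le : √(1 - S.δ) ≤ 1 := by
  have := h.δ_pos
  exact Real.sqrt_le_one.2 (by linarith)

/-- With M² ≤ 18R² + 9δR_m²/n, the arithmetic-geometric mean inequality turns both terms of 1/θ that
contain M into summands of the rate. The largest resulting coefficient is 38 + 18 = 56. -/
lemma theta_inv_le : S.theta⁻¹ ≤ 60 * S.rate := by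
  have h2 := h.γmu_pos
  have h3 := h.δ_pos
  have hn := h.n_pos
  have hm := h.m_pos
  have hR := h.RSq_nonneg
  have hM := h.MSq_nonneg
  have hMle := h.MSq_le
  have hw1 := h.sqrt_one_sub_δ_le
  rw [h.theta_inv, h.rate_eq]
  set G := S.γ * S.mu with hG
  set b := S.Rm ^ 2 / n with hb
  have hb0 : 0 ≤ b := by positivity
  set w := √(1 - S.δ) with hw
  have hw0 : 0 ≤ w := Real.sqrt_nonneg _
  have e1 : 4 * w * √S.RSq * √S.MSq / (S.δ * S.γ * S.mu)
      ≤ 38 * (w / S.δ * (S.RSq / G)) + 18 * (b / G) := by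
    have i1 : √S.RSq * √S.MSq ≤ (S.RSq + S.MSq) / 2 := by
      nlinarith [sq_nonneg (√S.RSq - √S.MSq), Real.sq_sqrt hR, Real.sq_sqrt hM]
    have i2 : √S.RSq * √S.MSq ≤ 19 / 2 * S.RSq + 9 / 2 * S.δ * b := by linarith
    calc 4 * w * √S.RSq * √S.MSq / (S.δ * S.γ * S.mu)
        = 4 * w / (S.δ * G) * (√S.RSq * √S.MSq) := by rw [hG]; field_simp
      _ ≤ 4 * w / (S.δ * G) * (19 / 2 * S.RSq + 9 / 2 * S.δ * b) := by gcongr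
      _ = 38 * (w / S.δ * (S.RSq / G)) + w * (18 * (b / G)) := by field_simp; ring
      _ ≤ 38 * (w / S.δ * (S.RSq / G)) + 1 * (18 * (b / G)) := by gcongr
      _ = _ := by ring
  have e2 : 2 * w * √S.MSq / (S.δ * √G) ≤ 1 / S.δ + 18 * (w / S.δ * (S.RSq / G)) + 9 * (b / G) := by
    have hG' : 0 < √G := Real.sqrt_pos.2 h2
    have i1 : 2 * w * √S.MSq / (S.δ * √G) ≤ 1 / S.δ + w ^ 2 * S.MSq / (S.δ * G) := by
      have : 0 ≤ 1 / S.δ * (1 - w * √S.MSq / √G) ^ 2 := by positivity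
      have e : 1 / S.δ * (1 - w * √S.MSq / √G) ^ 2
          = 1 / S.δ + w ^ 2 * √S.MSq ^ 2 / (S.δ * √G ^ 2) - 2 * w * √S.MSq / (S.δ * √G) := by
        field_simp
        ring
      rw [Real.sq_sqrt hM, Real.sq_sqrt h2.le] at e
      linarith
    have i2 : w ^ 2 * S.MSq / (S.δ * G) ≤ 18 * (w / S.δ * (S.RSq / G)) + 9 * (b / G) :=
      calc w ^ 2 * S.MSq / (S.δ * G) ≤ w ^ 2 * (18 * S.RSq + 9 * S.δ * b) / (S.δ * G) := by gcongr
        _ = w * (18 * (w / S.δ * (S.RSq / G))) + w * (w * (9 * (b / G))) := by field_simp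
        _ ≤ 1 * (18 * (w / S.δ * (S.RSq / G))) + 1 * (1 * (9 * (b / G))) := by gcongr
        _ = _ := by ring
    linarith
  have e3 : (S.RSq + b) / G = S.RSq / G + b / G := add_div _ _ _
  have p1 : 0 ≤ S.RSq / G := by positivity
  have p2 : 0 ≤ b / G := by positivity
  have p3 : 0 ≤ w / S.δ * (S.RSq / G) := by positivity
  have p4 : 0 ≤ 1 / S.δ := by positivity
  rw [e3]
  linarith

lemma one_le_N_div : 1 ≤ S.N / S.δ := by
  have h1 : (1 : ℝ) ≤ m := by exact_mod_cast h.one_le_m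
  have h2 : (1 : ℝ) ≤ n := by exact_mod_cast h.one_le_n
  rw [one_le_div h.δ_pos, N]
  nlinarith [h.δ_lt_one]

/-- A crude bound suffices, since it enters only through the logarithm, via `stopFactor_le`. -/
lemma rate_le : S.rate ≤ 3 * (S.N / S.δ * (1 + S.RSq / (S.γ * S.mu))) := by
  have h1 : (1 : ℝ) ≤ m := by exact_mod_cast h.one_le_m
  have h2 : (1 : ℝ) ≤ n := by exact_mod_cast h.one_le_n
  have h3 := h.δ_pos
  have h4 := h.δ_lt_one
  have hn := h.n_pos
  have hG := h.γmu_pos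
  have hR := h.RSq_nonneg
  have hN1 := h.one_le_N_div
  have hmN : (m : ℝ) ≤ S.N / S.δ := by
    rw [le_div_iff₀ h3, N]
    nlinarith
  have hδN : 1 / S.δ ≤ S.N / S.δ := by
    gcongr
    rw [N]
    nlinarith
  have hb : S.Rm ^ 2 / n ≤ S.N / S.δ * S.RSq := by
    refine le_trans ?_ (mul_le_mul_of_nonneg_right hmN hR)
    rw [div_le_iff₀ hn]
    linarith [h.Rm_sq_le]
  have hw : √(1 - S.δ) / S.δ ≤ S.N / S.δ := by
    refine le_trans ?_ hδN
    gcongr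
    exact h.sqrt_one_sub_δ_le
  rw [h.rate_eq]
  have p1 : 0 ≤ S.RSq / (S.γ * S.mu) := by positivity
  have i1 : S.Rm ^ 2 / n / (S.γ * S.mu) ≤ S.N / S.δ * (S.RSq / (S.γ * S.mu)) := by
    rw [← mul_div_assoc]
    gcongr
  have i2 := mul_le_mul_of_nonneg_right hw p1
  have i3 := mul_le_mul_of_nonneg_right hN1 p1
  linarith

end Valid

end Setup

/-! ### Moments of independent draws -/

set_option linter.unusedSectionVars false

section Draws

variable {m : ℕ} [NeZero m] {Ξ : Type*} [MeasurableSpace Ξ] {ν : Measure Ξ} [IsProbabilityMeasure ν]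

/-- The law of a draw: a uniform index and an independent variable of law `ν`. -/
def drawLaw (m : ℕ) {Ξ : Type*} [MeasurableSpace Ξ] (ν : Measure Ξ) : Measure (Fin m × Ξ) :=
  (uniformOn (Set.univ : Set (Fin m))).prod ν

instance : IsProbabilityMeasure (drawLaw m ν) := by
  unfold drawLaw
  infer_instance

variable {E : Type*} [NormedAddCommGroup E] [NormedSpace ℝ E] {f : Fin m × Ξ → E}

lemma integrable_drawLaw (hf : StronglyMeasurable f) (hi : ∀ i, Integrable (fun ξ => f (i, ξ)) ν) :
    Integrable f (drawLaw m ν) :=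
  (integrable_prod_iff hf.aestronglyMeasurable).2
    ⟨Filter.Eventually.of_forall hi, Integrable.of_finite⟩

lemma integral_drawLaw [CompleteSpace E] (hf : Integrable f (drawLaw m ν)) :
    ∫ w, f w ∂(drawLaw m ν) = (1 / (m : ℝ)) • ∑ i, ∫ ξ, f (i, ξ) ∂ν := by
  unfold drawLaw at hf ⊢
  rw [integral_prod _ hf, integral_fintype, Finset.smul_sum]
  swap
  · exact Integrable.of_finite
  refine Finset.sum_congr rfl fun i _ => ?_
  congr 1
  rw [measureReal_def, uniformOn_univ]
  simp

lemma integral_drawLaw_fst [CompleteSpace E] (F : Fin m → E) :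
    Integrable (fun w => F w.1) (drawLaw m ν) ∧
    ∫ w, F w.1 ∂(drawLaw m ν) = (1 / (m : ℝ)) • ∑ i, F i := by
  have hi : Integrable (fun w : Fin m × Ξ => F w.1) (drawLaw m ν) :=
    integrable_drawLaw ((StronglyMeasurable.of_discrete (f := F)).comp_measurable measurable_fst)
      fun i => integrable_const (F i)
  exact ⟨hi, by simpa using integral_drawLaw hi⟩

end Draws

/-! ### Sums over independent nodes -/

section Pi

variable {n d : ℕ} {X : Type*} [MeasurableSpace X] {ϖ : Measure X} [IsProbabilityMeasure ϖ]

lemma integral_sum_pi {E : Type*} [NormedAddCommGroup E] [NormedSpace ℝ E] {F : Fin n → X → E}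
    (hF : ∀ τ, Integrable (F τ) ϖ) :
    Integrable (fun w : Fin n → X => ∑ τ, F τ (w τ)) (Measure.pi fun _ => ϖ) ∧
    ∫ w : Fin n → X, ∑ τ, F τ (w τ) ∂(Measure.pi fun _ => ϖ) = ∑ τ, ∫ x, F τ x ∂ϖ := by
  have hi : ∀ τ, Integrable (fun w : Fin n → X => F τ (w τ)) (Measure.pi fun _ => ϖ) := fun τ =>
    integrable_comp_eval (μ := fun _ : Fin n => ϖ) (hF τ)
  refine ⟨integrable_finsetSum _ fun τ _ => hi τ, ?_⟩
  rw [integral_finsetSum _ fun τ _ => hi τ]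
  exact Finset.sum_congr rfl fun τ _ =>
    integral_comp_eval (μ := fun _ : Fin n => ϖ) (hF τ).aestronglyMeasurable

lemma integral_coord {F : X → Vec d} (hF : Integrable F ϖ) (j : Fin d) :
    (∫ x, F x ∂ϖ) j = ∫ x, F x j ∂ϖ :=
  ((EuclideanSpace.proj j : Vec d →L[ℝ] ℝ).integral_comp_comm hF).symm

lemma memLp_coord {F : X → Vec d} (hF : MemLp F 2 ϖ) (j : Fin d) :
    MemLp (fun x => F x j) 2 ϖ :=
  (EuclideanSpace.proj j : Vec d →L[ℝ] ℝ).comp_memLp' hF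

/-- The second moment of a sum of independent random vectors. -/
lemma integral_norm_sum_sq_pi {F : Fin n → X → Vec d} (hF : ∀ τ, MemLp (F τ) 2 ϖ) :
    Integrable (fun w : Fin n → X => ‖∑ τ, F τ (w τ)‖ ^ 2) (Measure.pi fun _ => ϖ) ∧
    ∫ w : Fin n → X, ‖∑ τ, F τ (w τ)‖ ^ 2 ∂(Measure.pi fun _ => ϖ)
      = ‖∑ τ, ∫ x, F τ x ∂ϖ‖ ^ 2 + ∑ τ, (∫ x, ‖F τ x‖ ^ 2 ∂ϖ - ‖∫ x, F τ x ∂ϖ‖ ^ 2) := by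
  have hL : MemLp (fun w : Fin n → X => ∑ τ, F τ (w τ)) 2 (Measure.pi fun _ => ϖ) :=
    memLp_finsetSum _ fun τ _ =>
      (hF τ).comp_measurePreserving (measurePreserving_eval (fun _ : Fin n => ϖ) τ)
  refine ⟨hL.integrable_norm_pow two_ne_zero, ?_⟩
  have hI : ∀ τ, Integrable (F τ) ϖ := fun τ => (hF τ).integrable one_le_two
  -- In each coordinate this is additivity of the variance under the product measure.
  have hcoord : ∀ j, ∫ w : Fin n → X, (∑ τ, F τ (w τ) j) ^ 2 ∂(Measure.pi fun _ => ϖ)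
      = (∑ τ, ∫ x, F τ x j ∂ϖ) ^ 2 + ∑ τ, (∫ x, F τ x j ^ 2 ∂ϖ - (∫ x, F τ x j ∂ϖ) ^ 2) := by
    intro j
    have hj := fun τ => memLp_coord (hF τ) j
    have hs : MemLp (fun w : Fin n → X => ∑ τ, F τ (w τ) j) 2 (Measure.pi fun _ => ϖ) :=
      memLp_finsetSum _ fun τ _ =>
        (hj τ).comp_measurePreserving (measurePreserving_eval (fun _ : Fin n => ϖ) τ)
    have h1 := variance_sum_pi (μ := fun _ : Fin n => ϖ) (X := fun τ x => F τ x j) hj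
    have e : (∑ τ, fun w : Fin n → X => F τ (w τ) j) = fun w => ∑ τ, F τ (w τ) j := by
      ext w
      simp
    rw [e, variance_eq_sub hs] at h1
    have h2 : ∀ τ, Var[fun x => F τ x j; ϖ] = ∫ x, F τ x j ^ 2 ∂ϖ - (∫ x, F τ x j ∂ϖ) ^ 2 :=
      fun τ => variance_eq_sub (hj τ)
    simp only [h2] at h1
    rw [(integral_sum_pi fun τ => (hj τ).integrable one_le_two).2] at h1
    simp only [Pi.pow_apply] at h1
    linarith
  have hsq : ∀ τ, ∫ x, ‖F τ x‖ ^ 2 ∂ϖ = ∑ j, ∫ x, F τ x j ^ 2 ∂ϖ := fun τ => by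
    rw [← integral_finsetSum _ fun j _ => (memLp_coord (hF τ) j).integrable_sq]
    simp only [EuclideanSpace.norm_sq_eq, Real.norm_eq_abs, sq_abs]
  have hsum : ∫ w : Fin n → X, ‖∑ τ, F τ (w τ)‖ ^ 2 ∂(Measure.pi fun _ => ϖ)
      = ∑ j, ∫ w : Fin n → X, (∑ τ, F τ (w τ) j) ^ 2 ∂(Measure.pi fun _ => ϖ) := by
    rw [← integral_finsetSum]
    · simp only [EuclideanSpace.norm_sq_eq, Real.norm_eq_abs, sq_abs, WithLp.ofLp_sum,
        Finset.sum_apply]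
    · intro j _
      have := (memLp_coord hL j).integrable_sq
      simpa only [WithLp.ofLp_sum, Finset.sum_apply] using this
  rw [hsum]
  simp only [hcoord, hsq]
  simp only [EuclideanSpace.norm_sq_eq, Real.norm_eq_abs, sq_abs, WithLp.ofLp_sum,
    Finset.sum_apply, integral_coord (hI _), Finset.sum_add_distrib, Finset.sum_sub_distrib]
  rw [Finset.sum_comm (f := fun j τ => ∫ x, F τ x j ^ 2 ∂ϖ),
    Finset.sum_comm (f := fun j τ => (∫ x, F τ x j ∂ϖ) ^ 2)]

end Pi

/-! ### Moments of the compression error -/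

section Compressor

variable {d : ℕ} {Ξ : Type*} [MeasurableSpace Ξ] {ν : Measure Ξ} [IsProbabilityMeasure ν]
  {Q : Ξ → Vec d → Vec d} {δ : ℝ}

lemma IsContractionCompressor.memLp_error (hQ : IsContractionCompressor ν Q δ) (x : Vec d) :
    MemLp (fun ξ => x - Q ξ x) 2 ν := by
  have hm : Measurable (fun ξ => x - Q ξ x) :=
    (hQ.measurable.comp (measurable_id.prodMk measurable_const)).const_sub x
  exact (memLp_two_iff_integrable_sq_norm hm.aestronglyMeasurable).2 (hQ.integrable x)

lemma IsContractionCompressor.integral_error (hQ : IsContractionCompressor ν Q δ)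
    (hmean : ∀ x, ∫ ξ, Q ξ x ∂ν = δ • x) (x : Vec d) :
    ∫ ξ, (x - Q ξ x) ∂ν = (1 - δ) • x := by
  have h1 : Integrable (fun ξ => x - Q ξ x) ν := (hQ.memLp_error x).integrable one_le_two
  have h2 : Integrable (fun ξ => Q ξ x) ν := by
    have h3 := (integrable_const x).sub h1
    simpa [Pi.sub_def] using h3
  rw [integral_sub (integrable_const x) h2, hmean]
  simp [sub_smul]

variable {m : ℕ} [NeZero m]

/-- Moments of the compression error of a vector `c i` depending on the sampled index. -/
lemma IsContractionCompressor.moments (hQ : IsContractionCompressor ν Q δ)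
    (hmean : ∀ x, ∫ ξ, Q ξ x ∂ν = δ • x) (c : Fin m → Vec d) :
    MemLp (fun w : Fin m × Ξ => c w.1 - Q w.2 (c w.1)) 2 (drawLaw m ν) ∧
    ∫ w, (c w.1 - Q w.2 (c w.1)) ∂(drawLaw m ν) = (1 - δ) • (1 / (m : ℝ)) • ∑ i, c i ∧
    ∫ w, ‖c w.1 - Q w.2 (c w.1)‖ ^ 2 ∂(drawLaw m ν) ≤ (1 - δ) * (1 / (m : ℝ) * ∑ i, ‖c i‖ ^ 2) := by
  have hc : Measurable (fun w : Fin m × Ξ => c w.1) :=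
    (measurable_of_finite c).comp measurable_fst
  have hm : Measurable (fun w : Fin m × Ξ => c w.1 - Q w.2 (c w.1)) :=
    hc.sub (hQ.measurable.comp (measurable_snd.prodMk hc))
  have hsq : Integrable (fun w : Fin m × Ξ => ‖c w.1 - Q w.2 (c w.1)‖ ^ 2) (drawLaw m ν) :=
    integrable_drawLaw (hm.norm.pow_const 2).stronglyMeasurable fun i => hQ.integrable (c i)
  have hL := (memLp_two_iff_integrable_sq_norm hm.aestronglyMeasurable).2 hsq
  refine ⟨hL, ?_, ?_⟩
  · rw [integral_drawLaw (hL.integrable one_le_two), Finset.smul_sum, Finset.smul_sum,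
      Finset.smul_sum]
    refine Finset.sum_congr rfl fun i _ => ?_
    rw [smul_comm (1 - δ)]
    exact congrArg _ (hQ.integral_error hmean (c i))
  · rw [integral_drawLaw hsq, smul_eq_mul, mul_left_comm, Finset.mul_sum (a := 1 - δ)]
    exact mul_le_mul_of_nonneg_left (Finset.sum_le_sum fun i _ => hQ.contraction (c i))
      (by positivity : (0 : ℝ) ≤ 1 / (m : ℝ))

end Compressor

lemma coe_sum_ereal {ι : Type*} (s : Finset ι) (f : ι → ℝ) :
    ((∑ i ∈ s, f i : ℝ) : EReal) = ∑ i ∈ s, (f i : EReal) := by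
  classical
  induction s using Finset.induction_on with
  | empty => simp
  | insert a s ha ih => rw [Finset.sum_insert ha, Finset.sum_insert ha, EReal.coe_add, ih]

namespace Setup

set_option linter.unusedSectionVars false

variable {d t m n : ℕ} {Ξ : Type*} [MeasurableSpace Ξ] {S : Setup d t m n Ξ} {ν : Measure Ξ}

/-! ### Primal and dual objectives of the subproblems -/

/-- The real value of the dual objective, meaningful where the conjugates are finite. -/
def dualR (S : Setup d t m n Ξ) (y : Vec d) (α : Fin n → Fin m → Vec t) : ℝ :=
  -(1 / S.N * ∑ τ, ∑ i, conjR (S.φ τ i) (-(α τ i))) - S.mu * conjR (S.xi y) (S.v α)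

/-- The error part of the Lyapunov function. -/
def errR (S : Setup d t m n Ξ) (s : InnerState d t m n) : ℝ :=
  2 * (S.rho + S.theta * S.mu) / S.δ * ‖(1 / (n : ℝ)) • ∑ τ, s.e τ‖ ^ 2
    + 16 * (1 - S.δ) * (S.rho + S.theta * S.mu) / (S.δ * n ^ 2) * ∑ τ, ‖s.e τ‖ ^ 2

/-- The real value of the Lyapunov function. -/
def lyap (S : Setup d t m n Ξ) (y : Vec d) (s : InnerState d t m n) : ℝ :=
  S.Gmin y - S.dualR y s.α + S.errR s

/-- Dual variables at which all the conjugates are finite. -/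
def DualFinite (S : Setup d t m n Ξ) (α : Fin n → Fin m → Vec t) : Prop :=
  ∀ τ i, conj (S.φ τ i) (-(α τ i)) ≠ ⊤

/-- The invariants of EC-SDCA. -/
structure Inv (S : Setup d t m n Ξ) (s : InnerState d t m n) : Prop where
  finite : S.DualFinite s.α
  link : s.u + (1 / (n : ℝ)) • ∑ τ, s.e τ = S.v s.α

namespace Valid

variable (h : S.Valid ν)
include h

lemma strongConvexOn_P : StrongConvexOn Set.univ S.lam S.P := by
  refine ⟨convex_univ, fun x _ z _ a b ha hb hab => ?_⟩
  have h1 := h.strong.2 (Set.mem_univ x) (Set.mem_univ z) ha hb hab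
  have h2 : ∑ τ, ∑ i, S.φ τ i ((S.A τ i).adjoint (a • x + b • z))
      ≤ a * ∑ τ, ∑ i, S.φ τ i ((S.A τ i).adjoint x)
        + b * ∑ τ, ∑ i, S.φ τ i ((S.A τ i).adjoint z) := by
    simp only [Finset.mul_sum]
    rw [← Finset.sum_add_distrib]
    refine Finset.sum_le_sum fun τ _ => ?_
    rw [← Finset.sum_add_distrib]
    refine Finset.sum_le_sum fun i _ => ?_
    rw [map_add, map_smul, map_smul]
    exact (h.smooth τ i).convex.2 (Set.mem_univ _) (Set.mem_univ _) ha hb hab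
  have hN := h.N_pos
  have h3 := mul_le_mul_of_nonneg_left h2 (by positivity : 0 ≤ 1 / S.N)
  simp only [smul_eq_mul, P] at h1 h3 ⊢
  linarith

lemma strongConvexOn_G (y : Vec d) : StrongConvexOn Set.univ S.mu (S.G y) :=
  StrongConvexOn.add_sq h.strongConvexOn_P y

lemma strongConvexOn_xi (y : Vec d) : StrongConvexOn Set.univ 1 (S.xi y) := by
  have h1 := StrongConvexOn.div_const (StrongConvexOn.add_sq (k := S.κ) h.strong y) h.mu_pos
  rwa [show (S.lam + S.κ) / S.mu = 1 from div_self h.mu_pos.ne'] at h1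

lemma conj_xi_ne_top (y u : Vec d) : conj (S.xi y) u ≠ ⊤ :=
  conj_ne_top_of_strongConvexOn one_pos (h.strongConvexOn_xi y) u

lemma exists_min_G (y : Vec d) : ∃ x, S.G y x = S.Gmin y ∧ ∀ z, S.G y x ≤ S.G y z := by
  obtain ⟨x, hx⟩ := StrongConvexOn.exists_forall_le h.mu_pos (h.strongConvexOn_G y)
  refine ⟨x, le_antisymm (le_ciInf hx) (ciInf_le ⟨S.G y x, ?_⟩ x), hx⟩
  rintro _ ⟨z, rfl⟩
  exact hx z

lemma exists_min_P : ∃ x, S.P x = S.Pmin ∧ ∀ z, S.P x ≤ S.P z := by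
  obtain ⟨x, hx⟩ := StrongConvexOn.exists_forall_le h.lam_pos h.strongConvexOn_P
  refine ⟨x, le_antisymm (le_ciInf hx) (ciInf_le ⟨S.P x, ?_⟩ x), hx⟩
  rintro _ ⟨z, rfl⟩
  exact hx z

lemma Gmin_le (y x : Vec d) : S.Gmin y ≤ S.G y x := by
  obtain ⟨z, h1, h2⟩ := h.exists_min_G y
  exact h1 ▸ h2 x

lemma G_eq (y x : Vec d) : S.G y x
    = 1 / S.N * ∑ τ, ∑ i, S.φ τ i ((S.A τ i).adjoint x) + S.mu * S.xi y x := by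
  have := h.mu_pos
  unfold G P xi
  field_simp
  ring

omit h in
lemma mu_inner_v (h : S.Valid ν) (α : Fin n → Fin m → Vec t) (x : Vec d) :
    S.mu * inner ℝ x (S.v α)
      = 1 / S.N * ∑ τ, ∑ i, inner ℝ ((S.A τ i).adjoint x) (α τ i) := by
  have := h.mu_pos
  have := h.N_pos
  unfold v
  rw [real_inner_smul_right, inner_sum]
  simp only [inner_sum, ContinuousLinearMap.adjoint_inner_left]
  field_simp

/-- Weak duality with a quadratic remainder. -/
lemma weak_duality (y x : Vec d) {α : Fin n → Fin m → Vec t} (hα : S.DualFinite α) :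
    S.mu / 2 * ‖x - gradConj (S.xi y) (S.v α)‖ ^ 2 ≤ S.G y x - S.dualR y α := by
  have h1 := inner_sub_add_sq_le one_pos (h.strongConvexOn_xi y) (S.v α) x
  rw [← conjR_eq one_pos (h.strongConvexOn_xi y)] at h1
  have h2 : -∑ τ, ∑ i, inner ℝ ((S.A τ i).adjoint x) (α τ i)
      ≤ ∑ τ, ∑ i, S.φ τ i ((S.A τ i).adjoint x) + ∑ τ, ∑ i, conjR (S.φ τ i) (-(α τ i)) := by
    rw [← Finset.sum_add_distrib, ← Finset.sum_neg_distrib]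
    refine Finset.sum_le_sum fun τ _ => ?_
    rw [← Finset.sum_add_distrib, ← Finset.sum_neg_distrib]
    refine Finset.sum_le_sum fun i _ => ?_
    have := le_conjR (hα τ i) ((S.A τ i).adjoint x)
    rw [inner_neg_right] at this
    linarith
  have hN := h.N_pos
  have hmu := h.mu_pos
  have h3 := mul_le_mul_of_nonneg_left h2 (by positivity : 0 ≤ 1 / S.N)
  have h4 := h.mu_inner_v α x
  have h5 := mul_le_mul_of_nonneg_left h1 hmu.le
  rw [h.G_eq]
  unfold dualR
  linarith

lemma dualR_le_Gmin (y : Vec d) {α : Fin n → Fin m → Vec t} (hα : S.DualFinite α) :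
    S.dualR y α ≤ S.Gmin y := by
  obtain ⟨x, h1, -⟩ := h.exists_min_G y
  have h2 := h.weak_duality y x hα
  have := h.mu_pos
  have : 0 ≤ S.mu / 2 * ‖x - gradConj (S.xi y) (S.v α)‖ ^ 2 := by positivity
  linarith

lemma errR_nonneg (s : InnerState d t m n) : 0 ≤ S.errR s := by
  have h1 := h.rho_nonneg
  have h2 := h.theta_pos
  have h3 := h.mu_pos
  have h4 := h.δ_pos
  have h5 := sub_pos.2 h.δ_lt_one
  unfold errR
  positivity

lemma lyap_nonneg (y : Vec d) {s : InnerState d t m n} (hs : S.Inv s) : 0 ≤ S.lyap y s := by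
  have := h.dualR_le_Gmin y hs.finite
  have := h.errR_nonneg s
  unfold lyap
  linarith

/-- Finite conjugates exclude infinite values of the dual objective, so the stopping rule can be
handled in ℝ. -/
lemma coe_dualR (y : Vec d) {α : Fin n → Fin m → Vec t} (hα : S.DualFinite α) :
    (S.dualR y α : EReal) = S.D y α := by
  unfold dualR D
  have h1 : ∀ τ i, conj (S.φ τ i) (-(α τ i)) = (conjR (S.φ τ i) (-(α τ i)) : EReal) :=
    fun τ i => (coe_conjR (hα τ i)).symm
  simp only [h1]
  rw [← coe_conjR (h.conj_xi_ne_top y (S.v α))]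
  simp only [← coe_sum_ereal]
  norm_cast

lemma coe_lyap (y : Vec d) {s : InnerState d t m n} (hs : S.DualFinite s.α) :
    (S.lyap y s : EReal) = S.Psi₄ y s := by
  unfold lyap Psi₄ errR
  rw [← h.coe_dualR y hs]
  norm_cast

lemma stop_iff (y : Vec d) (ε : ℝ) {s : InnerState d t m n} (hs : S.DualFinite s.α) :
    S.Stop y ε s ↔ 3 * √(2 + S.δ * m) * S.lyap y s
      + 2 * (S.G y (S.primal y s) - S.Gmin y) ≤ ε := by
  unfold Stop
  rw [← h.coe_lyap y hs]
  norm_cast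

end Valid

end Setup

namespace Setup

set_option linter.unusedSectionVars false

variable {d t m n : ℕ} {Ξ : Type*} [MeasurableSpace Ξ] {S : Setup d t m n Ξ} {ν : Measure Ξ}

/-! ### One iteration of EC-SDCA -/

/-- The dual residual `-∇φ_{iτ}(A_{iτ}ᵀ x) - α_{iτ}`. -/
def resid (S : Setup d t m n Ξ) (y : Vec d) (s : InnerState d t m n) (τ : Fin n) (i : Fin m) :
    Vec t :=
  -gradient (S.φ τ i) ((S.A τ i).adjoint (S.primal y s)) - s.α τ i

/-- The increment of the local vector caused by updating a coordinate. -/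
def incr (S : Setup d t m n Ξ) (y : Vec d) (s : InnerState d t m n) (τ : Fin n) (i : Fin m) :
    Vec d :=
  (S.theta / S.mu) • S.A τ i (S.resid y s τ i)

/-- The mean squared dual residual at a node. -/
def residSq (S : Setup d t m n Ξ) (y : Vec d) (s : InnerState d t m n) (τ : Fin n) : ℝ :=
  1 / (m : ℝ) * ∑ i, ‖S.resid y s τ i‖ ^ 2

lemma dualStep_eq (y : Vec d) (s : InnerState d t m n) (τ : Fin n) (i : Fin m) :
    S.dualStep y s τ i = (S.theta * m) • S.resid y s τ i := by
  unfold dualStep resid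
  module

lemma innerStep_e (y : Vec d) (s : InnerState d t m n) (w : Fin n → Fin m × Ξ) (τ : Fin n) :
    (S.innerStep y w s).e τ
      = S.message y s τ (w τ).1 - S.Q (w τ).2 (S.message y s τ (w τ).1) := rfl

lemma sum_update_apply {ι : Type*} [Fintype ι] [DecidableEq ι] {β : ι → Type*} {M : Type*}
    [AddCommGroup M] (F : ∀ i, β i → M) (a : ∀ i, β i) (j : ι) (b : β j) :
    ∑ i, F i (Function.update a j b i) = ∑ i, F i (a i) + (F j b - F j (a j)) := by
  rw [← Finset.add_sum_erase _ _ (Finset.mem_univ j),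
    ← Finset.add_sum_erase (f := fun i => F i (a i)) _ (Finset.mem_univ j),
    Function.update_self]
  have : ∑ i ∈ Finset.univ.erase j, F i (Function.update a j b i)
      = ∑ i ∈ Finset.univ.erase j, F i (a i) :=
    Finset.sum_congr rfl fun i hi => by rw [Function.update_of_ne (Finset.ne_of_mem_erase hi)]
  rw [this]
  abel

namespace Valid

variable (h : S.Valid ν)
include h

lemma message_eq (y : Vec d) (s : InnerState d t m n) (τ : Fin n) (i : Fin m) :
    S.message y s τ i = S.incr y s τ i + s.e τ := by
  have := h.m_pos
  have := h.mu_pos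
  unfold message incr
  rw [dualStep_eq, map_smul, smul_smul]
  congr 2
  field_simp

lemma v_innerStep (y : Vec d) (s : InnerState d t m n) (w : Fin n → Fin m × Ξ) :
    S.v (S.innerStep y w s).α = S.v s.α + ∑ τ, (1 / (n : ℝ)) • S.incr y s τ (w τ).1 := by
  have hm := h.m_pos
  have hn := h.n_pos
  have hmu := h.mu_pos
  unfold v
  have e : ∀ τ, ∑ i, S.A τ i ((S.innerStep y w s).α τ i) = ∑ i, S.A τ i (s.α τ i)
      + S.A τ (w τ).1 ((S.theta * m) • S.resid y s τ (w τ).1) := fun τ => by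
    change ∑ i, S.A τ i (Function.update (s.α τ) (w τ).1
      (s.α τ (w τ).1 + S.dualStep y s τ (w τ).1) i) = _
    rw [sum_update_apply (fun i a => S.A τ i a), map_add, dualStep_eq]
    abel
  simp only [e, Finset.sum_add_distrib, smul_add]
  congr 1
  rw [Finset.smul_sum]
  refine Finset.sum_congr rfl fun τ _ => ?_
  unfold incr
  rw [map_smul, smul_smul, smul_smul, N]
  congr 1
  field_simp

/-- The update moves -α_i the fraction θm ≤ 1 of the way to ∇φ(ζ), where φ^* is given by Fenchel's
equality; strong convexity of φ^* supplies the negative residual term. -/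
lemma conj_step (y : Vec d) {s : InnerState d t m n} (hs : S.DualFinite s.α) (τ : Fin n)
    (i : Fin m) :
    conj (S.φ τ i) (-(s.α τ i + S.dualStep y s τ i)) ≠ ⊤ ∧
    conjR (S.φ τ i) (-(s.α τ i + S.dualStep y s τ i)) - conjR (S.φ τ i) (-(s.α τ i))
      ≤ S.theta * m * (-inner ℝ ((S.A τ i).adjoint (S.primal y s)) (S.resid y s τ i + s.α τ i)
          - S.φ τ i ((S.A τ i).adjoint (S.primal y s)) - conjR (S.φ τ i) (-(s.α τ i)))
        - S.γ / 2 * (S.theta * m) * (1 - S.theta * m) * ‖S.resid y s τ i‖ ^ 2 := by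
  set ζ := (S.A τ i).adjoint (S.primal y s) with hζ
  have hr : S.resid y s τ i = -gradient (S.φ τ i) ζ - s.α τ i := rfl
  have hg : -(S.resid y s τ i + s.α τ i) = gradient (S.φ τ i) ζ := by rw [hr]; abel
  obtain ⟨g1, g2⟩ := (h.smooth τ i).conj_gradient ζ
  have hs0 : 0 ≤ S.theta * m := mul_nonneg h.theta_pos.le h.m_pos.le
  obtain ⟨c1, c2⟩ := (h.smooth τ i).conjR_combo_le h.γ_pos (hs τ i) g1 hs0 h.theta_mul_m_le
  have e : (1 - S.theta * m) • (-(s.α τ i)) + (S.theta * m) • gradient (S.φ τ i) ζ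
      = -(s.α τ i + S.dualStep y s τ i) := by
    rw [dualStep_eq, hr]
    module
  have e2 : -(s.α τ i) - gradient (S.φ τ i) ζ = S.resid y s τ i := by rw [hr]; abel
  rw [e] at c1 c2
  rw [e2, g2] at c2
  refine ⟨c1, ?_⟩
  rw [← inner_neg_right, hg]
  linarith

lemma inv_init {α : Fin n → Fin m → Vec t} (hα : S.DualFinite α) : S.Inv (S.innerInit α) :=
  ⟨hα, by simp [innerInit]⟩

/-- What Q drops from u is exactly what e keeps, so u + ē moves by the uncompressed increments, as
v(α) does. Finiteness persists because the domain of φ^* is convex and contains the gradients of φ.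
-/
lemma inv_step (y : Vec d) {s : InnerState d t m n} (hs : S.Inv s) (w : Fin n → Fin m × Ξ) :
    S.Inv (S.innerStep y w s) := by
  refine ⟨fun τ i => ?_, ?_⟩
  · change conj (S.φ τ i) (-(Function.update (s.α τ) (w τ).1
      (s.α τ (w τ).1 + S.dualStep y s τ (w τ).1) i)) ≠ ⊤
    rcases eq_or_ne i (w τ).1 with rfl | hi
    · rw [Function.update_self]
      exact (h.conj_step y hs.finite τ _).1
    · rw [Function.update_of_ne hi]
      exact hs.finite τ i
  · rw [h.v_innerStep, ← hs.link]
    simp only [innerStep_e, h.message_eq]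
    change s.u + (1 / (n : ℝ)) • ∑ τ, S.Q (w τ).2 (S.message y s τ (w τ).1) + _ = _
    simp only [h.message_eq, Finset.sum_sub_distrib, Finset.sum_add_distrib, smul_sub, smul_add,
      Finset.smul_sum]
    abel

lemma inv_iter (y : Vec d) {α : Fin n → Fin m → Vec t} (hα : S.DualFinite α)
    (w : InnerDraws m n Ξ) (K : ℕ) : S.Inv (S.iter y α w K) := by
  induction K with
  | zero => exact h.inv_init hα
  | succ K ih => exact h.inv_step y ih (w K)

/-! #### Bounds on the increments -/

lemma residSq_nonneg (y : Vec d) (s : InnerState d t m n) (τ : Fin n) : 0 ≤ S.residSq y s τ := by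
  unfold residSq
  positivity

lemma mean_norm_incr_sq_le (y : Vec d) (s : InnerState d t m n) (τ : Fin n) :
    1 / (m : ℝ) * ∑ i, ‖S.incr y s τ i‖ ^ 2
      ≤ (S.theta / S.mu) ^ 2 * S.Rm ^ 2 * S.residSq y s τ := by
  have hm := h.m_pos
  unfold residSq
  rw [mul_left_comm]
  refine mul_le_mul_of_nonneg_left ?_ (by positivity)
  rw [Finset.mul_sum]
  refine Finset.sum_le_sum fun i _ => ?_
  unfold incr
  rw [norm_smul, mul_pow, Real.norm_eq_abs, sq_abs, mul_assoc]
  exact mul_le_mul_of_nonneg_left (h.norm_A_apply_sq_le τ i _) (by positivity)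

lemma norm_mean_incr_sq_le (y : Vec d) (s : InnerState d t m n) (τ : Fin n) :
    ‖(1 / (m : ℝ)) • ∑ i, S.incr y s τ i‖ ^ 2
      ≤ (S.theta / S.mu) ^ 2 * S.RbarSq * S.residSq y s τ := by
  have hm := h.m_pos
  have h1 := h.norm_sum_A_sq_le τ (S.resid y s τ)
  unfold residSq incr
  rw [← Finset.smul_sum, smul_smul, norm_smul, mul_pow, Real.norm_eq_abs, sq_abs]
  calc (1 / (m : ℝ) * (S.theta / S.mu)) ^ 2 * ‖∑ i, S.A τ i (S.resid y s τ i)‖ ^ 2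
      ≤ (1 / (m : ℝ) * (S.theta / S.mu)) ^ 2
        * (m * S.RbarSq * ∑ i, ‖S.resid y s τ i‖ ^ 2) := by gcongr
    _ = _ := by field_simp

lemma mean_incr (y : Vec d) (s : InnerState d t m n) :
    ∑ τ, (1 / (n : ℝ)) • (1 / (m : ℝ)) • ∑ i, S.incr y s τ i = S.theta • S.v (S.resid y s) := by
  have hm := h.m_pos
  have hn := h.n_pos
  have hmu := h.mu_pos
  unfold v incr
  simp only [← Finset.smul_sum, smul_smul, N]
  congr 1
  field_simp

lemma sum_residSq (y : Vec d) (s : InnerState d t m n) :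
    ∑ τ, ∑ i, ‖S.resid y s τ i‖ ^ 2 = m * ∑ τ, S.residSq y s τ := by
  have hm := h.m_pos
  unfold residSq
  rw [← Finset.mul_sum, ← mul_assoc, mul_one_div_cancel hm.ne', one_mul]

lemma norm_v_resid_sq_le (y : Vec d) (s : InnerState d t m n) :
    ‖S.v (S.resid y s)‖ ^ 2 ≤ S.RSq / S.mu ^ 2 * (1 / (n : ℝ) * ∑ τ, S.residSq y s τ) := by
  have hm := h.m_pos
  have hn := h.n_pos
  have hmu := h.mu_pos
  have h1 := h.norm_sum_sum_A_sq_le (S.resid y s)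
  rw [h.sum_residSq] at h1
  unfold v
  rw [norm_smul, mul_pow, Real.norm_eq_abs, sq_abs]
  calc (1 / (S.mu * S.N)) ^ 2 * ‖∑ τ, ∑ i, S.A τ i (S.resid y s τ i)‖ ^ 2
      ≤ (1 / (S.mu * S.N)) ^ 2 * (S.N * S.RSq * (m * ∑ τ, S.residSq y s τ)) := by gcongr
    _ = _ := by
      rw [N]
      field_simp

/-! #### The dual objective -/

/-- The bound on the change of `N⁻¹ φ^*` at a sampled coordinate, plus the linear part of the
change of `ξ^*`. -/
def _root_.ECSDCA.Setup.dualTerm (S : Setup d t m n Ξ) (y : Vec d) (s : InnerState d t m n)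
    (τ : Fin n) (i : Fin m) : ℝ :=
  1 / S.N * (S.theta * m * (-inner ℝ ((S.A τ i).adjoint (S.primal y s))
      (S.resid y s τ i + s.α τ i)
      - S.φ τ i ((S.A τ i).adjoint (S.primal y s)) - conjR (S.φ τ i) (-(s.α τ i)))
      - S.γ / 2 * (S.theta * m) * (1 - S.theta * m) * ‖S.resid y s τ i‖ ^ 2)
    + S.mu * inner ℝ (gradConj (S.xi y) (S.v s.α)) ((1 / (n : ℝ)) • S.incr y s τ i)

/-- The change of the φ^* terms separates over the nodes. The change of ξ^* is bounded by its
smoothness at v(α), and only the quadratic term there couples the nodes. -/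
lemma dualR_innerStep (y : Vec d) {s : InnerState d t m n} (hs : S.Inv s)
    (w : Fin n → Fin m × Ξ) :
    -S.dualR y (S.innerStep y w s).α ≤ -S.dualR y s.α + ∑ τ, S.dualTerm y s τ (w τ).1
      + S.mu / 2 * ‖∑ τ, (1 / (n : ℝ)) • S.incr y s τ (w τ).1‖ ^ 2 := by
  have hN := h.N_pos
  have hmu := h.mu_pos
  have h1 := conjR_add_le one_pos (h.strongConvexOn_xi y) (S.v s.α)
    (∑ τ, (1 / (n : ℝ)) • S.incr y s τ (w τ).1)
  rw [← h.v_innerStep, inner_sum] at h1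
  have e : ∀ τ, ∑ i, conjR (S.φ τ i) (-((S.innerStep y w s).α τ i))
      = ∑ i, conjR (S.φ τ i) (-(s.α τ i))
        + (conjR (S.φ τ (w τ).1) (-(s.α τ (w τ).1 + S.dualStep y s τ (w τ).1))
          - conjR (S.φ τ (w τ).1) (-(s.α τ (w τ).1))) := fun τ => by
    change ∑ i, conjR (S.φ τ i) (-(Function.update (s.α τ) (w τ).1
      (s.α τ (w τ).1 + S.dualStep y s τ (w τ).1) i)) = _
    rw [sum_update_apply (fun i a => conjR (S.φ τ i) (-a))]
  have h2 := Finset.sum_le_sum fun τ (_ : τ ∈ Finset.univ) =>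
    mul_le_mul_of_nonneg_left (h.conj_step y hs.finite τ (w τ).1).2
      (by positivity : 0 ≤ 1 / S.N)
  have h3 := mul_le_mul_of_nonneg_left h1 hmu.le
  unfold dualR dualTerm
  simp only [e]
  simp only [Finset.sum_add_distrib, ← Finset.mul_sum] at h2 ⊢
  linarith

/-- Averaging over the index turns θm into θ, and the linear parts would assemble to -θ(G(x) - D(α))
if x were ∇ξ^*(v(α)). In fact x = ∇ξ^*(u) with v(α) = u + ē. Up to the factor θμ, smoothness of ξ^*
costs ‖ē‖²/2, and the Lipschitz gradient costs ‖ē‖ times the norm of the averaged residual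
direction. -/
lemma mean_dualTerm_le (y : Vec d) {s : InnerState d t m n} (hs : S.Inv s) :
    ∑ τ, 1 / (m : ℝ) * ∑ i, S.dualTerm y s τ i
      ≤ -(S.theta * (S.G y (S.primal y s) - S.dualR y s.α))
        + S.theta * S.mu / 2 * ‖(1 / (n : ℝ)) • ∑ τ, s.e τ‖ ^ 2
        + S.theta * S.mu * (‖(1 / (n : ℝ)) • ∑ τ, s.e τ‖ * ‖S.v (S.resid y s)‖)
        - S.theta * S.γ * (1 - S.theta * m) / 2 * (1 / (n : ℝ) * ∑ τ, S.residSq y s τ) := by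
  have hm := h.m_pos
  have hn := h.n_pos
  have hmu := h.mu_pos
  have hθ := h.theta_pos
  set x := S.primal y s with hx
  set xv := gradConj (S.xi y) (S.v s.α) with hxv
  set eb := (1 / (n : ℝ)) • ∑ τ, s.e τ with heb
  set b := S.v (S.resid y s) with hb
  have hsum : ∑ τ, 1 / (m : ℝ) * ∑ i, S.dualTerm y s τ i
      = S.theta * (-(S.mu * inner ℝ x b) - S.mu * inner ℝ x (S.v s.α)
        - 1 / S.N * ∑ τ, ∑ i, S.φ τ i ((S.A τ i).adjoint x)
        - 1 / S.N * ∑ τ, ∑ i, conjR (S.φ τ i) (-(s.α τ i)))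
        - S.theta * S.γ * (1 - S.theta * m) / 2 * (1 / (n : ℝ) * ∑ τ, S.residSq y s τ)
        + S.theta * (S.mu * inner ℝ xv b) := by
    have e1 : S.theta * (S.mu * inner ℝ xv b) = ∑ τ, 1 / (m : ℝ) * ∑ i, S.mu *
        inner ℝ xv ((1 / (n : ℝ)) • S.incr y s τ i) := by
      rw [mul_left_comm, ← real_inner_smul_right, ← h.mean_incr y s, inner_sum, Finset.mul_sum]
      refine Finset.sum_congr rfl fun τ _ => ?_
      rw [real_inner_smul_right, real_inner_smul_right, inner_sum]
      simp only [real_inner_smul_right, ← Finset.mul_sum]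
      ring
    rw [e1, h.mu_inner_v, h.mu_inner_v]
    have e2 : 1 / (n : ℝ) * ∑ τ, S.residSq y s τ
        = 1 / S.N * ∑ τ, ∑ i, ‖S.resid y s τ i‖ ^ 2 := by
      rw [h.sum_residSq, N]
      field_simp
    rw [e2]
    unfold dualTerm
    simp only [Finset.sum_add_distrib, Finset.sum_sub_distrib, ← Finset.mul_sum, mul_add,
      inner_add_right, Finset.sum_neg_distrib, neg_add, ← hx, ← hxv]
    rw [add_left_inj]
    field_simp
    ring
  have hlink : S.v s.α = s.u + eb := hs.link.symm
  have hxdef : x = gradConj (S.xi y) s.u := rfl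
  have hξ := h.strongConvexOn_xi y
  have c1 := conjR_eq one_pos hξ s.u
  have c2 := conjR_add_le one_pos hξ s.u eb
  rw [← hxdef] at c1 c2
  rw [← hlink] at c2
  have c3 : inner ℝ x (S.v s.α) = inner ℝ x s.u + inner ℝ x eb := by
    rw [hlink, inner_add_right]
  have c4 : ‖xv - x‖ ≤ ‖eb‖ := by
    have := norm_gradConj_sub_le one_pos hξ (S.v s.α) s.u
    rwa [one_mul, hlink, add_sub_cancel_left, ← hlink] at this
  have c5 : inner ℝ xv b - inner ℝ x b ≤ ‖eb‖ * ‖b‖ := by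
    rw [← inner_sub_left]
    exact (real_inner_le_norm _ _).trans (by gcongr)
  have hG := h.G_eq y x
  have hD : S.dualR y s.α = -(1 / S.N * ∑ τ, ∑ i, conjR (S.φ τ i) (-(s.α τ i)))
    - S.mu * conjR (S.xi y) (S.v s.α) := rfl
  rw [hsum, hG, hD]
  have k1 : S.theta * S.mu * (inner ℝ xv b - inner ℝ x b) ≤ S.theta * S.mu * (‖eb‖ * ‖b‖) :=
    mul_le_mul_of_nonneg_left c5 (by positivity)
  have k2 : S.theta * S.mu * (S.xi y x + conjR (S.xi y) (S.v s.α) - inner ℝ x (S.v s.α))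
      ≤ S.theta * S.mu * (1 / 2 * ‖eb‖ ^ 2) :=
    mul_le_mul_of_nonneg_left (by linarith) (by positivity)
  linarith

end Valid

end Setup

/-! ### Arithmetic of the Lyapunov contraction -/

namespace Setup

set_option linter.unusedSectionVars false

variable {d t m n : ℕ} {Ξ : Type*} [MeasurableSpace Ξ] {S : Setup d t m n Ξ} {ν : Measure Ξ}

/-- The difference of the two sides is the square δ/2 ‖x - (2(1 - δ)/δ) y‖². The weight is chosen to
keep half of the contraction on x. -/
lemma young_shrink {d : ℕ} {δ : ℝ} (h₀ : 0 < δ) (x y : Vec d) :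
    (1 - δ) * ‖x + y‖ ^ 2 ≤ (1 - δ / 2) * ‖x‖ ^ 2 + (1 - δ) * (2 - δ) / δ * ‖y‖ ^ 2 := by
  have h1 : 0 ≤ δ / 2 * ‖x - (2 * (1 - δ) / δ) • y‖ ^ 2 := by positivity
  rw [norm_sub_sq_real, real_inner_smul_right, norm_smul, mul_pow, Real.norm_eq_abs, sq_abs] at h1
  rw [norm_add_sq_real]
  have e : δ / 2 * (‖x‖ ^ 2 - 2 * (2 * (1 - δ) / δ * inner ℝ x y)
      + (2 * (1 - δ) / δ) ^ 2 * ‖y‖ ^ 2)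
      = (1 - δ / 2) * ‖x‖ ^ 2 + (1 - δ) * (2 - δ) / δ * ‖y‖ ^ 2
        - (1 - δ) * (‖x‖ ^ 2 + 2 * inner ℝ x y + ‖y‖ ^ 2) := by
    field_simp
    ring
  linarith

lemma norm_add_sq_le_two {d : ℕ} (x y : Vec d) : ‖x + y‖ ^ 2 ≤ 2 * ‖x‖ ^ 2 + 2 * ‖y‖ ^ 2 := by
  have h1 : 0 ≤ ‖x - y‖ ^ 2 := by positivity
  rw [norm_sub_sq_real] at h1
  rw [norm_add_sq_real]
  linarith

/-- Bias–variance decomposition under the uniform law on the indices. -/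
lemma mean_norm_add_sq {m d : ℕ} (hm : (0 : ℝ) < m) (p : Fin m → Vec d) (x : Vec d) :
    1 / (m : ℝ) * ∑ i, ‖p i + x‖ ^ 2 = ‖x + (1 / (m : ℝ)) • ∑ i, p i‖ ^ 2
      + 1 / (m : ℝ) * ∑ i, ‖p i‖ ^ 2 - ‖(1 / (m : ℝ)) • ∑ i, p i‖ ^ 2 := by
  rw [norm_add_sq_real, real_inner_smul_right, inner_sum]
  simp only [norm_add_sq_real, Finset.sum_add_distrib, ← Finset.mul_sum, real_inner_comm x,
    Finset.sum_const, Finset.card_univ, Fintype.card_fin, nsmul_eq_mul]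
  field_simp
  ring

/-- These bounds account for the coefficients 2, 16 and 9 in M². -/
lemma shrink_coeffs {δ : ℝ} (h₀ : 0 < δ) (h₁ : δ < 1) :
    (1 - δ) * (2 - δ) ≤ 2 ∧ 2 * δ ^ 2 + 8 * (1 - δ) * (2 - δ) ≤ 16 ∧
      δ * (1 + 8 * (1 - δ)) ≤ 9 * δ := by
  refine ⟨?_, ?_, ?_⟩ <;> nlinarith

namespace Valid

variable (h : S.Valid ν)
include h

set_option maxHeartbeats 1000000 in
/-- The real arithmetic behind the contraction of the Lyapunov function: `E`, `E'` stand for the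
squared norms of the mean error, `F`, `F'` for the sums of the squared norms of the errors, `B` for
the norm of the expected dual direction and `Z` for the mean squared residual. -/
lemma lyapunov_arith {gap prim E F B Z I W E' F' : ℝ} (hE : 0 ≤ E) (hF : 0 ≤ F)
    (hZ : 0 ≤ Z) (hgap : 0 ≤ gap)
    (hI : I ≤ -(S.theta * (prim + gap)) + S.theta * S.mu / 2 * E ^ 2
      + S.theta * S.mu * (E * B) - S.theta * S.γ * (1 - S.theta * m) / 2 * Z)
    (hW : W ≤ S.theta ^ 2 * B ^ 2 + (S.theta / S.mu) ^ 2 * S.Rm ^ 2 / n * Z)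
    (hBZ : B ^ 2 ≤ S.RSq / S.mu ^ 2 * Z)
    (hE' : E' ≤ (1 - S.δ) * ((1 - S.δ / 2) * E ^ 2
        + (1 - S.δ) * (2 - S.δ) / S.δ * (S.theta ^ 2 * B ^ 2))
      + S.δ * (1 - S.δ) / n ^ 2 * (2 * F + 2 * ((S.theta / S.mu) ^ 2 * S.RbarSq * (n * Z)))
      + (1 - S.δ) / n ^ 2 * ((S.theta / S.mu) ^ 2 * S.Rm ^ 2 * (n * Z)))
    (hF' : F' ≤ (1 - S.δ / 2) * F
      + (1 - S.δ) * (2 - S.δ) / S.δ * ((S.theta / S.mu) ^ 2 * S.RbarSq * (n * Z))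
      + (1 - S.δ) * ((S.theta / S.mu) ^ 2 * S.Rm ^ 2 * (n * Z))) :
    gap + I + S.mu / 2 * W + (2 * (S.rho + S.theta * S.mu) / S.δ * E'
        + 16 * (1 - S.δ) * (S.rho + S.theta * S.mu) / (S.δ * n ^ 2) * F')
      ≤ (1 - min S.theta (S.δ / 4)) * (gap + (2 * (S.rho + S.theta * S.mu) / S.δ * E ^ 2
        + 16 * (1 - S.δ) * (S.rho + S.theta * S.mu) / (S.δ * n ^ 2) * F)) - S.theta * prim := by
  have hn := h.n_pos
  have hmu := h.mu_pos
  have hδ := h.δ_pos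
  have hδ1 := sub_pos.2 h.δ_lt_one
  have hθ := h.theta_pos
  have hρ := h.rho_nonneg
  have hR := h.RSq_nonneg
  have hRb := h.RbarSq_nonneg
  have hst := h.stepsize_bound
  have hM : S.MSq = 2 * S.RSq + (16 * S.RbarSq + 9 * S.δ * S.Rm ^ 2) / n := rfl
  set δ := S.δ with hδdef
  set T := (S.theta / S.mu) ^ 2 with hT
  have hT0 : 0 ≤ T := by positivity
  set a := 2 * (S.rho + S.theta * S.mu) / δ with ha
  have ha0 : 0 ≤ a := by positivity
  have ha2 : 16 * (1 - δ) * (S.rho + S.theta * S.mu) / (δ * n ^ 2) = 8 * (1 - δ) / n ^ 2 * a := by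
    rw [ha]
    field_simp
    ring
  have haδ : a * δ = 2 * (S.rho + S.theta * S.mu) := by
    rw [ha]
    field_simp
  rw [ha2]
  have hTB : S.theta ^ 2 * B ^ 2 ≤ T * S.RSq * Z := by
    calc S.theta ^ 2 * B ^ 2 ≤ S.theta ^ 2 * (S.RSq / S.mu ^ 2 * Z) := by gcongr
      _ = T * S.RSq * Z := by rw [hT]; field_simp
  -- the coupling term
  have hcouple : S.theta * S.mu * (E * B) ≤ S.rho / 2 * E ^ 2
      + S.theta ^ 2 * (√S.RSq * √(1 - δ) * √S.MSq / (δ * S.mu)) * Z := by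
    have i1 : S.mu * B ≤ √S.RSq * √Z := by
      refine abs_le_of_sq_le_sq' ?_ (by positivity) |>.2
      rw [mul_pow, mul_pow, Real.sq_sqrt hR, Real.sq_sqrt hZ]
      calc S.mu ^ 2 * B ^ 2 ≤ S.mu ^ 2 * (S.RSq / S.mu ^ 2 * Z) := by gcongr
        _ = _ := by field_simp
    have i2 := h.young_rho (x := E) (z := √Z)
    rw [Real.sq_sqrt hZ] at i2
    refine le_trans ?_ i2
    calc S.theta * S.mu * (E * B) = S.theta * E * (S.mu * B) := by ring
      _ ≤ S.theta * E * (√S.RSq * √Z) := by gcongr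
      _ = _ := by ring
  -- the error terms
  have herr : a * E' + 8 * (1 - δ) / n ^ 2 * a * F'
      ≤ a * (1 - δ / 2) * E ^ 2 + 8 * (1 - δ) / n ^ 2 * a * (1 - δ / 4) * F
        + a * (1 - δ) * T * Z / δ * S.MSq := by
    have j1 := mul_le_mul_of_nonneg_left hE' ha0
    have j2 := mul_le_mul_of_nonneg_left hF' (by positivity : 0 ≤ 8 * (1 - δ) / n ^ 2 * a)
    have hδ2 : 0 < 2 - δ := by linarith
    have j3 : a * ((1 - δ) * ((1 - δ) * (2 - δ) / δ * (S.theta ^ 2 * B ^ 2)))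
        ≤ a * ((1 - δ) * ((1 - δ) * (2 - δ) / δ * (T * S.RSq * Z))) := by
      gcongr
    have j4 : 0 ≤ a * (δ / 2 + δ * (1 - δ / 2)) * E ^ 2 - a * (δ / 2) * E ^ 2 := by
      have : 0 ≤ a * (δ * (1 - δ / 2)) * E ^ 2 := by
        have : 0 < 1 - δ / 2 := by linarith
        positivity
      linarith
    have j5 : a * ((1 - δ) * ((1 - δ) * (2 - δ) / δ * (T * S.RSq * Z)))
        + a * (δ * (1 - δ) / n ^ 2 * (2 * (T * S.RbarSq * (n * Z))))
        + a * ((1 - δ) / n ^ 2 * (T * S.Rm ^ 2 * (n * Z)))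
        + 8 * (1 - δ) / n ^ 2 * a * ((1 - δ) * (2 - δ) / δ * (T * S.RbarSq * (n * Z)))
        + 8 * (1 - δ) / n ^ 2 * a * ((1 - δ) * (T * S.Rm ^ 2 * (n * Z)))
        = a * (1 - δ) * T * Z / δ * ((1 - δ) * (2 - δ) * S.RSq
          + ((2 * δ ^ 2 + 8 * (1 - δ) * (2 - δ)) * S.RbarSq
            + δ * (1 + 8 * (1 - δ)) * S.Rm ^ 2) / n) := by
      field_simp
      ring
    have j6 : a * (1 - δ) * T * Z / δ * ((1 - δ) * (2 - δ) * S.RSq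
          + ((2 * δ ^ 2 + 8 * (1 - δ) * (2 - δ)) * S.RbarSq
            + δ * (1 + 8 * (1 - δ)) * S.Rm ^ 2) / n) ≤ a * (1 - δ) * T * Z / δ * S.MSq := by
      rw [hM]
      obtain ⟨k1, k2, k3⟩ := shrink_coeffs hδ h.δ_lt_one
      gcongr
    -- The variance of the averaged error feeds F back in. The weight 8(1 - δ)/n² makes this cost
    -- δ/4, half of the contraction δ/2 of F.
    have j7 : a * (δ * (1 - δ) / n ^ 2 * (2 * F)) + 8 * (1 - δ) / n ^ 2 * a * ((1 - δ / 2) * F)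
        = 8 * (1 - δ) / n ^ 2 * a * (1 - δ / 4) * F := by
      ring
    linarith
  -- the coefficient of the residual
  have hZc := mul_le_mul_of_nonneg_right hst hZ
  have hrew : a * (1 - δ) * T * Z / δ * S.MSq
      = 2 * (S.rho + S.theta * S.mu) * (1 - δ) * S.theta ^ 2 * S.MSq / (S.mu ^ 2 * δ ^ 2) * Z := by
    rw [ha, hT]
    field_simp
  have hWrew : S.mu / 2 * W ≤ S.theta ^ 2 * (S.RSq + S.Rm ^ 2 / n) / (2 * S.mu) * Z := by
    have l1 : W ≤ T * S.RSq * Z + T * S.Rm ^ 2 / n * Z := by linarith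
    calc S.mu / 2 * W ≤ S.mu / 2 * (T * S.RSq * Z + T * S.Rm ^ 2 / n * Z) := by gcongr
      _ = _ := by
        rw [hT]
        field_simp
  -- The E² terms from the dual step (θμ/2) and from the coupling (ρ/2) together use half of the
  -- contraction δ/2 of E².
  have hE4 : (S.rho + S.theta * S.mu) / 2 * E ^ 2 = a * (δ / 4) * E ^ 2 := by
    have : a * (δ / 4) = (S.rho + S.theta * S.mu) / 2 := by linarith
    rw [this]
  -- the rate
  set r := min S.theta (δ / 4) with hr
  have r1 : r * gap ≤ S.theta * gap := by
    gcongr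
    exact min_le_left _ _
  have r2 : r * (a * E ^ 2) ≤ δ / 4 * (a * E ^ 2) := by
    gcongr
    exact min_le_right _ _
  have r3 : r * (8 * (1 - δ) / n ^ 2 * a * F) ≤ δ / 4 * (8 * (1 - δ) / n ^ 2 * a * F) := by
    gcongr
    exact min_le_right _ _
  linarith

end Valid

end Setup

/-! ### Conditional expectation of one iteration -/

namespace Setup

set_option linter.unusedSectionVars false

variable {d t m n : ℕ} {Ξ : Type*} [MeasurableSpace Ξ] {S : Setup d t m n Ξ} {ν : Measure Ξ}
  [IsProbabilityMeasure ν]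

/-- The law of the draws of one inner iteration. -/
def stepLaw (m n : ℕ) {Ξ : Type*} [MeasurableSpace Ξ] (ν : Measure Ξ) :
    Measure (Fin n → Fin m × Ξ) :=
  Measure.pi fun _ => drawLaw m ν

/-- The contraction factor `1 - min θ (δ/4)` is governed by this rate. -/
def contr (S : Setup d t m n Ξ) : ℝ := min S.theta (S.δ / 4)

/-- The compression error at a node. -/
def nodeError (S : Setup d t m n Ξ) (y : Vec d) (s : InnerState d t m n) (τ : Fin n)
    (w : Fin m × Ξ) : Vec d :=
  S.message y s τ w.1 - S.Q w.2 (S.message y s τ w.1)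

lemma integral_const_add_combo {X : Type*} [MeasurableSpace X] {π : Measure X}
    [IsProbabilityMeasure π] {f₁ f₂ f₃ f₄ : X → ℝ} (h₁ : Integrable f₁ π) (h₂ : Integrable f₂ π)
    (h₃ : Integrable f₃ π) (h₄ : Integrable f₄ π) (c c₂ c₃ c₄ : ℝ) :
    Integrable (fun w => (c + f₁ w + c₂ * f₂ w) + (c₃ * f₃ w + c₄ * f₄ w)) π ∧
    ∫ w, ((c + f₁ w + c₂ * f₂ w) + (c₃ * f₃ w + c₄ * f₄ w)) ∂π
      = (c + ∫ w, f₁ w ∂π + c₂ * ∫ w, f₂ w ∂π)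
        + (c₃ * ∫ w, f₃ w ∂π + c₄ * ∫ w, f₄ w ∂π) := by
  have i₁ : Integrable (fun w => c + f₁ w) π := (integrable_const c).add h₁
  have i₂ : Integrable (fun w => c + f₁ w + c₂ * f₂ w) π := i₁.add (h₂.const_mul c₂)
  have i₃ : Integrable (fun w => c₃ * f₃ w + c₄ * f₄ w) π := (h₃.const_mul c₃).add (h₄.const_mul c₄)
  refine ⟨i₂.add i₃, ?_⟩
  rw [integral_add i₂ i₃, integral_add i₁ (h₂.const_mul c₂), integral_add (integrable_const c) h₁,
    integral_add (h₃.const_mul c₃) (h₄.const_mul c₄), integral_const_mul, integral_const_mul,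
    integral_const_mul, integral_const, probReal_univ, one_smul]

namespace Valid

variable (h : S.Valid ν)
include h

lemma neZero_m : NeZero m := ⟨by have := h.one_le_m; omega⟩

/-- The increments: expected squared norm of the mean over the nodes. -/
lemma integral_incr [NeZero m] (y : Vec d) (s : InnerState d t m n) :
    Integrable (fun w : Fin n → Fin m × Ξ => ‖∑ τ, (1 / (n : ℝ)) • S.incr y s τ (w τ).1‖ ^ 2)
      (stepLaw m n ν) ∧
    ∫ w, ‖∑ τ, (1 / (n : ℝ)) • S.incr y s τ (w τ).1‖ ^ 2 ∂(stepLaw m n ν)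
      ≤ S.theta ^ 2 * ‖S.v (S.resid y s)‖ ^ 2
        + (S.theta / S.mu) ^ 2 * S.Rm ^ 2 / n * (1 / (n : ℝ) * ∑ τ, S.residSq y s τ) := by
  have hn := h.n_pos
  have hF : ∀ τ, MemLp (fun w : Fin m × Ξ => (1 / (n : ℝ)) • S.incr y s τ w.1) 2
      (drawLaw m ν) := fun τ => by
    have h1 := (integral_drawLaw_fst (ν := ν) fun i => (1 / (n : ℝ)) • S.incr y s τ i).1
    have h2 := (integral_drawLaw_fst (ν := ν) fun i => ‖(1 / (n : ℝ)) • S.incr y s τ i‖ ^ 2).1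
    exact (memLp_two_iff_integrable_sq_norm h1.aestronglyMeasurable).2 h2
  obtain ⟨i1, i2⟩ := integral_norm_sum_sq_pi hF
  refine ⟨i1, ?_⟩
  unfold stepLaw
  rw [i2]
  have e1 : ∀ τ, ∫ w : Fin m × Ξ, (1 / (n : ℝ)) • S.incr y s τ w.1 ∂(drawLaw m ν)
      = (1 / (n : ℝ)) • (1 / (m : ℝ)) • ∑ i, S.incr y s τ i := fun τ => by
    rw [(integral_drawLaw_fst (ν := ν) fun i => (1 / (n : ℝ)) • S.incr y s τ i).2,
      ← Finset.smul_sum, smul_comm]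
  have e2 : ∀ τ, ∫ w : Fin m × Ξ, ‖(1 / (n : ℝ)) • S.incr y s τ w.1‖ ^ 2 ∂(drawLaw m ν)
      = (1 / (n : ℝ)) ^ 2 * (1 / (m : ℝ) * ∑ i, ‖S.incr y s τ i‖ ^ 2) := fun τ => by
    rw [(integral_drawLaw_fst (ν := ν) fun i => ‖(1 / (n : ℝ)) • S.incr y s τ i‖ ^ 2).2]
    simp only [norm_smul, mul_pow, Real.norm_eq_abs, sq_abs, ← Finset.mul_sum, smul_eq_mul]
    ring
  simp only [e1, e2]
  rw [h.mean_incr, norm_smul, mul_pow, Real.norm_eq_abs, sq_abs]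
  refine add_le_add le_rfl ?_
  calc ∑ τ, ((1 / (n : ℝ)) ^ 2 * (1 / (m : ℝ) * ∑ i, ‖S.incr y s τ i‖ ^ 2)
        - ‖(1 / (n : ℝ)) • (1 / (m : ℝ)) • ∑ i, S.incr y s τ i‖ ^ 2)
      ≤ ∑ τ, (1 / (n : ℝ)) ^ 2 * ((S.theta / S.mu) ^ 2 * S.Rm ^ 2 * S.residSq y s τ) := by
        refine Finset.sum_le_sum fun τ _ => (sub_le_self _ (by positivity)).trans ?_
        exact mul_le_mul_of_nonneg_left (h.mean_norm_incr_sq_le y s τ) (by positivity)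
    _ = _ := by
      rw [← Finset.mul_sum, ← Finset.mul_sum]
      field_simp

/-- The compression errors of one iteration. -/
lemma integral_nodeError [NeZero m] (y : Vec d) (s : InnerState d t m n) :
    Integrable (fun w : Fin n → Fin m × Ξ =>
      ‖(1 / (n : ℝ)) • ∑ τ, S.nodeError y s τ (w τ)‖ ^ 2) (stepLaw m n ν) ∧
    Integrable (fun w : Fin n → Fin m × Ξ => ∑ τ, ‖S.nodeError y s τ (w τ)‖ ^ 2)
      (stepLaw m n ν) ∧
    ∫ w, ‖(1 / (n : ℝ)) • ∑ τ, S.nodeError y s τ (w τ)‖ ^ 2 ∂(stepLaw m n ν)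
      ≤ (1 - S.δ) * ((1 - S.δ / 2) * ‖(1 / (n : ℝ)) • ∑ τ, s.e τ‖ ^ 2
        + (1 - S.δ) * (2 - S.δ) / S.δ * (S.theta ^ 2 * ‖S.v (S.resid y s)‖ ^ 2))
      + S.δ * (1 - S.δ) / n ^ 2 * (2 * ∑ τ, ‖s.e τ‖ ^ 2 + 2 * ((S.theta / S.mu) ^ 2 * S.RbarSq
        * (n * (1 / (n : ℝ) * ∑ τ, S.residSq y s τ))))
      + (1 - S.δ) / n ^ 2 * ((S.theta / S.mu) ^ 2 * S.Rm ^ 2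
        * (n * (1 / (n : ℝ) * ∑ τ, S.residSq y s τ))) ∧
    ∫ w, ∑ τ, ‖S.nodeError y s τ (w τ)‖ ^ 2 ∂(stepLaw m n ν)
      ≤ (1 - S.δ / 2) * ∑ τ, ‖s.e τ‖ ^ 2
      + (1 - S.δ) * (2 - S.δ) / S.δ * ((S.theta / S.mu) ^ 2 * S.RbarSq
        * (n * (1 / (n : ℝ) * ∑ τ, S.residSq y s τ)))
      + (1 - S.δ) * ((S.theta / S.mu) ^ 2 * S.Rm ^ 2
        * (n * (1 / (n : ℝ) * ∑ τ, S.residSq y s τ))) := by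
  have hn := h.n_pos
  have hm := h.m_pos
  have hδ := h.δ_pos
  have hδ1 := sub_pos.2 h.δ_lt_one
  have hδ2 : 0 < 2 - S.δ := by linarith
  have hZ : (n : ℝ) * (1 / (n : ℝ) * ∑ τ, S.residSq y s τ) = ∑ τ, S.residSq y s τ := by
    field_simp
  rw [hZ]
  set p : Fin n → Vec d := fun τ => (1 / (m : ℝ)) • ∑ i, S.incr y s τ i with hp
  have hmom : ∀ τ, MemLp (S.nodeError y s τ) 2 (drawLaw m ν) ∧
      ∫ w, S.nodeError y s τ w ∂(drawLaw m ν) = (1 - S.δ) • (s.e τ + p τ) ∧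
      ∫ w, ‖S.nodeError y s τ w‖ ^ 2 ∂(drawLaw m ν)
        ≤ (1 - S.δ) * (‖s.e τ + p τ‖ ^ 2
          + (S.theta / S.mu) ^ 2 * S.Rm ^ 2 * S.residSq y s τ) := fun τ => by
    obtain ⟨a1, a2, a3⟩ := h.compressor.moments h.mean fun i => S.message y s τ i
    refine ⟨a1, a2.trans ?_, a3.trans ?_⟩
    · congr 1
      simp only [h.message_eq, Finset.sum_add_distrib, Finset.sum_const, Finset.card_univ,
        Fintype.card_fin, hp, smul_add, ← Nat.cast_smul_eq_nsmul ℝ, smul_smul]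
      rw [one_div_mul_cancel hm.ne', one_smul, add_comm]
    · refine mul_le_mul_of_nonneg_left ?_ hδ1.le
      simp only [h.message_eq]
      rw [mean_norm_add_sq hm]
      have b1 := h.mean_norm_incr_sq_le y s τ
      have b2 : 0 ≤ ‖(1 / (m : ℝ)) • ∑ i, S.incr y s τ i‖ ^ 2 := by positivity
      change ‖s.e τ + p τ‖ ^ 2 + _ - _ ≤ _
      linarith
  have hpb : ∀ τ, ‖p τ‖ ^ 2 ≤ (S.theta / S.mu) ^ 2 * S.RbarSq * S.residSq y s τ :=
    fun τ => h.norm_mean_incr_sq_le y s τ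
  obtain ⟨i1, i2⟩ := integral_norm_sum_sq_pi fun τ => (hmom τ).1
  obtain ⟨i3, i4⟩ := integral_sum_pi (ϖ := drawLaw m ν) (F := fun τ w => ‖S.nodeError y s τ w‖ ^ 2)
    fun τ => (hmom τ).1.integrable_norm_pow two_ne_zero
  have hsm : ∀ w : Fin n → Fin m × Ξ, ‖(1 / (n : ℝ)) • ∑ τ, S.nodeError y s τ (w τ)‖ ^ 2
      = (1 / (n : ℝ)) ^ 2 * ‖∑ τ, S.nodeError y s τ (w τ)‖ ^ 2 := fun w => by
    rw [norm_smul, mul_pow, Real.norm_eq_abs, sq_abs]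
  simp only [hsm]
  refine ⟨i1.const_mul _, i3, ?_, ?_⟩
  · unfold stepLaw
    rw [integral_const_mul, i2]
    simp only [(hmom _).2.1]
    have c1 : (1 / (n : ℝ)) ^ 2 * ‖∑ τ, (1 - S.δ) • (s.e τ + p τ)‖ ^ 2
        ≤ (1 - S.δ) * ((1 - S.δ / 2) * ‖(1 / (n : ℝ)) • ∑ τ, s.e τ‖ ^ 2
        + (1 - S.δ) * (2 - S.δ) / S.δ * (S.theta ^ 2 * ‖S.v (S.resid y s)‖ ^ 2)) := by
      have d1 := young_shrink hδ ((1 / (n : ℝ)) • ∑ τ, s.e τ) (S.theta • S.v (S.resid y s))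
      have d2 : (1 / (n : ℝ)) • ∑ τ, (1 - S.δ) • (s.e τ + p τ)
          = (1 - S.δ) • ((1 / (n : ℝ)) • ∑ τ, s.e τ + S.theta • S.v (S.resid y s)) := by
        rw [← h.mean_incr, ← Finset.smul_sum, ← Finset.smul_sum, smul_comm, ← smul_add,
          Finset.sum_add_distrib]
      have d3 : (1 / (n : ℝ)) ^ 2 * ‖∑ τ, (1 - S.δ) • (s.e τ + p τ)‖ ^ 2
          = ‖(1 / (n : ℝ)) • ∑ τ, (1 - S.δ) • (s.e τ + p τ)‖ ^ 2 := by
        rw [norm_smul, mul_pow, Real.norm_eq_abs, sq_abs]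
      rw [d3, d2, norm_smul, mul_pow, Real.norm_eq_abs, sq_abs, sq (1 - S.δ), mul_assoc]
      rw [norm_smul S.theta, mul_pow, Real.norm_eq_abs S.theta, sq_abs] at d1
      exact mul_le_mul_of_nonneg_left d1 hδ1.le
    -- In the second moment minus the squared mean, ‖e_τ + p_τ‖² has the coefficient (1 - δ) - (1 -
    -- δ)² = δ(1 - δ). This needs E Q(x) = δx and not only the contraction property.
    have c2 : ∑ τ, (∫ w, ‖S.nodeError y s τ w‖ ^ 2 ∂(drawLaw m ν)
          - ‖(1 - S.δ) • (s.e τ + p τ)‖ ^ 2)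
        ≤ S.δ * (1 - S.δ) * (2 * ∑ τ, ‖s.e τ‖ ^ 2
            + 2 * ((S.theta / S.mu) ^ 2 * S.RbarSq * ∑ τ, S.residSq y s τ))
          + (1 - S.δ) * ((S.theta / S.mu) ^ 2 * S.Rm ^ 2 * ∑ τ, S.residSq y s τ) := by
      simp only [Finset.mul_sum]
      rw [← Finset.sum_add_distrib, Finset.mul_sum, ← Finset.sum_add_distrib]
      refine Finset.sum_le_sum fun τ _ => ?_
      rw [norm_smul, mul_pow, Real.norm_eq_abs, sq_abs]
      have d1 := (hmom τ).2.2
      have d2 := norm_add_sq_le_two (s.e τ) (p τ)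
      have d3 := hpb τ
      have d4 := mul_le_mul_of_nonneg_left (d2.trans (add_le_add le_rfl
        (mul_le_mul_of_nonneg_left d3 two_pos.le))) (by positivity : 0 ≤ S.δ * (1 - S.δ))
      linarith
    have c3 := mul_le_mul_of_nonneg_left c2 (by positivity : 0 ≤ (1 / (n : ℝ)) ^ 2)
    rw [mul_add]
    refine (add_le_add c1 c3).trans (le_of_eq ?_)
    field_simp
    ring
  · unfold stepLaw
    rw [i4]
    simp only [Finset.mul_sum]
    rw [← Finset.sum_add_distrib, ← Finset.sum_add_distrib]
    refine Finset.sum_le_sum fun τ _ => ?_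
    have d1 := (hmom τ).2.2
    have d2 := young_shrink hδ (s.e τ) (p τ)
    have d3 := mul_le_mul_of_nonneg_left (hpb τ)
      (by positivity : 0 ≤ (1 - S.δ) * (2 - S.δ) / S.δ)
    linarith

/-- One iteration contracts the Lyapunov function in expectation. -/
lemma one_step (y : Vec d) {s : InnerState d t m n} (hs : S.Inv s) :
    ∃ H : (Fin n → Fin m × Ξ) → ℝ, Integrable H (stepLaw m n ν) ∧
      (∀ w, S.lyap y (S.innerStep y w s) ≤ H w) ∧
      ∫ w, H w ∂(stepLaw m n ν) ≤ (1 - S.contr) * S.lyap y s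
        - S.theta * (S.G y (S.primal y s) - S.Gmin y) := by
  have := h.neZero_m
  obtain ⟨a1, a2⟩ := h.integral_incr y s
  obtain ⟨b1, b2, b3, b4⟩ := h.integral_nodeError y s
  obtain ⟨c1, c2⟩ := integral_sum_pi (n := n) (ϖ := drawLaw m ν)
    (F := fun τ w => S.dualTerm y s τ w.1) fun τ =>
      (integral_drawLaw_fst (ν := ν) fun i => S.dualTerm y s τ i).1
  have c3 : ∀ τ, ∫ w : Fin m × Ξ, S.dualTerm y s τ w.1 ∂(drawLaw m ν)
      = 1 / (m : ℝ) * ∑ i, S.dualTerm y s τ i := fun τ =>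
    (integral_drawLaw_fst (ν := ν) fun i => S.dualTerm y s τ i).2
  simp only [c3] at c2
  set c₁ := 2 * (S.rho + S.theta * S.mu) / S.δ with hc₁
  set c₂ := 16 * (1 - S.δ) * (S.rho + S.theta * S.mu) / (S.δ * n ^ 2) with hc₂
  have : IsProbabilityMeasure (stepLaw m n ν) := by unfold stepLaw; infer_instance
  have hcombo := integral_const_add_combo (π := stepLaw m n ν) c1 a1 b1 b2
    (S.Gmin y - S.dualR y s.α) (S.mu / 2) c₁ c₂
  -- H is a majorant whose integral is computed term by term, so integrability of the new Lyapunov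
  -- value itself is not needed.
  refine ⟨fun w => ((S.Gmin y - S.dualR y s.α) + ∑ τ, S.dualTerm y s τ (w τ).1
      + S.mu / 2 * ‖∑ τ, (1 / (n : ℝ)) • S.incr y s τ (w τ).1‖ ^ 2)
      + (c₁ * ‖(1 / (n : ℝ)) • ∑ τ, S.nodeError y s τ (w τ)‖ ^ 2
        + c₂ * ∑ τ, ‖S.nodeError y s τ (w τ)‖ ^ 2), ?_, fun w => ?_, ?_⟩
  · exact hcombo.1
  · have e1 := h.dualR_innerStep y hs w
    have e2 : S.errR (S.innerStep y w s)
        = c₁ * ‖(1 / (n : ℝ)) • ∑ τ, S.nodeError y s τ (w τ)‖ ^ 2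
          + c₂ * ∑ τ, ‖S.nodeError y s τ (w τ)‖ ^ 2 := rfl
    unfold lyap
    rw [e2]
    linarith
  · rw [hcombo.2]
    have hI : ∫ w : Fin n → Fin m × Ξ, ∑ τ, S.dualTerm y s τ (w τ).1 ∂(stepLaw m n ν)
        ≤ _ := c2.le.trans (h.mean_dualTerm_le y hs)
    have hgap : 0 ≤ S.Gmin y - S.dualR y s.α := sub_nonneg.2 (h.dualR_le_Gmin y hs.finite)
    have hn := h.n_pos
    refine (h.lyapunov_arith (norm_nonneg _) (Finset.sum_nonneg fun τ _ => by positivity)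
      (mul_nonneg (by positivity) (Finset.sum_nonneg fun τ _ => h.residSq_nonneg y s τ))
      hgap (prim := S.G y (S.primal y s) - S.Gmin y) ?_ a2 (h.norm_v_resid_sq_le y s) b3 b4)
    have e : S.G y (S.primal y s) - S.Gmin y + (S.Gmin y - S.dualR y s.α)
        = S.G y (S.primal y s) - S.dualR y s.α := by ring
    rw [e]
    exact hI

lemma contr_pos : 0 < S.contr := lt_min h.theta_pos (by have := h.δ_pos; positivity)

lemma contr_le_one : S.contr ≤ 1 := (min_le_left _ _).trans h.theta_le_one

/-- The primal gap is controlled by the Lyapunov function. -/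
lemma primal_gap_le (y : Vec d) {s : InnerState d t m n} (hs : S.Inv s) :
    S.theta * (S.G y (S.primal y s) - S.Gmin y) ≤ S.lyap y s := by
  obtain ⟨H, -, h2, h3⟩ := h.one_step y hs
  -- The expected next value is nonnegative, so the guaranteed decrease θ(G(x) - G^*) cannot exceed
  -- the current value.
  have h4 : 0 ≤ ∫ w, H w ∂(stepLaw m n ν) :=
    integral_nonneg fun w => (h.lyap_nonneg y (h.inv_step y hs w)).trans (h2 w)
  have h5 := mul_nonneg h.contr_pos.le (h.lyap_nonneg y hs)
  linarith

/-- Lower integrals require no integrability, which makes the bound easy to iterate. The extra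
decrease -θ(G(x) - G^*) is discarded here. -/
lemma lintegral_step_le (y : Vec d) {s : InnerState d t m n} (hs : S.Inv s) :
    ∫⁻ w, ENNReal.ofReal (S.lyap y (S.innerStep y w s)) ∂(stepLaw m n ν)
      ≤ ENNReal.ofReal (1 - S.contr) * ENNReal.ofReal (S.lyap y s) := by
  obtain ⟨H, h1, h2, h3⟩ := h.one_step y hs
  have h4 : ∀ w, 0 ≤ H w := fun w => (h.lyap_nonneg y (h.inv_step y hs w)).trans (h2 w)
  rw [← ENNReal.ofReal_mul (sub_nonneg.2 h.contr_le_one)]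
  calc ∫⁻ w, ENNReal.ofReal (S.lyap y (S.innerStep y w s)) ∂(stepLaw m n ν)
      ≤ ∫⁻ w, ENNReal.ofReal (H w) ∂(stepLaw m n ν) :=
        lintegral_mono fun w => ENNReal.ofReal_le_ofReal (h2 w)
    _ = ENNReal.ofReal (∫ w, H w ∂(stepLaw m n ν)) :=
        (ofReal_integral_eq_lintegral_ofReal h1 (Filter.Eventually.of_forall h4)).symm
    _ ≤ _ := by
        refine ENNReal.ofReal_le_ofReal (h3.trans (sub_le_self _ ?_))
        exact mul_nonneg h.theta_pos.le (sub_nonneg.2 (h.Gmin_le y _))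

end Valid

end Setup

namespace Setup

set_option linter.unusedSectionVars false

variable {d t m n : ℕ} {Ξ : Type*} [MeasurableSpace Ξ] {S : Setup d t m n Ξ} {ν : Measure Ξ}

/-! ### The outer loop -/

namespace Valid

variable (h : S.Valid ν)
include h

lemma q_pos : 0 < S.q := div_pos h.lam_pos h.mu_pos

lemma q_le_one : S.q ≤ 1 := by
  refine div_le_one_of_le₀ ?_ h.mu_pos.le
  linarith [h.κ_nonneg]

lemma sqrt_q_pos : 0 < √S.q := Real.sqrt_pos.2 h.q_pos

lemma sqrt_q_le_one : √S.q ≤ 1 := Real.sqrt_le_one.2 h.q_le_one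

lemma mu_mul_q : S.mu * √S.q ^ 2 = S.lam := by
  rw [Real.sq_sqrt h.q_pos.le]
  exact mul_div_cancel₀ _ h.mu_pos.ne'

lemma lam_le_mu : S.lam ≤ S.mu := by
  unfold mu
  linarith [h.κ_nonneg]

lemma gap_pos' : 0 < √S.q - S.ρ₀ := sub_pos.2 h.ρ₀_lt

lemma gap_le : √S.q - S.ρ₀ ≤ 1 - S.ρ₀ := by linarith [h.sqrt_q_le_one]

lemma one_sub_ρ₀_pos : 0 < 1 - S.ρ₀ := h.gap_pos'.trans_le h.gap_le

lemma one_sub_ρ₀_le : 1 - S.ρ₀ ≤ 1 := by linarith [h.ρ₀_nonneg]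

lemma eps_pos (k : ℕ) : 0 < S.eps k := by
  have := h.one_sub_ρ₀_pos
  have := sub_pos.2 h.gap_pos
  unfold eps
  positivity

/-- √q is a fixed point of the recursion, since the linear term vanishes at a² = q. The
extrapolation is therefore constant. -/
lemma catA_eq (k : ℕ) : S.catA k = √S.q := by
  have hq := h.q_pos
  induction k with
  | zero => rfl
  | succ k ih =>
    unfold catA
    rw [ih, Real.sq_sqrt hq.le, sub_self, zero_pow two_ne_zero, zero_add, zero_add]
    rw [show 4 * S.q = 2 ^ 2 * S.q by norm_num, Real.sqrt_mul (by positivity),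
      Real.sqrt_sq two_pos.le, mul_div_cancel_left₀ _ two_ne_zero]

lemma catB_eq (k : ℕ) : S.catB k = (1 - √S.q) / (1 + √S.q) := by
  have ha := h.sqrt_q_pos
  unfold catB
  rw [h.catA_eq, h.catA_eq]
  field_simp
  ring

lemma catB_mem (k : ℕ) : 0 ≤ S.catB k ∧ S.catB k ≤ 1 := by
  have ha := h.sqrt_q_pos
  have ha1 := h.sqrt_q_le_one
  rw [h.catB_eq]
  refine ⟨div_nonneg (by linarith) (by linarith), ?_⟩
  rw [div_le_one (by linarith)]
  linarith

/-- One step of the accelerated inexact proximal point method, with the estimate point `v`. -/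
lemma catalyst_step {x v y x' z : Vec d} {ε c : ℝ} (hc : 0 < c)
    (hy : y = (1 / (1 + √S.q)) • (√S.q • v + x)) (hx' : S.G y x' - S.Gmin y ≤ ε)
    (hz : ∀ w, S.P z ≤ S.P w) :
    (1 - c) * (S.P x' - S.P z + S.lam / 2 * ‖z - (x + (1 / √S.q) • (x' - x))‖ ^ 2)
      ≤ (1 - √S.q) * (S.P x - S.P z + S.lam / 2 * ‖z - v‖ ^ 2) + (1 + 1 / c) * ε := by
  have ha := h.sqrt_q_pos
  have ha1 := h.sqrt_q_le_one
  have hmu := h.mu_pos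
  have hlam := h.lam_pos
  have hκ : S.κ = S.mu - S.lam := by unfold mu; ring
  have hmq := h.mu_mul_q
  set a := √S.q with hadef
  obtain ⟨xs, hs1, hs2⟩ := h.exists_min_G y
  have hquad := fun p => StrongConvexOn.add_sq_le (h.strongConvexOn_G y) hs2 p
  rw [hs1] at hquad
  -- Quadratic growth at the exact minimizer `xs` is recentred at the inexact x'. The price is ε and
  -- an inner product with r, where ‖r‖² ≤ 2ε/(λ+κ).
  set r := x' - xs with hr
  have hrε : S.mu / 2 * ‖r‖ ^ 2 ≤ ε := by linarith [hquad x']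
  have hp : ∀ p, S.P x' + S.κ / 2 * ‖x' - y‖ ^ 2 - ε + S.mu / 2 * ‖p - x'‖ ^ 2
      + S.mu * inner ℝ (p - x') r ≤ S.P p + S.κ / 2 * ‖p - y‖ ^ 2 := fun p => by
    have h1 := hquad p
    have h2 : ‖p - xs‖ ^ 2 = ‖p - x'‖ ^ 2 + 2 * inner ℝ (p - x') r + ‖r‖ ^ 2 := by
      rw [← norm_add_sq_real, hr]
      congr 2
      abel
    have h3 : 0 ≤ S.mu / 2 * ‖r‖ ^ 2 := by positivity
    rw [h2] at h1
    have h4 : S.G y p = S.P p + S.κ / 2 * ‖p - y‖ ^ 2 := rfl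
    have h5 : S.G y x' = S.P x' + S.κ / 2 * ‖x' - y‖ ^ 2 := rfl
    linarith
  set v' := x + (1 / a) • (x' - x) with hv'
  set b := z - v' with hb
  -- two convex combination identities
  have hcomb : ∀ w : Vec d, a * ‖z - w‖ ^ 2 + (1 - a) * ‖x - w‖ ^ 2
      = ‖a • (z - w) + (1 - a) • (x - w)‖ ^ 2 + a * (1 - a) * ‖z - x‖ ^ 2 := fun w => by
    have e : z - x = (z - w) - (x - w) := by abel
    rw [e, norm_add_sq_real, norm_sub_sq_real (z - w), norm_smul, norm_smul, real_inner_smul_left,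
      real_inner_smul_right, mul_pow, mul_pow, Real.norm_eq_abs, Real.norm_eq_abs, sq_abs, sq_abs]
    ring
  have hx'b : a • (z - x') + (1 - a) • (x - x') = a • b := by
    rw [hb, hv']
    match_scalars <;> field_simp <;> ring
  have hyb : a • (z - y) + (1 - a) • (x - y)
      = a • ((a / (1 + a)) • (z - x) + (1 / (1 + a)) • (z - v)) := by
    rw [hy]
    match_scalars <;> field_simp <;> ring
  have hyn : ‖a • (z - y) + (1 - a) • (x - y)‖ ^ 2
      ≤ a ^ 2 * (a / (1 + a) * ‖z - x‖ ^ 2 + 1 / (1 + a) * ‖z - v‖ ^ 2) := by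
    rw [hyb, norm_smul, mul_pow, Real.norm_eq_abs, sq_abs]
    refine mul_le_mul_of_nonneg_left ?_ (by positivity)
    have e : a / (1 + a) * ‖z - x‖ ^ 2 + 1 / (1 + a) * ‖z - v‖ ^ 2
        - ‖(a / (1 + a)) • (z - x) + (1 / (1 + a)) • (z - v)‖ ^ 2
        = a / (1 + a) ^ 2 * ‖(z - x) - (z - v)‖ ^ 2 := by
      rw [norm_add_sq_real, norm_sub_sq_real (z - x), norm_smul, norm_smul, real_inner_smul_left,
        real_inner_smul_right, mul_pow, mul_pow, Real.norm_eq_abs, Real.norm_eq_abs, sq_abs,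
        sq_abs]
      field_simp
      ring
    have : 0 ≤ a / (1 + a) ^ 2 * ‖(z - x) - (z - v)‖ ^ 2 := by positivity
    linarith
  have hκy : S.κ / 2 * ‖a • (z - y) + (1 - a) • (x - y)‖ ^ 2
      ≤ S.lam / 2 * (1 - a) * (a * ‖z - x‖ ^ 2 + ‖z - v‖ ^ 2) := by
    have hκ0 := h.κ_nonneg
    calc S.κ / 2 * ‖a • (z - y) + (1 - a) • (x - y)‖ ^ 2
        ≤ S.κ / 2 * (a ^ 2 * (a / (1 + a) * ‖z - x‖ ^ 2 + 1 / (1 + a) * ‖z - v‖ ^ 2)) := by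
          gcongr
      _ = S.lam / 2 * (1 - a) * (a * ‖z - x‖ ^ 2 + ‖z - v‖ ^ 2) := by
          rw [hκ, ← hmq]
          field_simp
          ring
  have hz1 := hp z
  have hx1 := hp x
  -- Weights √q on the comparison with z and 1 - √q on the comparison with x, as in estimate
  -- sequences.
  have hsum := add_le_add (mul_le_mul_of_nonneg_left hz1 ha.le)
    (mul_le_mul_of_nonneg_left hx1 (sub_nonneg.2 ha1))
  have hcx := hcomb x'
  have hcy := hcomb y
  rw [hx'b, norm_smul, mul_pow, Real.norm_eq_abs, sq_abs] at hcx
  have hin : a * inner ℝ (z - x') r + (1 - a) * inner ℝ (x - x') r = a * inner ℝ b r := by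
    rw [← real_inner_smul_left, ← real_inner_smul_left, ← inner_add_left, hx'b,
      real_inner_smul_left]
  -- The cross term is absorbed by a fraction c of the new potential, whence the factor 1 - c in the
  -- statement.
  have hyoung : -(S.mu * (a * inner ℝ b r)) ≤ c * (S.lam / 2 * ‖b‖ ^ 2) + 1 / c * ε := by
    have h1 : 0 ≤ S.mu / (2 * c) * ‖(c * a) • b + r‖ ^ 2 := by positivity
    have h2 : S.mu / (2 * c) * ‖(c * a) • b + r‖ ^ 2 = c * (S.lam / 2 * ‖b‖ ^ 2)
        + S.mu * (a * inner ℝ b r) + 1 / c * (S.mu / 2 * ‖r‖ ^ 2) := by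
      rw [norm_add_sq_real, norm_smul, real_inner_smul_left, mul_pow, Real.norm_eq_abs, sq_abs,
        ← hmq]
      field_simp
    have h3 : 1 / c * (S.mu / 2 * ‖r‖ ^ 2) ≤ 1 / c * ε := by gcongr
    linarith
  have hκx : 0 ≤ S.κ / 2 * ‖x' - y‖ ^ 2 := by have := h.κ_nonneg; positivity
  have hcP : 0 ≤ c * (S.P x' - S.P z) := mul_nonneg hc.le (sub_nonneg.2 (hz x'))
  have hcx' : S.mu / 2 * (a * ‖z - x'‖ ^ 2 + (1 - a) * ‖x - x'‖ ^ 2)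
      = S.lam / 2 * ‖b‖ ^ 2 + S.mu / 2 * (a * (1 - a) * ‖z - x‖ ^ 2) := by
    rw [hcx, ← hmq]
    ring
  have hcy' : S.κ / 2 * (a * ‖z - y‖ ^ 2 + (1 - a) * ‖x - y‖ ^ 2)
      = S.κ / 2 * ‖a • (z - y) + (1 - a) • (x - y)‖ ^ 2
        + (S.mu - S.lam) / 2 * (a * (1 - a) * ‖z - x‖ ^ 2) := by
    rw [hcy, hκ]
    ring
  have hin' : S.mu * (a * inner ℝ (z - x') r + (1 - a) * inner ℝ (x - x') r)
      = S.mu * (a * inner ℝ b r) := by rw [hin]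
  linarith

/-- The convergence of the outer iterates, for any sequence of sufficiently accurate solutions of
the subproblems. -/
lemma catalyst_bound {x y : ℕ → Vec d} {z : Vec d} (hx0 : x 0 = S.x₀) (hy0 : y 0 = S.x₀)
    (hy : ∀ k, y (k + 1) = x (k + 1) + S.catB k • (x (k + 1) - x k)) (hz : ∀ w, S.P z ≤ S.P w)
    {K : ℕ} (hx : ∀ k < K, S.G (y k) (x (k + 1)) - S.Gmin (y k) ≤ S.eps (k + 1)) :
    ∀ k ≤ K, S.lam / 2 * ‖x k - z‖ ^ 2
      ≤ 16 / (√S.q - S.ρ₀) ^ 2 * ((S.P S.x₀ - S.P z) * (1 - S.ρ₀) ^ k) := by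
  have ha := h.sqrt_q_pos
  have ha1 := h.sqrt_q_le_one
  have hgap := h.gap_pos'
  have hρ := h.one_sub_ρ₀_pos
  have hρ1 := h.one_sub_ρ₀_le
  have hlam := h.lam_pos
  have hPz : S.P z = S.Pmin := by
    obtain ⟨w, hw1, hw2⟩ := h.exists_min_P
    exact le_antisymm (hw1 ▸ hz w) (hw1 ▸ hw2 z)
  set D := S.P S.x₀ - S.P z with hD
  have hD0 : 0 < D := by rw [hD, hPz]; exact sub_pos.2 h.gap_pos
  -- With √q = ρ₀ + 4c one has 1 - √q + 3c ≤ (1 - c)(1 - ρ₀): three shares of c absorb the errors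
  -- ε_k and one share the factor 1 - c.
  set c := (√S.q - S.ρ₀) / 4 with hc
  have hc0 : 0 < c := by positivity
  have hc4 : c ≤ 1 / 4 := by
    rw [hc]
    linarith [h.ρ₀_nonneg]
  have hcc : 16 / (√S.q - S.ρ₀) ^ 2 = 1 / c ^ 2 := by
    rw [hc]
    field_simp
    norm_num
  rw [hcc]
  -- The estimate points. With the constant extrapolation coefficient, y_k is the convex combination
  -- of v_k and x_k required by `catalyst_step`.
  let v : ℕ → Vec d := fun k => Nat.casesOn k S.x₀ fun j => x j + (1 / √S.q) • (x (j + 1) - x j)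
  have hyv : ∀ k, y k = (1 / (1 + √S.q)) • (√S.q • v k + x k) := by
    intro k
    cases k with
    | zero =>
      change y 0 = (1 / (1 + √S.q)) • (√S.q • S.x₀ + x 0)
      rw [hy0, hx0]
      match_scalars
      field_simp
      ring
    | succ k =>
      change y (k + 1) = (1 / (1 + √S.q)) • (√S.q • (x k + (1 / √S.q) • (x (k + 1) - x k))
        + x (k + 1))
      rw [hy, h.catB_eq]
      match_scalars <;> field_simp <;> ring
  have main : ∀ k ≤ K, S.P (x k) - S.P z + S.lam / 2 * ‖z - v k‖ ^ 2
      ≤ 1 / c ^ 2 * (D * (1 - S.ρ₀) ^ k) := by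
    intro k
    induction k with
    | zero =>
      intro _
      change S.P (x 0) - S.P z + S.lam / 2 * ‖z - S.x₀‖ ^ 2 ≤ _
      rw [hx0, pow_zero, mul_one, norm_sub_rev]
      have h1 := StrongConvexOn.add_sq_le h.strongConvexOn_P hz S.x₀
      have h2 : 2 ≤ 1 / c ^ 2 := by
        rw [le_div_iff₀ (by positivity)]
        nlinarith
      have h3 := mul_le_mul_of_nonneg_right h2 hD0.le
      linarith
    | succ k ih =>
      intro hk
      have h1 := ih (by omega)
      have h2 := h.catalyst_step hc0 (hyv k) (hx k (by omega)) hz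
      have h3 : S.eps (k + 1) = 2 / 9 * D * (1 - S.ρ₀) ^ k * (1 - S.ρ₀) := by
        rw [eps, hD, hPz, pow_succ]
        ring
      change S.P (x (k + 1)) - S.P z
        + S.lam / 2 * ‖z - (x k + (1 / √S.q) • (x (k + 1) - x k))‖ ^ 2 ≤ _
      have h1c : 0 < 1 - c := by linarith
      refine le_of_mul_le_mul_left (h2.trans ?_) h1c
      have h4 := mul_le_mul_of_nonneg_left h1 (sub_nonneg.2 ha1)
      set E := D * (1 - S.ρ₀) ^ k with hE
      have hE0 : 0 < E := by positivity
      have h5 : (1 + 1 / c) * S.eps (k + 1) ≤ 3 * c * (1 / c ^ 2) * E := by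
        have e1 : 3 * c * (1 / c ^ 2) = 3 / c := by field_simp
        have e2 : S.eps (k + 1) ≤ 2 / 9 * E := by
          rw [h3]
          nlinarith
        have e3 : 1 + 1 / c ≤ 2 / c := by
          rw [le_div_iff₀ hc0, add_mul, one_div_mul_cancel hc0.ne']
          linarith
        rw [e1]
        calc (1 + 1 / c) * S.eps (k + 1) ≤ 2 / c * (2 / 9 * E) := by
              have := (h.eps_pos (k + 1)).le
              gcongr
          _ ≤ 3 / c * E := by
              have : 2 / c * (2 / 9 * E) = 4 / 9 / c * E := by ring
              rw [this]
              gcongr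
              norm_num
      have h6 : 1 - √S.q + 3 * c ≤ (1 - c) * (1 - S.ρ₀) := by
        have : √S.q = 4 * c + S.ρ₀ := by rw [hc]; ring
        nlinarith [h.ρ₀_nonneg]
      have h7 : (1 - √S.q + 3 * c) * (1 / c ^ 2 * E) ≤ (1 - c) * (1 - S.ρ₀) * (1 / c ^ 2 * E) := by
        gcongr
      have e8 : (1 - c) * (1 / c ^ 2 * (D * (1 - S.ρ₀) ^ (k + 1)))
          = (1 - c) * (1 - S.ρ₀) * (1 / c ^ 2 * E) := by
        rw [hE, pow_succ]
        ring
      rw [e8]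
      linarith
  intro k hk
  have h1 := main k hk
  have h2 := StrongConvexOn.add_sq_le h.strongConvexOn_P hz (x k)
  have h3 : 0 ≤ S.lam / 2 * ‖z - v k‖ ^ 2 := by positivity
  linarith

/-- The prox-centers move little. -/
lemma prox_center_bound {x y : ℕ → Vec d} (hx0 : x 0 = S.x₀) (hy0 : y 0 = S.x₀)
    (hy : ∀ k, y (k + 1) = x (k + 1) + S.catB k • (x (k + 1) - x k))
    {K : ℕ} (hx : ∀ k < K + 1, S.G (y k) (x (k + 1)) - S.Gmin (y k) ≤ S.eps (k + 1)) :
    S.lam * ‖y (K + 1) - y K‖ ^ 2 ≤ 5184 / (√S.q - S.ρ₀) ^ 5 * S.eps (K + 2) := by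
  have hgap := h.gap_pos'
  have hρ := h.one_sub_ρ₀_pos
  have hρ1 := h.one_sub_ρ₀_le
  have hlam := h.lam_pos
  obtain ⟨z, hz1, hz⟩ := h.exists_min_P
  have hb := h.catalyst_bound hx0 hy0 hy hz hx
  have hD0 : 0 < S.P S.x₀ - S.Pmin := sub_pos.2 h.gap_pos
  -- Since √q - ρ₀ ≤ 1 - ρ₀, dividing by its cube trades (1 - ρ₀)^k for (1 - ρ₀)^(K + 2): k + 3 ≥ K
  -- + 2 for the iterates involved, of index K - 1, K and K + 1.
  set Bd := 16 / (√S.q - S.ρ₀) ^ 2 * ((S.P S.x₀ - S.P z) * (1 - S.ρ₀) ^ (K + 2))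
    / (√S.q - S.ρ₀) ^ 3 with hBd
  have hBd0 : 0 ≤ Bd := by
    rw [hBd, hz1]
    positivity
  have hxk : ∀ k ≤ K + 1, K ≤ k + 1 → S.lam / 2 * ‖x k - z‖ ^ 2 ≤ Bd := fun k hk1 hk2 => by
    refine (hb k hk1).trans ?_
    rw [hBd, le_div_iff₀ (by positivity), hz1, mul_assoc, mul_assoc]
    refine mul_le_mul_of_nonneg_left (mul_le_mul_of_nonneg_left ?_ hD0.le) (by positivity)
    calc (1 - S.ρ₀) ^ k * (√S.q - S.ρ₀) ^ 3 ≤ (1 - S.ρ₀) ^ k * (1 - S.ρ₀) ^ 3 := by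
          gcongr
          exact h.sqrt_q_le_one
      _ = (1 - S.ρ₀) ^ (k + 3) := by rw [pow_add]
      _ ≤ (1 - S.ρ₀) ^ (K + 2) := pow_le_pow_of_le_one hρ.le hρ1 (by omega)
  set M := √(2 * Bd / S.lam) with hM
  have hM0 : 0 ≤ M := Real.sqrt_nonneg _
  have hM2 : M ^ 2 = 2 * Bd / S.lam := Real.sq_sqrt (by positivity)
  have hxM : ∀ k ≤ K + 1, K ≤ k + 1 → ‖x k - z‖ ≤ M := fun k hk1 hk2 => by
    refine Real.le_sqrt_of_sq_le ?_
    rw [le_div_iff₀ hlam]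
    linarith [hxk k hk1 hk2]
  have hyM : ∀ k ≤ K, K ≤ k + 1 → ‖y (k + 1) - z‖ ≤ 3 * M := fun k hk1 hk2 => by
    obtain ⟨b0, b1⟩ := h.catB_mem k
    have e : y (k + 1) - z = (x (k + 1) - z) + S.catB k • ((x (k + 1) - z) - (x k - z)) := by
      rw [hy]
      module
    rw [e]
    calc ‖(x (k + 1) - z) + S.catB k • ((x (k + 1) - z) - (x k - z))‖
        ≤ ‖x (k + 1) - z‖ + S.catB k * (‖x (k + 1) - z‖ + ‖x k - z‖) := by
          refine (norm_add_le _ _).trans ?_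
          rw [norm_smul, Real.norm_of_nonneg b0]
          gcongr
          exact norm_sub_le _ _
      _ ≤ M + 1 * (M + M) := by
          gcongr
          · exact hxM _ (by omega) (by omega)
          · exact hxM _ (by omega) (by omega)
          · exact hxM _ (by omega) (by omega)
      _ = 3 * M := by ring
  have hyK : ‖y K - z‖ ≤ 3 * M := by
    cases K with
    | zero =>
      rw [hy0, ← hx0]
      linarith [hxM 0 (by omega) (by omega)]
    | succ K => exact hyM K (by omega) (by omega)
  have hdiff : ‖y (K + 1) - y K‖ ≤ 6 * M := by
    have e : y (K + 1) - y K = (y (K + 1) - z) - (y K - z) := by abel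
    rw [e]
    refine (norm_sub_le _ _).trans ?_
    linarith [hyM K le_rfl (by omega)]
  calc S.lam * ‖y (K + 1) - y K‖ ^ 2 ≤ S.lam * (6 * M) ^ 2 := by gcongr
    _ = 72 * Bd := by
      rw [mul_pow, hM2]
      field_simp
      ring
    -- 72 · 16 · 9/2 = 5184, where 9/2 inverts the factor 2/9 in ε_k.
    _ = _ := by
      rw [hBd, hz1, eps]
      field_simp
      norm_num

/-- Warm start: the dual gap after a change of the prox-center. -/
lemma warm_start (y y' : Vec d) {α : Fin n → Fin m → Vec t} (hα : S.DualFinite α) :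
    S.Gmin y' - S.dualR y' α
      ≤ 2 * (S.Gmin y - S.dualR y α) + S.κ ^ 2 / S.mu * ‖y' - y‖ ^ 2 := by
  have hmu := h.mu_pos
  have hκ := h.κ_nonneg
  obtain ⟨x, hx1, hx2⟩ := h.exists_min_G y
  set p := y' - y with hp
  set w := S.v α with hw
  set X := gradConj (S.xi y) w with hX
  have hwd := h.weak_duality y x hα
  -- A new prox-center changes the objective by a linear term and a constant; the constant cancels
  -- in the gap.
  have hyp : ∀ z : Vec d, ‖z - y'‖ ^ 2
      = ‖z - y‖ ^ 2 - 2 * inner ℝ z p + (‖y'‖ ^ 2 - ‖y‖ ^ 2) := fun z => by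
    rw [norm_sub_sq_real, norm_sub_sq_real, hp, inner_sub_right]
    ring
  set c := S.κ / 2 * (‖y'‖ ^ 2 - ‖y‖ ^ 2) with hc
  have hG : S.Gmin y' ≤ S.Gmin y - S.κ * inner ℝ x p + c := by
    refine (h.Gmin_le y' x).trans (le_of_eq ?_)
    rw [← hx1, G, G, hyp, hc]
    ring
  have hxi : ∀ z, S.xi y' z = S.xi y z - S.κ / S.mu * inner ℝ z p + c / S.mu := fun z => by
    rw [xi, xi, hyp, hc]
    field_simp
    ring
  have hconj : conjR (S.xi y') w ≤ conjR (S.xi y) (w + (S.κ / S.mu) • p) - c / S.mu := by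
    refine conjR_le fun z => ?_
    have h1 := le_conjR (h.conj_xi_ne_top y (w + (S.κ / S.mu) • p)) z
    rw [inner_add_right, real_inner_smul_right] at h1
    rw [hxi]
    linarith
  have hup := conjR_add_le one_pos (h.strongConvexOn_xi y) w ((S.κ / S.mu) • p)
  rw [real_inner_smul_right, norm_smul, mul_pow, Real.norm_eq_abs, sq_abs] at hup
  have hcs := mul_le_mul_of_nonneg_left (hconj.trans (sub_le_sub_right hup _)) hmu.le
  have hd : S.dualR y' α = S.dualR y α + S.mu * conjR (S.xi y) w - S.mu * conjR (S.xi y') w := by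
    unfold dualR
    ring
  have e1 : S.mu * (conjR (S.xi y) w + S.κ / S.mu * inner ℝ X p
      + 1 / (2 * 1) * ((S.κ / S.mu) ^ 2 * ‖p‖ ^ 2) - c / S.mu)
      = S.mu * conjR (S.xi y) w + S.κ * inner ℝ X p + S.κ ^ 2 / S.mu / 2 * ‖p‖ ^ 2 - c := by
    field_simp
  -- The linear terms differ through the distance between the primal solution x and the primal image
  -- X of α. Weak duality charges (λ+κ)/2 ‖x - X‖² to a second copy of the gap, hence the factor 2.
  have hyoung : S.κ * (inner ℝ X p - inner ℝ x p)
      ≤ S.mu / 2 * ‖x - X‖ ^ 2 + S.κ ^ 2 / S.mu / 2 * ‖p‖ ^ 2 := by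
    rw [← inner_sub_left]
    have h1 := real_inner_le_norm (X - x) p
    rw [norm_sub_rev] at h1
    have h2 := mul_le_mul_of_nonneg_left h1 hκ
    have h3 : 0 ≤ 1 / (2 * S.mu) * (S.mu * ‖x - X‖ - S.κ * ‖p‖) ^ 2 := by positivity
    have h4 : 1 / (2 * S.mu) * (S.mu * ‖x - X‖ - S.κ * ‖p‖) ^ 2
        = S.mu / 2 * ‖x - X‖ ^ 2 + S.κ ^ 2 / S.mu / 2 * ‖p‖ ^ 2
          - S.κ * (‖x - X‖ * ‖p‖) := by
      field_simp
      ring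
    linarith
  rw [hx1] at hwd
  linarith

end Valid

end Setup

/-! ### Measurability -/

section MeasurableStates

variable {d t m n : ℕ}

instance : MeasurableSpace (InnerState d t m n) :=
  MeasurableSpace.comap (fun s => (s.α, s.u, s.e)) inferInstance

lemma measurable_innerState_tuple :
    Measurable (fun s : InnerState d t m n => (s.α, s.u, s.e)) :=
  comap_measurable _

lemma measurable_α : Measurable (fun s : InnerState d t m n => s.α) :=
  measurable_innerState_tuple.fst

lemma measurable_u : Measurable (fun s : InnerState d t m n => s.u) :=
  measurable_innerState_tuple.snd.fst

lemma measurable_e : Measurable (fun s : InnerState d t m n => s.e) :=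
  measurable_innerState_tuple.snd.snd

lemma measurable_innerState_mk {X : Type*} [MeasurableSpace X] {f : X → InnerState d t m n}
    (hα : Measurable fun x => (f x).α) (hu : Measurable fun x => (f x).u)
    (he : Measurable fun x => (f x).e) : Measurable f :=
  measurable_comap_iff.2 (hα.prodMk (hu.prodMk he))

lemma measurable_comp_countable {ι X Y : Type*} [Countable ι] [MeasurableSpace ι]
    [MeasurableSingletonClass ι] [MeasurableSpace X] [MeasurableSpace Y] {f : ι → X → Y}
    (hf : ∀ i, Measurable (f i)) {g : X → ι} (hg : Measurable g) :
    Measurable fun x => f (g x) x :=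
  (measurable_from_prod_countable_right (f := fun p : ι × X => f p.1 p.2) hf).comp
    (hg.prodMk measurable_id)

/-- As `sInf ∅ = 0`, the fibre over 0 also contains the points lying in no `A K`. -/
lemma measurable_sInf_nat {X : Type*} [MeasurableSpace X] {A : ℕ → Set X}
    (hA : ∀ K, MeasurableSet (A K)) : Measurable (fun x => sInf {K | x ∈ A K}) := by
  classical
  refine measurable_to_countable' fun j => ?_
  have e : (fun x => sInf {K | x ∈ A K}) ⁻¹' {j}
      = (A j ∩ ⋂ i ∈ Set.Iio j, (A i)ᶜ) ∪ (if j = 0 then ⋂ i, (A i)ᶜ else ∅) := by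
    ext x
    simp only [Set.mem_preimage, Set.mem_singleton_iff, Set.mem_union, Set.mem_inter_iff,
      Set.mem_iInter, Set.mem_Iio, Set.mem_compl_iff]
    constructor
    · rintro rfl
      rcases Set.eq_empty_or_nonempty {K | x ∈ A K} with h0 | h0
      · right
        rw [h0]
        simp only [Nat.sInf_empty, if_true, Set.mem_iInter, Set.mem_compl_iff]
        intro i hi
        exact (h0 ▸ hi : i ∈ (∅ : Set ℕ))
      · exact Or.inl ⟨Nat.sInf_mem h0, fun i hi => Nat.notMem_of_lt_sInf hi⟩
    · rintro (⟨h1, h2⟩ | h1)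
      · refine le_antisymm (Nat.sInf_le h1) ?_
        by_contra! hlt
        exact h2 _ hlt (Nat.sInf_mem (s := {K | x ∈ A K}) ⟨j, h1⟩)
      · split_ifs at h1 with hj
        · subst hj
          simp only [Set.mem_iInter, Set.mem_compl_iff] at h1
          have : {K | x ∈ A K} = ∅ := Set.eq_empty_iff_forall_notMem.2 h1
          rw [this, Nat.sInf_empty]
        · exact absurd h1 (Set.notMem_empty x)
  rw [e]
  refine MeasurableSet.union ((hA j).inter ?_) ?_
  · exact MeasurableSet.biInter (Set.to_countable _) fun i _ => (hA i).compl
  · split_ifs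
    · exact MeasurableSet.iInter fun i => (hA i).compl
    · exact MeasurableSet.empty

end MeasurableStates

namespace Setup

set_option linter.unusedSectionVars false

variable {d t m n : ℕ} {Ξ : Type*} [MeasurableSpace Ξ] {S : Setup d t m n Ξ} {ν : Measure Ξ}

/-! #### Stopping times -/

/-- The set of the iterations at which the inner loop may stop. -/
def hits (S : Setup d t m n Ξ) (y : Vec d) (α : Fin n → Fin m → Vec t) (ε : ℝ)
    (w : InnerDraws m n Ξ) : Set ℕ :=
  {K | 1 ≤ K ∧ S.Stop y ε (S.iter y α w K)}

/-- If the criterion is never met both sides are 0, as `toNat` of ⊤ and as `sInf ∅`. -/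
lemma stopTime_toNat (y : Vec d) (α : Fin n → Fin m → Vec t) (ε : ℝ) (w : InnerDraws m n Ξ) :
    (S.stopTime y α ε w).toNat = sInf (S.hits y α ε w) := by
  change (⨅ K ∈ S.hits y α ε w, (K : ℕ∞)).toNat = _
  rcases Set.eq_empty_or_nonempty (S.hits y α ε w) with h0 | h0
  · simp [h0]
  · have : (⨅ K ∈ S.hits y α ε w, (K : ℕ∞)) = ((sInf (S.hits y α ε w) : ℕ) : ℕ∞) := by
      refine le_antisymm (iInf₂_le _ (Nat.sInf_mem h0)) (le_iInf₂ fun K hK => ?_)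
      exact_mod_cast Nat.sInf_le hK
    rw [this, ENat.toNat_natCast]

lemma stopTime_le {y : Vec d} {α : Fin n → Fin m → Vec t} {ε : ℝ} {w : InnerDraws m n Ξ} {K : ℕ}
    (hK : K ∈ S.hits y α ε w) : S.stopTime y α ε w ≤ K :=
  iInf₂_le K hK

lemma stop_of_ne_top {y : Vec d} {α : Fin n → Fin m → Vec t} {ε : ℝ} {w : InnerDraws m n Ξ}
    (hT : S.stopTime y α ε w ≠ ⊤) :
    S.Stop y ε (S.iter y α w (S.stopTime y α ε w).toNat) := by
  have h0 : (S.hits y α ε w).Nonempty := by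
    by_contra h0
    rw [Set.not_nonempty_iff_eq_empty] at h0
    refine hT ?_
    change (⨅ K ∈ S.hits y α ε w, (K : ℕ∞)) = ⊤
    simp [h0]
  rw [stopTime_toNat]
  exact (Nat.sInf_mem h0).2

namespace Valid

variable (h : S.Valid ν)
include h

lemma continuous_g : Continuous S.g := StrongConvexOn.continuous' h.lam_pos.le h.strong

lemma continuous_P : Continuous S.P := StrongConvexOn.continuous' h.lam_pos.le h.strongConvexOn_P

/-- The prox-term is quadratic, so the prox-center only translates the argument. Joint continuity in
(y, u) thus reduces to continuity in one variable. -/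
lemma gradConj_xi (y u : Vec d) :
    gradConj (S.xi y) u = gradConj (S.xi 0) (u + (S.κ / S.mu) • y) := by
  have hmu := h.mu_pos
  refine (hasGradientAt_conjR one_pos (h.strongConvexOn_xi y) fun z => ?_).2.2.2.gradient
  have h1 := inner_sub_add_sq_le one_pos (h.strongConvexOn_xi 0) (u + (S.κ / S.mu) • y) z
  have e : ∀ z, inner ℝ z u - S.xi y z
      = inner ℝ z (u + (S.κ / S.mu) • y) - S.xi 0 z - S.κ / 2 * ‖y‖ ^ 2 / S.mu := fun z => by
    rw [xi, xi, inner_add_right, real_inner_smul_right, norm_sub_sq_real, sub_zero]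
    field_simp
    ring
  rw [e, e]
  linarith

lemma continuous_gradConj_xi : Continuous (fun p : Vec d × Vec d => gradConj (S.xi p.1) p.2) := by
  have e : (fun p : Vec d × Vec d => gradConj (S.xi p.1) p.2)
      = fun p => gradConj (S.xi 0) (p.2 + (S.κ / S.mu) • p.1) :=
    funext fun p => h.gradConj_xi p.1 p.2
  rw [e]
  exact (continuous_gradConj one_pos (h.strongConvexOn_xi 0)).comp (by fun_prop)

lemma continuous_conjR_xi : Continuous (fun p : Vec d × Vec d => conjR (S.xi p.1) p.2) := by
  have h1 := h.continuous_gradConj_xi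
  have h2 := h.continuous_g
  have e : (fun p : Vec d × Vec d => conjR (S.xi p.1) p.2) = fun p =>
      inner ℝ (gradConj (S.xi p.1) p.2) p.2 - (S.g (gradConj (S.xi p.1) p.2)
        + S.κ / 2 * ‖gradConj (S.xi p.1) p.2 - p.1‖ ^ 2) / S.mu := by
    ext p
    exact conjR_eq one_pos (h.strongConvexOn_xi p.1) p.2
  rw [e]
  fun_prop

lemma continuous_Gmin : Continuous S.Gmin := by
  -- Up to a constant, minimizing G(y, ·) means maximizing ⟨z, κy⟩ - G(0, z).
  have e : ∀ y, S.Gmin y = S.G y (gradConj (S.G 0) (S.κ • y)) := fun y => by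
    refine le_antisymm (h.Gmin_le y _) (le_ciInf fun z => ?_)
    have h1 := inner_sub_add_sq_le h.mu_pos (h.strongConvexOn_G 0) (S.κ • y) z
    have h2 : 0 ≤ S.mu / 2 * ‖z - gradConj (S.G 0) (S.κ • y)‖ ^ 2 := by
      have := h.mu_pos
      positivity
    have h3 : ∀ z, S.G y z = -(inner ℝ z (S.κ • y) - S.G 0 z) + S.κ / 2 * ‖y‖ ^ 2 := fun z => by
      rw [G, G, real_inner_smul_right, norm_sub_sq_real, sub_zero]
      ring
    rw [h3, h3]
    linarith
  have h1 := (continuous_gradConj h.mu_pos (h.strongConvexOn_G 0)).comp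
    (continuous_const_smul S.κ)
  have h2 := h.continuous_P
  rw [funext e]
  unfold G
  exact (h2.comp h1).add ((((h1.sub continuous_id).norm).pow 2).const_mul _)

variable {X : Type*} [MeasurableSpace X] {y : X → Vec d} {s : X → InnerState d t m n}

lemma measurable_primal (hy : Measurable y) (hs : Measurable s) :
    Measurable fun x => S.primal (y x) (s x) := by
  have h2 : Measurable fun x => (s x).u := measurable_u.comp hs
  exact Continuous.measurable2 (c := fun y u => gradConj (S.xi y) u) h.continuous_gradConj_xi hy h2

omit h in
lemma measurable_v {α : X → Fin n → Fin m → Vec t} (hα : Measurable α) :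
    Measurable fun x => S.v (α x) := by
  have h1 : Continuous S.v := by
    unfold v
    fun_prop
  exact h1.measurable.comp hα

lemma measurable_message (hy : Measurable y) (hs : Measurable s) (τ : Fin n) (i : Fin m) :
    (Measurable fun x => S.dualStep (y x) (s x) τ i) ∧
    Measurable fun x => S.message (y x) (s x) τ i := by
  have hα : Measurable fun x => (s x).α τ i :=
    (measurable_pi_apply i).comp ((measurable_pi_apply τ).comp (measurable_α.comp hs))
  have he : Measurable fun x => (s x).e τ := (measurable_pi_apply τ).comp (measurable_e.comp hs)
  have hg : Measurable (gradient (S.φ τ i)) :=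
    ((h.smooth τ i).continuous_gradient (one_div_nonneg.2 h.γ_pos.le)).measurable
  have h1 : Measurable fun x => S.dualStep (y x) (s x) τ i := by
    have h2 : Measurable fun x => gradient (S.φ τ i) ((S.A τ i).adjoint (S.primal (y x) (s x))) :=
      hg.comp ((S.A τ i).adjoint.continuous.measurable.comp (h.measurable_primal hy hs))
    unfold dualStep
    fun_prop
  refine ⟨h1, ?_⟩
  have h3 : Measurable fun x => S.A τ i (S.dualStep (y x) (s x) τ i) :=
    (S.A τ i).continuous.measurable.comp h1
  unfold message
  fun_prop

lemma measurable_innerStep (hy : Measurable y) (hs : Measurable s)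
    {w : X → Fin n → Fin m × Ξ} (hw : Measurable w) :
    Measurable fun x => S.innerStep (y x) (w x) (s x) := by
  have hwτ : ∀ τ, Measurable fun x => w x τ := fun τ => (measurable_pi_apply τ).comp hw
  have hmsg : ∀ τ, Measurable fun x => S.message (y x) (s x) τ (w x τ).1 := fun τ =>
    measurable_comp_countable (f := fun i x => S.message (y x) (s x) τ i)
      (fun i => (h.measurable_message hy hs τ i).2) (hwτ τ).fst
  have hQ : ∀ τ, Measurable fun x => S.Q (w x τ).2 (S.message (y x) (s x) τ (w x τ).1) :=
    fun τ => h.compressor.measurable.comp ((hwτ τ).snd.prodMk (hmsg τ))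
  refine measurable_innerState_mk ?_ ?_ ?_
  · refine measurable_pi_lambda _ fun τ => measurable_pi_lambda _ fun i => ?_
    have hα : Measurable fun x => (s x).α τ i :=
      (measurable_pi_apply i).comp ((measurable_pi_apply τ).comp (measurable_α.comp hs))
    have e : (fun x => (S.innerStep (y x) (w x) (s x)).α τ i)
        = fun x => if i = (w x τ).1 then (s x).α τ i + S.dualStep (y x) (s x) τ i
          else (s x).α τ i := by
      ext x : 1
      change Function.update ((s x).α τ) (w x τ).1 _ i = _
      split_ifs with hi
      · rw [hi, Function.update_self]
      · rw [Function.update_of_ne hi]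
    rw [e]
    refine Measurable.ite ?_ (hα.add (h.measurable_message hy hs τ i).1) hα
    exact (measurableSet_singleton i).preimage (hwτ τ).fst |>.congr (by
      ext x
      simp [eq_comm])
  · have h1 : Measurable fun x => (s x).u := measurable_u.comp hs
    have h2 : Measurable fun x => ∑ τ, S.Q (w x τ).2 (S.message (y x) (s x) τ (w x τ).1) :=
      Finset.measurable_fun_sum _ fun τ _ => hQ τ
    change Measurable fun x => (s x).u
      + (1 / (n : ℝ)) • ∑ τ, S.Q (w x τ).2 (S.message (y x) (s x) τ (w x τ).1)
    fun_prop
  · exact measurable_pi_lambda _ fun τ => (hmsg τ).sub (hQ τ)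

lemma measurable_lyap (hy : Measurable y) (hs : Measurable s) :
    Measurable fun x => S.lyap (y x) (s x) := by
  have hα : ∀ τ i, Measurable fun x => (s x).α τ i := fun τ i =>
    (measurable_pi_apply i).comp ((measurable_pi_apply τ).comp (measurable_α.comp hs))
  have he : ∀ τ, Measurable fun x => (s x).e τ := fun τ =>
    (measurable_pi_apply τ).comp (measurable_e.comp hs)
  have h1 : Measurable fun x => S.Gmin (y x) := h.continuous_Gmin.measurable.comp hy
  have h2 : Measurable fun x => ∑ τ, ∑ i, conjR (S.φ τ i) (-((s x).α τ i)) :=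
    Finset.measurable_fun_sum _ fun τ _ => Finset.measurable_fun_sum _ fun i _ =>
      measurable_conjR.comp (hα τ i).neg
  have h3 : Measurable fun x => S.v (s x).α := measurable_v (measurable_α.comp hs)
  have h4 : Measurable fun x => conjR (S.xi (y x)) (S.v (s x).α) :=
    Continuous.measurable2 (c := fun y u => conjR (S.xi y) u) h.continuous_conjR_xi hy h3
  have h5 : Measurable fun x => ∑ τ, (s x).e τ := Finset.measurable_fun_sum _ fun τ _ => he τ
  have h6 : Measurable fun x => ∑ τ, ‖(s x).e τ‖ ^ 2 :=
    Finset.measurable_fun_sum _ fun τ _ => (he τ).norm.pow_const 2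
  unfold lyap dualR errR
  fun_prop

lemma measurableSet_stopping (hy : Measurable y) (hs : Measurable s) (ε : ℝ)
    (hfin : ∀ x, S.DualFinite (s x).α) : MeasurableSet {x | S.Stop (y x) ε (s x)} := by
  have e : {x | S.Stop (y x) ε (s x)} = {x | 3 * √(2 + S.δ * m) * S.lyap (y x) (s x)
      + 2 * (S.G (y x) (S.primal (y x) (s x)) - S.Gmin (y x)) ≤ ε} := by
    ext x
    exact h.stop_iff (y x) ε (hfin x)
  rw [e]
  have hp := h.measurable_primal hy hs
  have hG : Measurable fun x => S.G (y x) (S.primal (y x) (s x)) := by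
    have h1 : Measurable fun x => S.P (S.primal (y x) (s x)) :=
      h.continuous_P.measurable.comp hp
    unfold G
    fun_prop
  have hmin : Measurable fun x => S.Gmin (y x) := h.continuous_Gmin.measurable.comp hy
  have hl := h.measurable_lyap hy hs
  exact measurableSet_le (by fun_prop) measurable_const

/-- Only the draws before step K have to be measurable, and the σ-algebra on X is arbitrary. This is
what later makes the draws of step K independent of the state. -/
lemma measurable_iter {α : X → Fin n → Fin m → Vec t} {W : ℕ → Fin n → X → Fin m × Ξ}
    (hy : Measurable y) (hα : Measurable α) {K : ℕ} (hW : ∀ k < K, ∀ τ, Measurable (W k τ)) :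
    Measurable fun x => S.iter (y x) (α x) (fun k τ => W k τ x) K := by
  induction K with
  | zero =>
    exact measurable_innerState_mk hα (measurable_v hα) measurable_const
  | succ K ih =>
    exact h.measurable_innerStep hy (ih fun k hk τ => hW k (by omega) τ)
      (measurable_pi_lambda _ fun τ => hW K (by omega) τ)

lemma dualFinite_zero : S.DualFinite 0 := fun τ i => by
  simpa using conj_zero_ne_top (h.bddBelow τ i)

lemma dualFinite_outer (w : ℕ → InnerDraws m n Ξ) (k : ℕ) : S.DualFinite (S.outer w k).α := by
  induction k with
  | zero => exact h.dualFinite_zero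
  | succ k ih => exact (h.inv_iter _ ih _ _).finite

/-- The outer iterates depend measurably on the draws of the earlier outer iterations. -/
lemma measurable_outer {U : ℕ → ℕ → Fin n → X → Fin m × Ξ} {k : ℕ}
    (hU : ∀ j ≤ k, ∀ K τ, Measurable (U j K τ)) :
    (Measurable fun x => (S.outer (fun k K τ => U k K τ x) k).x) ∧
    (Measurable fun x => (S.outer (fun k K τ => U k K τ x) k).y) ∧
    Measurable fun x => (S.outer (fun k K τ => U k K τ x) k).α := by
  induction k with
  | zero => exact ⟨measurable_const, measurable_const, measurable_const⟩
  | succ k ih =>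
    obtain ⟨hx, hy, hα⟩ := ih fun j hj => hU j (by omega)
    have hit := fun K => h.measurable_iter (W := U (k + 1)) (K := K) hy hα
      fun K _ τ => hU (k + 1) le_rfl K τ
    have hN : Measurable fun x => (S.count (k + 1) (S.outer (fun k K τ => U k K τ x) k)
        (fun K τ => U (k + 1) K τ x)).toNat := by
      unfold count
      simp only [stopTime_toNat]
      refine measurable_sInf_nat (A := fun K => {x | 1 ≤ K ∧
        S.Stop (S.outer (fun k K τ => U k K τ x) k).y (S.eps (k + 1))
          (S.iter (S.outer (fun k K τ => U k K τ x) k).y (S.outer (fun k K τ => U k K τ x) k).α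
            (fun K τ => U (k + 1) K τ x) K)}) fun K => ?_
      exact (MeasurableSet.const (1 ≤ K)).inter (h.measurableSet_stopping hy (hit K) _ fun x =>
        (h.inv_iter _ (h.dualFinite_outer _ k) _ K).finite)
    have hs := measurable_comp_countable hit hN
    have hx' := h.measurable_primal hy hs
    refine ⟨hx', ?_, measurable_α.comp hs⟩
    have hd : Measurable fun x => S.catB k • (S.primal (S.outer (fun k K τ => U k K τ x) k).y
        (S.iter (S.outer (fun k K τ => U k K τ x) k).y (S.outer (fun k K τ => U k K τ x) k).α
          (fun K τ => U (k + 1) K τ x) (S.count (k + 1) (S.outer (fun k K τ => U k K τ x) k)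
            (fun K τ => U (k + 1) K τ x)).toNat) - (S.outer (fun k K τ => U k K τ x) k).x) :=
      (hx'.sub hx).const_smul (S.catB k)
    exact hx'.add hd

end Valid

end Setup

namespace Setup

set_option linter.unusedSectionVars false

variable {d t m n : ℕ} {Ξ : Type*} [MeasurableSpace Ξ] {S : Setup d t m n Ξ} {ν : Measure Ξ}
  [IsProbabilityMeasure ν] {Ω : Type*} [mΩ : MeasurableSpace Ω] {prob : Measure Ω}
  [IsProbabilityMeasure prob] {U : ℕ → ℕ → Fin n → Ω → Fin m × Ξ}

/-! ### The expected progress of an inner loop -/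

lemma _root_.ECSDCA.IsSampling.map_eq (hU : IsSampling prob ν U) (k K : ℕ) :
    Measure.map (fun ω τ => U k K τ ω) prob = stepLaw m n ν := by
  have h1 : iIndepFun (fun τ : Fin n => U k K τ) prob :=
    hU.indep.precomp (g := fun τ : Fin n => (k, K, τ)) fun τ σ hτσ => by simpa using hτσ
  rw [(iIndepFun_iff_map_fun_eq_pi_map fun τ => (hU.measurable k K τ).aemeasurable).1 h1]
  unfold stepLaw
  congr 1
  ext1 τ
  exact hU.law k K τ

/-- The hypothesis expresses that A is a function of the past draws: it is measurable for every
σ-algebra that makes them measurable. Applied to the σ-algebra they generate, it reduces the claim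
to independence of disjoint groups of draws. -/
lemma _root_.ECSDCA.IsSampling.indepFun (hU : IsSampling prob ν U) {Y : Type*}
    [mY : MeasurableSpace Y] (k K : ℕ) {A : Ω → Y}
    (hA : ∀ m' : MeasurableSpace Ω,
      (∀ j K' τ, j ≤ k ∨ (j = k + 1 ∧ K' < K) → Measurable[m'] (U j K' τ)) → Measurable[m'] A) :
    IndepFun A (fun ω τ => U (k + 1) K τ ω) prob := by
  set mj : ℕ × ℕ × Fin n → MeasurableSpace Ω :=
    fun j => MeasurableSpace.comap (U j.1 j.2.1 j.2.2) inferInstance with hmj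
  have hle : ∀ j, mj j ≤ mΩ := fun j => (hU.measurable j.1 j.2.1 j.2.2).comap_le
  have hdisj : Disjoint {j : ℕ × ℕ × Fin n | j.1 ≤ k ∨ (j.1 = k + 1 ∧ j.2.1 < K)}
      {j : ℕ × ℕ × Fin n | j.1 = k + 1 ∧ j.2.1 = K} := by
    rw [Set.disjoint_left]
    rintro ⟨a, b, c⟩ h1 h2
    simp only [Set.mem_ofPred_eq] at h1 h2
    omega
  have hind := indep_iSup_of_disjoint hle ((iIndepFun_iff_iIndep _ _ _).1 hU.indep) hdisj
  rw [IndepFun_iff_Indep]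
  refine indep_of_indep_of_le_left (indep_of_indep_of_le_right hind ?_) ?_
  · refine Measurable.comap_le ?_
    have hpi : ∀ m' : MeasurableSpace Ω, (∀ τ, Measurable[m'] (U (k + 1) K τ)) →
        Measurable[m'] fun ω τ => U (k + 1) K τ ω := fun m' hm' => measurable_pi_lambda _ hm'
    refine hpi _ fun τ => ?_
    exact (comap_measurable _).mono (le_iSup₂_of_le (k + 1, K, τ) ⟨rfl, rfl⟩ le_rfl) le_rfl
  · refine Measurable.comap_le (hA _ fun j K' τ hj => ?_)
    exact (comap_measurable _).mono (le_iSup₂_of_le (j, K', τ) hj le_rfl) le_rfl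

namespace Valid

variable (h : S.Valid ν)
include h

/-- Expected contraction along the inner loop of outer iteration `k + 1`. -/
lemma lintegral_iter_le (hU : IsSampling prob ν U) (k K : ℕ) :
    ∫⁻ ω, ENNReal.ofReal (S.lyap (S.outer (fun k K τ => U k K τ ω) k).y
        (S.iter (S.outer (fun k K τ => U k K τ ω) k).y (S.outer (fun k K τ => U k K τ ω) k).α
          (fun K τ => U (k + 1) K τ ω) K)) ∂prob
      ≤ ENNReal.ofReal (1 - S.contr) ^ K * ∫⁻ ω, ENNReal.ofReal
        (S.lyap (S.outer (fun k K τ => U k K τ ω) k).y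
          (S.innerInit (S.outer (fun k K τ => U k K τ ω) k).α)) ∂prob := by
  induction K with
  | zero => simp [iter]
  | succ K ih =>
    set A : Ω → Vec d × InnerState d t m n := fun ω =>
      ((S.outer (fun k K τ => U k K τ ω) k).y,
        S.iter (S.outer (fun k K τ => U k K τ ω) k).y (S.outer (fun k K τ => U k K τ ω) k).α
          (fun K τ => U (k + 1) K τ ω) K) with hA
    set w : Ω → Fin n → Fin m × Ξ := fun ω τ => U (k + 1) K τ ω with hw
    have hAm : ∀ m' : MeasurableSpace Ω,
        (∀ j K' τ, j ≤ k ∨ (j = k + 1 ∧ K' < K) → Measurable[m'] (U j K' τ)) →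
        Measurable[m'] A := fun m' hm' => by
      obtain ⟨-, hy, hα⟩ := h.measurable_outer (U := U) (k := k)
        fun j hj K τ => hm' j K τ (Or.inl hj)
      exact hy.prodMk (h.measurable_iter (W := U (k + 1)) hy hα
        fun K' hK' τ => hm' (k + 1) K' τ (Or.inr ⟨rfl, hK'⟩))
    have hAmeas : Measurable A := hAm mΩ fun j K' τ _ => hU.measurable j K' τ
    have hwmeas : Measurable w := measurable_pi_lambda _ fun τ => hU.measurable (k + 1) K τ
    have hind := hU.indepFun k K hAm
    -- State and fresh draws have a product law, so the one-step bound applies with the state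
    -- frozen.
    have hmap := (indepFun_iff_map_prod_eq_prod_map_map hAmeas.aemeasurable
      hwmeas.aemeasurable).1 hind
    rw [hU.map_eq] at hmap
    have hf : Measurable fun p : (Vec d × InnerState d t m n) × (Fin n → Fin m × Ξ) =>
        ENNReal.ofReal (S.lyap p.1.1 (S.innerStep p.1.1 p.2 p.1.2)) := by
      have h1 : Measurable fun p : (Vec d × InnerState d t m n) × (Fin n → Fin m × Ξ) => p.1.1 :=
        measurable_fst.fst
      exact (h.measurable_lyap h1 (h.measurable_innerStep h1 measurable_fst.snd
        measurable_snd)).ennreal_ofReal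
    have hprob : IsProbabilityMeasure (stepLaw m n ν) := by
      have := h.neZero_m
      unfold stepLaw
      infer_instance
    calc ∫⁻ ω, ENNReal.ofReal (S.lyap (A ω).1 (S.innerStep (A ω).1 (w ω) (A ω).2)) ∂prob
        = ∫⁻ p, ENNReal.ofReal (S.lyap p.1.1 (S.innerStep p.1.1 p.2 p.1.2))
            ∂((Measure.map A prob).prod (stepLaw m n ν)) := by
          rw [← hmap, lintegral_map hf (hAmeas.prodMk hwmeas)]
      _ = ∫⁻ a, ∫⁻ v, ENNReal.ofReal (S.lyap a.1 (S.innerStep a.1 v a.2)) ∂(stepLaw m n ν)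
            ∂(Measure.map A prob) := lintegral_prod _ hf.aemeasurable
      _ = ∫⁻ ω, ∫⁻ v, ENNReal.ofReal (S.lyap (A ω).1 (S.innerStep (A ω).1 v (A ω).2))
            ∂(stepLaw m n ν) ∂prob := lintegral_map hf.lintegral_prod_right' hAmeas
      _ ≤ ∫⁻ ω, ENNReal.ofReal (1 - S.contr) * ENNReal.ofReal (S.lyap (A ω).1 (A ω).2) ∂prob :=
          lintegral_mono fun ω => h.lintegral_step_le _
            (h.inv_iter _ (h.dualFinite_outer _ k) _ K)
      _ = ENNReal.ofReal (1 - S.contr) * ∫⁻ ω, ENNReal.ofReal (S.lyap (A ω).1 (A ω).2) ∂prob := by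
          refine lintegral_const_mul _ ?_
          exact (h.measurable_lyap hAmeas.fst hAmeas.snd).ennreal_ofReal
      _ ≤ _ := by
          rw [pow_succ', mul_assoc]
          gcongr

end Valid

end Setup

/-! ### The expected number of inner iterations -/

lemma one_sub_pow_mul_le_one {r Y : ℝ} (hr : 0 < r) (hr1 : r ≤ 1) (hY : 0 < Y) {N : ℕ}
    (hN : Real.log Y / r ≤ N) : (1 - r) ^ N * Y ≤ 1 := by
  have h1 := sub_nonneg.2 hr1
  have h2 : (1 - r) ^ N ≤ Y⁻¹ :=
    calc (1 - r) ^ N ≤ Real.exp (-r) ^ N := pow_le_pow_left₀ h1 (Real.one_sub_le_exp_neg r) N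
      _ = Real.exp (-(r * N)) := by rw [← Real.exp_nat_mul]; ring_nf
      _ ≤ Real.exp (-Real.log Y) := by
          rw [div_le_iff₀' hr] at hN
          exact Real.exp_le_exp.2 (neg_le_neg hN)
      _ = Y⁻¹ := by rw [Real.exp_neg, Real.exp_log hY]
  calc (1 - r) ^ N * Y ≤ Y⁻¹ * Y := mul_le_mul_of_nonneg_right h2 hY.le
    _ = 1 := inv_mul_cancel₀ hY.ne'

/-- About log Y / r terms are bounded by 1; the remaining ones are dominated by a geometric series
of sum 1/r. -/
lemma tsum_min_one_le {r Y : ℝ} (hr : 0 < r) (hr1 : r ≤ 1) (hY : 1 ≤ Y) :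
    ∑' K : ℕ, min 1 (ENNReal.ofReal (1 - r) ^ K * ENNReal.ofReal Y)
      ≤ ENNReal.ofReal (1 / r * (2 + Real.log Y)) := by
  have hlog : 0 ≤ Real.log Y := Real.log_nonneg hY
  obtain ⟨N, hN, h3⟩ : ∃ N : ℕ, Real.log Y / r ≤ N ∧ (N : ℝ) ≤ Real.log Y / r + 1 :=
    ⟨_, Nat.le_ceil _, (Nat.ceil_lt_add_one (by positivity)).le⟩
  have h1 := one_sub_pow_mul_le_one hr hr1 (by linarith) hN
  have h2 : ENNReal.ofReal (1 - r) ^ N * ENNReal.ofReal Y ≤ 1 := by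
    rw [← ENNReal.ofReal_pow (sub_nonneg.2 hr1),
      ← ENNReal.ofReal_mul (pow_nonneg (sub_nonneg.2 hr1) _)]
    exact ENNReal.ofReal_le_one.2 h1
  have h4 : (1 - ENNReal.ofReal (1 - r))⁻¹ = ENNReal.ofReal (1 / r) := by
    rw [← ENNReal.ofReal_one, ← ENNReal.ofReal_sub _ (sub_nonneg.2 hr1), sub_sub_cancel,
      ENNReal.ofReal_div_of_pos hr, ENNReal.ofReal_one, one_div]
  have h5 : ∀ K : ℕ, min 1 (ENNReal.ofReal (1 - r) ^ (K + N) * ENNReal.ofReal Y)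
      ≤ ENNReal.ofReal (1 - r) ^ K := fun K => by
    refine (min_le_right _ _).trans ?_
    rw [pow_add, mul_assoc]
    exact mul_le_of_le_one_right' h2
  have h6 : ∑ K ∈ Finset.range N, min 1 (ENNReal.ofReal (1 - r) ^ K * ENNReal.ofReal Y) ≤ N :=
    (Finset.sum_le_card_nsmul _ _ 1 fun _ _ => min_le_left _ _).trans (by simp)
  have h7 : ∑' K : ℕ, min 1 (ENNReal.ofReal (1 - r) ^ (K + N) * ENNReal.ofReal Y)
      ≤ ∑' K : ℕ, ENNReal.ofReal (1 - r) ^ K := ENNReal.tsum_le_tsum h5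
  rw [← Summable.sum_add_tsum_nat_add' (k := N) ENNReal.summable]
  refine (add_le_add h6 h7).trans ?_
  rw [ENNReal.tsum_geometric, h4, ← ENNReal.ofReal_natCast,
    ← ENNReal.ofReal_add (Nat.cast_nonneg N) (by positivity)]
  refine ENNReal.ofReal_le_ofReal ?_
  have : 1 ≤ 1 / r := by rwa [one_le_div hr]
  have e : 1 / r * (2 + Real.log Y) = 1 / r + 1 / r + Real.log Y / r := by ring
  linarith

namespace Setup

set_option linter.unusedSectionVars false

variable {d t m n : ℕ} {Ξ : Type*} [MeasurableSpace Ξ] {S : Setup d t m n Ξ} {ν : Measure Ξ}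
  [IsProbabilityMeasure ν] {Ω : Type*} [mΩ : MeasurableSpace Ω] {prob : Measure Ω}
  [IsProbabilityMeasure prob] {U : ℕ → ℕ → Fin n → Ω → Fin m × Ξ}

/-- The inner loop stops as soon as this multiple of the Lyapunov function is at most the
tolerance. -/
def stopFactor (S : Setup d t m n Ξ) : ℝ := 3 * √(2 + S.δ * m) + 2 / S.theta

namespace Valid

variable (h : S.Valid ν)
include h

lemma stopFactor_pos : 0 < S.stopFactor := by
  have := h.theta_pos
  unfold stopFactor
  positivity

/-- The primal gap in the criterion is at most Ψ/θ, whence the summand 2/θ of `stopFactor`. -/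
lemma stop_of_lyap_le {y : Vec d} {ε : ℝ} {s : InnerState d t m n} (hs : S.Inv s)
    (hle : S.stopFactor * S.lyap y s ≤ ε) : S.Stop y ε s := by
  rw [h.stop_iff y ε hs.finite]
  have h1 := h.primal_gap_le y hs
  have h2 := h.theta_pos
  have h3 : S.G y (S.primal y s) - S.Gmin y ≤ 1 / S.theta * S.lyap y s := by
    rw [one_div_mul_eq_div, le_div_iff₀' h2]
    exact h1
  have e : S.stopFactor * S.lyap y s
      = 3 * √(2 + S.δ * m) * S.lyap y s + 2 * (1 / S.theta * S.lyap y s) := by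
    unfold stopFactor
    ring
  linarith

/-- T counts the steps K < T. Step 0 is never tested and accounts for the 1; each later one fails
the test, so its truncated term equals 1. If T = ⊤, the series diverges as well. -/
lemma stopTime_le_tsum (y : Vec d) {α : Fin n → Fin m → Vec t} (hα : S.DualFinite α) {ε : ℝ}
    (hε : 0 < ε) (w : InnerDraws m n Ξ) :
    (S.stopTime y α ε w : ℝ≥0∞) ≤ 1 + ∑' K, min 1
      (ENNReal.ofReal (S.stopFactor / ε) * ENNReal.ofReal (S.lyap y (S.iter y α w K))) := by
  set F : ℕ → ℝ≥0∞ := fun K => min 1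
      (ENNReal.ofReal (S.stopFactor / ε) * ENNReal.ofReal (S.lyap y (S.iter y α w K))) with hF
  have hone : ∀ K : ℕ, 1 ≤ K → (K : ℕ∞) < S.stopTime y α ε w → F K = 1 := fun K hK hlt => by
    refine min_eq_left ?_
    have h1 : ¬ S.Stop y ε (S.iter y α w K) := fun hs => hlt.not_ge (stopTime_le ⟨hK, hs⟩)
    have h2 : ε < S.stopFactor * S.lyap y (S.iter y α w K) := by
      by_contra! hle
      exact h1 (h.stop_of_lyap_le (h.inv_iter y hα w K) hle)
    have h3 := h.stopFactor_pos
    rw [← ENNReal.ofReal_mul (by positivity), ENNReal.one_le_ofReal, div_mul_eq_mul_div,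
      one_le_div hε]
    exact h2.le
  have hnat : ∀ M : ℕ, (M : ℕ∞) ≤ S.stopTime y α ε w → (M : ℝ≥0∞) ≤ 1 + ∑' K, F K := by
    intro M hM
    rcases M with _ | M
    · simp
    have h1 : ∑ K ∈ Finset.Icc 1 M, F K = M := by
      rw [Finset.sum_congr rfl fun K hK => hone K (Finset.mem_Icc.1 hK).1 ?_]
      · simp
      · refine lt_of_lt_of_le ?_ hM
        have := (Finset.mem_Icc.1 hK).2
        exact_mod_cast (by omega : K < M + 1)
    rw [Nat.cast_add, Nat.cast_one, add_comm, ← h1]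
    gcongr
    exact ENNReal.sum_le_tsum _
  rcases hT : S.stopTime y α ε w with _ | M
  · have : 1 + ∑' K, F K = ⊤ := ENNReal.eq_top_of_forall_nnreal_le fun r =>
      (ENNReal.coe_le_coe.2 (Nat.le_ceil r)).trans
        (by simpa using hnat ⌈r⌉₊ (hT ▸ le_top))
    rw [this]
    exact le_top
  · exact (ENat.toENNReal_coe M).le.trans (hnat M hT.ge)

/-- The expected number of iterations of an inner loop in terms of its expected initial gap. -/
lemma lintegral_T_le (hU : IsSampling prob ν U) (k : ℕ) {L : ℝ}
    (hL : 1 ≤ S.stopFactor / S.eps (k + 1) * L)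
    (hgap : ∀ᵐ ω ∂prob, S.lyap (S.outer (fun k K τ => U k K τ ω) k).y
      (S.innerInit (S.outer (fun k K τ => U k K τ ω) k).α) ≤ L) :
    (∫⁻ ω, (S.T (fun k K τ => U k K τ ω) (k + 1) : ℝ≥0∞) ∂prob
      ≤ ENNReal.ofReal (1 / S.contr * (3 + Real.log (S.stopFactor / S.eps (k + 1) * L)))) ∧
    ∀ᵐ ω ∂prob, S.T (fun k K τ => U k K τ ω) (k + 1) ≠ ⊤ := by
  set Y := S.stopFactor / S.eps (k + 1) * L with hY
  have hr := h.contr_pos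
  have hr1 := h.contr_le_one
  have hB : 0 ≤ S.stopFactor / S.eps (k + 1) := (div_pos h.stopFactor_pos (h.eps_pos _)).le
  set ℓ : ℕ → Ω → ℝ≥0∞ := fun K ω => ENNReal.ofReal (S.stopFactor / S.eps (k + 1))
    * ENNReal.ofReal (S.lyap (S.outer (fun k K τ => U k K τ ω) k).y
      (S.iter (S.outer (fun k K τ => U k K τ ω) k).y (S.outer (fun k K τ => U k K τ ω) k).α
        (fun K τ => U (k + 1) K τ ω) K)) with hℓ
  have hmeas : ∀ K, Measurable (ℓ K) := fun K => by
    obtain ⟨-, hy, hα⟩ := h.measurable_outer (U := U) (k := k)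
      fun j _ K τ => hU.measurable j K τ
    exact ((h.measurable_lyap hy (h.measurable_iter (W := U (k + 1)) hy hα
      fun K _ τ => hU.measurable (k + 1) K τ)).ennreal_ofReal).const_mul _
  have hdom : ∀ ω, (S.T (fun k K τ => U k K τ ω) (k + 1) : ℝ≥0∞)
      ≤ 1 + ∑' K, min 1 (ℓ K ω) := fun ω =>
    h.stopTime_le_tsum _ (h.dualFinite_outer _ k) (h.eps_pos (k + 1)) _
  have hint : ∀ K, ∫⁻ ω, ℓ K ω ∂prob
      ≤ ENNReal.ofReal (1 - S.contr) ^ K * ENNReal.ofReal Y := fun K => by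
    have h1 := h.lintegral_iter_le hU k K
    have h2 : ∫⁻ ω, ENNReal.ofReal (S.lyap (S.outer (fun k K τ => U k K τ ω) k).y
        (S.innerInit (S.outer (fun k K τ => U k K τ ω) k).α)) ∂prob ≤ ENNReal.ofReal L :=
      calc _ ≤ ∫⁻ _, ENNReal.ofReal L ∂prob :=
            lintegral_mono_ae (hgap.mono fun ω hω => ENNReal.ofReal_le_ofReal hω)
        _ = _ := by simp
    rw [hℓ, lintegral_const_mul' _ _ ENNReal.ofReal_ne_top, hY, ENNReal.ofReal_mul hB]
    calc _ ≤ ENNReal.ofReal (S.stopFactor / S.eps (k + 1))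
          * (ENNReal.ofReal (1 - S.contr) ^ K * ENNReal.ofReal L) := by
          gcongr
          exact h1.trans (by gcongr)
      _ = _ := by ring
  have hsum : ∫⁻ ω, (1 + ∑' K, min 1 (ℓ K ω)) ∂prob
      ≤ ENNReal.ofReal (1 / S.contr * (3 + Real.log Y)) := by
    have hlog := Real.log_nonneg hL
    rw [lintegral_add_left measurable_const, lintegral_tsum fun K =>
      (measurable_const.min (hmeas K)).aemeasurable]
    calc _ ≤ ENNReal.ofReal (1 / S.contr) + ENNReal.ofReal (1 / S.contr * (2 + Real.log Y)) := by
          refine add_le_add ?_ (le_trans (ENNReal.tsum_le_tsum fun K => ?_)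
            (tsum_min_one_le hr hr1 hL))
          · simp only [lintegral_const, measure_univ, mul_one]
            rw [ENNReal.one_le_ofReal, one_le_div hr]
            exact hr1
          · refine le_min ?_ ((lintegral_mono fun ω => min_le_right _ _).trans (hint K))
            calc _ ≤ ∫⁻ _, (1 : ℝ≥0∞) ∂prob := lintegral_mono fun ω => min_le_left _ _
              _ = 1 := by simp
      _ = _ := by
          rw [← ENNReal.ofReal_add (by positivity) (by positivity)]
          congr 1
          ring
  refine ⟨(lintegral_mono hdom).trans hsum, ?_⟩
  -- Almost sure finiteness is read off from the measurable majorant, so measurability of T is not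
  -- needed.
  have hm : Measurable fun ω => 1 + ∑' K, min 1 (ℓ K ω) :=
    measurable_const.add (Measurable.tsum fun K => measurable_const.min (hmeas K))
  filter_upwards [ae_lt_top hm (hsum.trans_lt ENNReal.ofReal_lt_top).ne] with ω hω hT
  have := hdom ω
  rw [hT] at this
  exact (this.trans_lt hω).ne (by simp)

end Valid

end Setup

namespace Setup

set_option linter.unusedSectionVars false

variable {d t m n : ℕ} {Ξ : Type*} [MeasurableSpace Ξ] {S : Setup d t m n Ξ} {ν : Measure Ξ}
  [IsProbabilityMeasure ν] {Ω : Type*} [mΩ : MeasurableSpace Ω] {prob : Measure Ω}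
  [IsProbabilityMeasure prob] {U : ℕ → ℕ → Fin n → Ω → Fin m × Ξ}

/-- The argument of the logarithm in `logFactor`. -/
def logArg (S : Setup d t m n Ξ) : ℝ :=
  S.N / S.δ * (1 + S.RSq / (S.γ * S.mu)) * (S.mu / S.lam) / (√S.q - S.ρ₀)

omit [MeasurableSpace Ξ] in
lemma lyap_innerInit (y : Vec d) (α : Fin n → Fin m → Vec t) :
    S.lyap y (S.innerInit α) = S.Gmin y - S.dualR y α := by
  simp [lyap, errR, innerInit]

namespace Valid

variable (h : S.Valid ν)
include h

/-! ### Constants in the complexity bound -/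

lemma one_div_contr_le : 1 / S.contr ≤ 60 * S.rate := by
  have h1 := h.theta_inv_le
  have h2 : 1 / S.δ ≤ S.rate := by
    have := h.γmu_pos
    have := h.δ_pos
    have := h.RSq_nonneg
    have : 0 ≤ m + (S.Rm ^ 2 / n / (S.γ * S.mu) + S.RSq / (S.γ * S.mu)
      + √(1 - S.δ) / S.δ * (S.RSq / (S.γ * S.mu))) := by positivity
    rw [h.rate_eq]
    linarith
  have h3 := h.rate_pos
  unfold contr
  rcases min_choice S.theta (S.δ / 4) with h4 | h4 <;> rw [h4]
  · rwa [one_div]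
  · rw [one_div_div, div_eq_mul_one_div]
    linarith

/-- √(2 + δm) ≤ 3m and 1/θ ≤ 60 `rate` give 9m + 120 `rate` ≤ 129 `rate`, and 129 · 3 = 387. -/
lemma stopFactor_le : S.stopFactor ≤ 387 * (S.N / S.δ * (1 + S.RSq / (S.γ * S.mu))) := by
  have h1 := h.theta_inv_le
  have hm : (1 : ℝ) ≤ m := by exact_mod_cast h.one_le_m
  have h2 : (m : ℝ) ≤ S.rate := by
    have := h.γmu_pos
    have := h.δ_pos
    have := h.RSq_nonneg
    have : 0 ≤ 1 / S.δ + (S.Rm ^ 2 / n / (S.γ * S.mu) + S.RSq / (S.γ * S.mu)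
      + √(1 - S.δ) / S.δ * (S.RSq / (S.γ * S.mu))) := by positivity
    rw [h.rate_eq]
    linarith
  have h3 : √(2 + S.δ * m) ≤ 3 * m := by
    rw [Real.sqrt_le_left (by positivity)]
    nlinarith [h.δ_lt_one]
  have h4 := h.rate_le
  unfold stopFactor
  rw [div_eq_mul_inv]
  linarith

lemma one_le_mu_div : 1 ≤ S.mu / S.lam := (one_le_div h.lam_pos).2 h.lam_le_mu

lemma one_le_smooth : 1 ≤ 1 + S.RSq / (S.γ * S.mu) := by
  have := h.γmu_pos
  have := h.RSq_nonneg
  have : 0 ≤ S.RSq / (S.γ * S.mu) := by positivity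
  linarith

lemma gap_le_one : √S.q - S.ρ₀ ≤ 1 := h.gap_le.trans h.one_sub_ρ₀_le

lemma le_logArg : S.N / S.δ * (1 + S.RSq / (S.γ * S.mu)) / (√S.q - S.ρ₀) ≤ S.logArg := by
  have hg := h.gap_pos'
  have h1 := h.one_le_N_div
  have h2 := h.one_le_smooth
  have h3 := h.one_le_mu_div
  unfold logArg
  exact div_le_div_of_nonneg_right (le_mul_of_one_le_right (by positivity) h3) hg.le

lemma one_le_logArg : 1 ≤ S.logArg := by
  refine le_trans ?_ h.le_logArg
  rw [one_le_div h.gap_pos']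
  exact h.gap_le_one.trans (one_le_mul_of_one_le_of_one_le h.one_le_N_div h.one_le_smooth)

/-- The fifth power matches `prox_center_bound`; in the logarithm it costs only a factor 5. -/
lemma le_logArg_pow : S.N / S.δ * (1 + S.RSq / (S.γ * S.mu)) * (S.mu / S.lam)
    / (√S.q - S.ρ₀) ^ 5 ≤ S.logArg ^ 5 := by
  have hg := h.gap_pos'
  have h1 : 1 ≤ S.N / S.δ * (1 + S.RSq / (S.γ * S.mu)) * (S.mu / S.lam) :=
    one_le_mul_of_one_le_of_one_le
      (one_le_mul_of_one_le_of_one_le h.one_le_N_div h.one_le_smooth) h.one_le_mu_div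
  unfold logArg
  rw [div_pow]
  gcongr
  exact le_self_pow₀ h1 (by norm_num)

/-- The complexity of an inner loop whose initial gap is polynomially bounded. -/
lemma lintegral_T_le_rate (hU : IsSampling prob ν U) (k : ℕ) {B : ℝ} (hB : 1 ≤ B)
    (hgap : ∀ᵐ ω ∂prob, S.stopFactor * S.lyap (S.outer (fun k K τ => U k K τ ω) k).y
      (S.innerInit (S.outer (fun k K τ => U k K τ ω) k).α)
        ≤ S.eps (k + 1) * (2 ^ 21 * S.logArg ^ 5 * B)) :
    (∫⁻ ω, (S.T (fun k K τ => U k K τ ω) (k + 1) : ℝ≥0∞) ∂prob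
      ≤ ENNReal.ofReal (1536 * S.rate * (S.logFactor + Real.log B))) ∧
    ∀ᵐ ω ∂prob, S.T (fun k K τ => U k K τ ω) (k + 1) ≠ ⊤ := by
  have hs := h.stopFactor_pos
  have hε := h.eps_pos (k + 1)
  have hA := h.one_le_logArg
  have hrate := h.rate_pos
  have hY : S.stopFactor / S.eps (k + 1)
      * (S.eps (k + 1) * (2 ^ 21 * S.logArg ^ 5 * B) / S.stopFactor)
      = 2 ^ 21 * S.logArg ^ 5 * B := by
    field_simp
  have hlogA := Real.log_nonneg hA
  have hlogB := Real.log_nonneg hB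
  have hlog : Real.log (2 ^ 21 * S.logArg ^ 5 * B)
      = 21 * Real.log 2 + 5 * Real.log S.logArg + Real.log B := by
    rw [Real.log_mul (by positivity) (by positivity), Real.log_mul (by positivity) (by positivity),
      Real.log_pow, Real.log_pow]
    norm_num
  obtain ⟨h1, h2⟩ := h.lintegral_T_le hU k
    (L := S.eps (k + 1) * (2 ^ 21 * S.logArg ^ 5 * B) / S.stopFactor)
    (by
      rw [hY]
      exact one_le_mul_of_one_le_of_one_le
        (one_le_mul_of_one_le_of_one_le (by norm_num) (one_le_pow₀ hA)) hB)
    (hgap.mono fun ω hω => by rwa [le_div_iff₀' hs])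
  refine ⟨h1.trans (ENNReal.ofReal_le_ofReal ?_), h2⟩
  rw [hY, hlog]
  have h3 := Real.log_two_lt_d9
  -- Both 3 + 21 log 2 and 5 are below 25.6, and 60 · 25.6 = 1536 is the universal constant.
  calc 1 / S.contr * (3 + (21 * Real.log 2 + 5 * Real.log S.logArg + Real.log B))
      ≤ (60 * S.rate) * (25.6 * ((1 + Real.log S.logArg) + Real.log B)) := by
        refine mul_le_mul h.one_div_contr_le (by linarith) ?_ (by positivity)
        have := Real.log_nonneg one_le_two
        positivity
    _ = 1536 * S.rate * (S.logFactor + Real.log B) := by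
        change _ = 1536 * S.rate * (1 + Real.log S.logArg + Real.log B)
        ring

/-! ### Initial gaps of the inner loops -/

lemma initGap_eq : S.Gmin S.x₀ - S.dualR S.x₀ 0 = S.initGap * (S.P S.x₀ - S.Pmin) := by
  have h1 := sub_pos.2 h.gap_pos
  unfold initGap
  rw [← h.coe_dualR S.x₀ h.dualFinite_zero, ← EReal.coe_sub, EReal.toReal_coe,
    div_mul_cancel₀ _ h1.ne']

lemma initGap_nonneg : 0 ≤ S.initGap := by
  have h1 := h.initGap_eq
  have h2 := h.dualR_le_Gmin S.x₀ h.dualFinite_zero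
  exact nonneg_of_mul_nonneg_left (h1 ▸ sub_nonneg.2 h2) (sub_pos.2 h.gap_pos)

lemma first_gap_le : S.stopFactor * S.lyap S.x₀ (S.innerInit 0)
    ≤ S.eps 1 * (2 ^ 21 * S.logArg ^ 5 * (1 + S.initGap)) := by
  have hg := h.gap_pos'
  have hP := sub_pos.2 h.gap_pos
  have hI := h.initGap_nonneg
  have hA := h.one_le_logArg
  have h1 := h.le_logArg
  have h2 : S.logArg ≤ S.logArg ^ 5 := le_self_pow₀ hA (by norm_num)
  have h3 := h.stopFactor_le
  rw [div_le_iff₀ hg] at h1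
  have h4 : S.stopFactor ≤ 387 * (S.logArg ^ 5 * (1 - S.ρ₀)) := by
    have : S.logArg * (√S.q - S.ρ₀) ≤ S.logArg ^ 5 * (1 - S.ρ₀) := by
      gcongr
      exact h.sqrt_q_le_one
    linarith
  have h5 := h.one_sub_ρ₀_pos
  rw [lyap_innerInit, h.initGap_eq]
  unfold eps
  calc S.stopFactor * (S.initGap * (S.P S.x₀ - S.Pmin))
      ≤ 387 * (S.logArg ^ 5 * (1 - S.ρ₀)) * ((1 + S.initGap) * (S.P S.x₀ - S.Pmin)) := by
        gcongr
        linarith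
    _ ≤ 2 / 9 * 2 ^ 21 * (S.logArg ^ 5 * (1 - S.ρ₀))
        * ((1 + S.initGap) * (S.P S.x₀ - S.Pmin)) := by
        gcongr
        norm_num
    _ = _ := by ring

/-- The criterion is a sum of nonnegative terms, so stopping certifies each of them on the given
path: primal accuracy for Catalyst and dual accuracy for the next warm start. -/
lemma of_T_ne_top {w : ℕ → InnerDraws m n Ξ} {j : ℕ} (hT : S.T w (j + 1) ≠ ⊤) :
    S.G (S.outer w j).y (S.outer w (j + 1)).x - S.Gmin (S.outer w j).y ≤ S.eps (j + 1) ∧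
    S.Gmin (S.outer w j).y - S.dualR (S.outer w j).y (S.outer w (j + 1)).α ≤ S.eps (j + 1) := by
  set s := S.iter (S.outer w j).y (S.outer w j).α (w (j + 1))
    (S.count (j + 1) (S.outer w j) (w (j + 1))).toNat with hs
  have hinv : S.Inv s := h.inv_iter _ (h.dualFinite_outer w j) _ _
  have h1 : S.Stop (S.outer w j).y (S.eps (j + 1)) s := stop_of_ne_top hT
  rw [h.stop_iff _ _ hinv.finite] at h1
  change S.G (S.outer w j).y (S.primal (S.outer w j).y s) - _ ≤ _ ∧ _ - S.dualR _ s.α ≤ _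
  have h2 := h.lyap_nonneg (S.outer w j).y hinv
  have h3 := h.Gmin_le (S.outer w j).y (S.primal (S.outer w j).y s)
  have h4 := h.errR_nonneg s
  have h5 : 1 ≤ √(2 + S.δ * m) := by
    rw [Real.one_le_sqrt]
    have := mul_nonneg h.δ_pos.le h.m_pos.le
    linarith
  have h6 : S.lyap (S.outer w j).y s ≤ 3 * √(2 + S.δ * m) * S.lyap (S.outer w j).y s :=
    le_mul_of_one_le_left h2 (by linarith)
  have h7 : S.Gmin (S.outer w j).y - S.dualR (S.outer w j).y s.α ≤ S.lyap (S.outer w j).y s := by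
    unfold lyap
    linarith
  constructor <;> linarith

/-- After a warm start the gap is at most 2ε_{K+1} plus the cost of the moved prox-center. Both are
polynomial multiples of ε_{K+2}, on every path on which the earlier loops stopped. -/
lemma later_gap_le {w : ℕ → InnerDraws m n Ξ} {K : ℕ} (hT : ∀ j ≤ K, S.T w (j + 1) ≠ ⊤) :
    S.stopFactor * S.lyap (S.outer w (K + 1)).y (S.innerInit (S.outer w (K + 1)).α)
      ≤ S.eps (K + 2) * (2 ^ 21 * S.logArg ^ 5 * 1) := by
  have hg := h.gap_pos'
  have hlam := h.lam_pos
  have hmu := h.mu_pos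
  have hκ := h.κ_nonneg
  have hε := h.eps_pos (K + 2)
  have h1 := h.one_le_N_div
  have h2 := h.one_le_smooth
  have h3 := h.one_le_mu_div
  have hprox := h.prox_center_bound (x := fun j => (S.outer w j).x) (y := fun j => (S.outer w j).y)
    rfl rfl (fun _ => rfl) (K := K) fun j hj => (h.of_T_ne_top (hT j (by omega))).1
  have hwarm := h.warm_start (S.outer w K).y (S.outer w (K + 1)).y
    (h.dualFinite_outer w (K + 1))
  have hΓ := (h.of_T_ne_top (hT K le_rfl)).2
  have hκμ : S.κ ^ 2 / S.mu * ‖(S.outer w (K + 1)).y - (S.outer w K).y‖ ^ 2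
      ≤ S.mu / S.lam * (5184 / (√S.q - S.ρ₀) ^ 5 * S.eps (K + 2)) := by
    have i1 : S.κ ^ 2 / S.mu ≤ S.mu := by
      rw [div_le_iff₀ hmu, ← pow_two]
      gcongr
      unfold mu
      linarith
    calc _ ≤ S.mu * ‖(S.outer w (K + 1)).y - (S.outer w K).y‖ ^ 2 := by gcongr
      _ = S.mu / S.lam * (S.lam * ‖(S.outer w (K + 1)).y - (S.outer w K).y‖ ^ 2) := by
          field_simp
      _ ≤ _ := by gcongr
  have hεK : 2 * S.eps (K + 1) ≤ S.mu / S.lam * (2 / (√S.q - S.ρ₀) ^ 5 * S.eps (K + 2)) := by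
    have i1 : S.eps (K + 2) = (1 - S.ρ₀) * S.eps (K + 1) := by
      unfold eps
      ring
    have i2 := h.eps_pos (K + 1)
    have i3 : (√S.q - S.ρ₀) ^ 5 ≤ 1 - S.ρ₀ :=
      (pow_le_of_le_one hg.le h.gap_le_one (by norm_num)).trans h.gap_le
    have i4 : 2 * S.eps (K + 1) ≤ 2 / (√S.q - S.ρ₀) ^ 5 * S.eps (K + 2) := by
      rw [i1, div_mul_eq_mul_div, le_div_iff₀ (by positivity)]
      nlinarith
    exact i4.trans (le_mul_of_one_le_left (by positivity) h3)
  have hgap : S.lyap (S.outer w (K + 1)).y (S.innerInit (S.outer w (K + 1)).α)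
      ≤ S.mu / S.lam * (5186 / (√S.q - S.ρ₀) ^ 5 * S.eps (K + 2)) := by
    rw [lyap_innerInit]
    have e : S.mu / S.lam * (5186 / (√S.q - S.ρ₀) ^ 5 * S.eps (K + 2))
        = S.mu / S.lam * (2 / (√S.q - S.ρ₀) ^ 5 * S.eps (K + 2))
          + S.mu / S.lam * (5184 / (√S.q - S.ρ₀) ^ 5 * S.eps (K + 2)) := by ring
    linarith
  have hs := h.stopFactor_pos
  calc _ ≤ 387 * (S.N / S.δ * (1 + S.RSq / (S.γ * S.mu)))
        * (S.mu / S.lam * (5186 / (√S.q - S.ρ₀) ^ 5 * S.eps (K + 2))) :=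
        mul_le_mul h.stopFactor_le hgap
          (h.lyap_nonneg _ (h.inv_init (h.dualFinite_outer w (K + 1)))) (by positivity)
    _ = S.eps (K + 2) * (387 * 5186 * (S.N / S.δ * (1 + S.RSq / (S.γ * S.mu)) * (S.mu / S.lam)
        / (√S.q - S.ρ₀) ^ 5)) := by ring
    -- 5186 = 5184 + 2 collects both contributions, and 387 · 5186 < 2^21.
    _ ≤ S.eps (K + 2) * (2 ^ 21 * S.logArg ^ 5 * 1) := by
        have := h.le_logArg_pow
        rw [mul_one]
        gcongr
        norm_num

/-- The complexity of the first inner loop. -/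
lemma lintegral_T_one_le (hU : IsSampling prob ν U) :
    (∫⁻ ω, (S.T (fun k K τ => U k K τ ω) 1 : ℝ≥0∞) ∂prob
      ≤ ENNReal.ofReal (1536 * S.rate * (S.logFactor + Real.log (1 + S.initGap)))) ∧
    ∀ᵐ ω ∂prob, S.T (fun k K τ => U k K τ ω) 1 ≠ ⊤ :=
  h.lintegral_T_le_rate hU 0 (by linarith [h.initGap_nonneg])
    (Filter.Eventually.of_forall fun _ => h.first_gap_le)

/-- The complexity of the later inner loops, provided that the earlier ones terminate. -/
lemma lintegral_T_add_two_le (hU : IsSampling prob ν U) {k : ℕ}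
    (hT : ∀ j ≤ k, ∀ᵐ ω ∂prob, S.T (fun k K τ => U k K τ ω) (j + 1) ≠ ⊤) :
    (∫⁻ ω, (S.T (fun k K τ => U k K τ ω) (k + 2) : ℝ≥0∞) ∂prob
      ≤ ENNReal.ofReal (1536 * S.rate * S.logFactor)) ∧
    ∀ᵐ ω ∂prob, S.T (fun k K τ => U k K τ ω) (k + 2) ≠ ⊤ := by
  have h1 := h.lintegral_T_le_rate hU (k + 1) le_rfl (by
    have h2 : ∀ᵐ ω ∂prob, ∀ j, j ≤ k → S.T (fun k K τ => U k K τ ω) (j + 1) ≠ ⊤ :=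
      ae_all_iff.2 fun j => Filter.eventually_imp_distrib_left.2 (hT j)
    filter_upwards [h2] with ω hω
    exact h.later_gap_le hω)
  rwa [Real.log_one, add_zero] at h1

/-- Almost surely, every inner loop terminates. -/
lemma ae_T_ne_top (hU : IsSampling prob ν U) (k : ℕ) :
    ∀ᵐ ω ∂prob, S.T (fun k K τ => U k K τ ω) (k + 1) ≠ ⊤ := by
  induction k using Nat.strong_induction_on with
  | _ k ih =>
    rcases k with _ | k
    · exact (h.lintegral_T_one_le hU).2
    · exact (h.lintegral_T_add_two_le hU fun j hj => ih j (by omega)).2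

end Valid

end Setup

end

end ECSDCA
theorem mainTheorem8 :
    ∃ C : ℝ, 0 < C ∧
      ∀ (d t m n : ℕ) (_ : 1 ≤ m) (_ : 1 ≤ n)
        (Ξ : Type*) [MeasurableSpace Ξ] (ν : Measure Ξ) [IsProbabilityMeasure ν]
        (Ω : Type*) [MeasurableSpace Ω] (prob : Measure Ω) [IsProbabilityMeasure prob]
        (S : ECSDCA.Setup d t m n Ξ)
        (U : ℕ → ℕ → Fin n → Ω → Fin m × Ξ) (_ : ECSDCA.IsSampling prob ν U)
        -- the problem
        (_ : 0 < S.lam) (_ : 0 < S.γ)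
        (_ : ∀ τ i, ECSDCA.ConvexSmooth (S.φ τ i) (1 / S.γ))
        (_ : ∀ τ i, BddBelow (Set.range (S.φ τ i)))
        (_ : StrongConvexOn Set.univ S.lam S.g)
        -- the compressor
        (_ : ECSDCA.IsContractionCompressor ν S.Q S.δ) (_ : S.δ < 1)
        (_ : ∀ x, ∫ ξ, S.Q ξ x ∂ν = S.δ • x)
        -- the parameters of the outer loop
        (_ : 0 ≤ S.κ) (_ : 0 ≤ S.ρ₀) (_ : S.ρ₀ < √S.q) (_ : S.Pmin < S.P S.x₀),
        (∫⁻ ω, (S.T (fun k K τ => U k K τ ω) 1 : ℝ≥0∞) ∂prob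
            ≤ ENNReal.ofReal (C * S.rate * (S.logFactor + Real.log (1 + S.initGap)))) ∧
        ∀ k : ℕ, 2 ≤ k →
          ∫⁻ ω, (S.T (fun k K τ => U k K τ ω) k : ℝ≥0∞) ∂prob
            ≤ ENNReal.ofReal (C * S.rate * S.logFactor) := by
  refine ⟨1536, by norm_num, ?_⟩
  intro d t m n hm hn Ξ _ ν _ Ω _ prob _ S U hU hlam hγ hsmooth hbdd hstrong hQ hδ hmean hκ hρ hρq
    hgap
  have h : S.Valid ν := ⟨hm, hn, hlam, hγ, hsmooth, hbdd, hstrong, hQ, hδ, hmean, hκ, hρ, hρq, hgap⟩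
  refine ⟨(h.lintegral_T_one_le hU).1, fun k hk => ?_⟩
  obtain ⟨k, rfl⟩ := Nat.exists_eq_add_of_le' hk
  exact (h.lintegral_T_add_two_le hU fun j _ => h.ae_T_ne_top hU j).1
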